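/- There are an absolute constant $C>0$, a polynomial $T$, and a single deterministic algorithm with the following property. Let $G=(V,E,w)$ be a finite simple undirected graph on $n=|V|$ vertices with edge weights $w:E\to[0,\infty)$, and let $0\le\varepsilon\le 1$. On input $(G,\varepsilon)$ the algorithm halts after at most $T(n)$ steps and outputs a subgraph $H=(V,E',w)$, $E'\subseteq E$, with \[ |E'|\le C\,n^{1+\varepsilon} \] such that for all $u,v\in V$ and every shortest $u$–$v$ path $P$ of $G$, \[ d_H(u,v)\le d_G(u,v)+C\,n^{\frac{1-\varepsilon}{2}}\log n\cdot W(P), \] where $d_G,d_H$ are the weighted shortest-path distances and $W(P)$ is the weight of the heaviest edge of $P$ (and $W(P)=0$ if $P$ has no edge). In other words, $H$ is a $+O(n^{(1-\varepsilon)/2}\log n)W$ spanner of size $O(n^{1+\varepsilon})$. In particular, for $\varepsilon=0$ one obtains a spanner with $O(n)$ edges and additive stretch $O(\sqrt n\log n)\cdot W$. Here steps are counted on a random access machine whose memory holds natural numbers and real numbers (the weights and $\varepsilon$ are given as real numbers, the graph by its adjacency matrix), and in which additions, subtractions and comparisons, as well as memory accesses, cost one step each. -/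

import Mathlib

open scoped NNReal ENNReal

/-! ### Weighted graphs, distances and additive spanners -/

/-- A finite undirected graph on the vertex set `Fin n` with nonnegative real edge weights.
Only the values of `w` on edges of `graph` are ever used. -/
structure WeightedGraph (n : ℕ) where
  graph : SimpleGraph (Fin n)
  w : Sym2 (Fin n) → ℝ≥0

namespace WeightedGraph

/-- The length of a walk: the sum of the weights of its edges. -/
def length {V : Type*} (w : Sym2 V → ℝ≥0) {H : SimpleGraph V} {u v : V} (p : H.Walk u v) : ℝ≥0 :=
  (p.edges.map w).sum

/-- The weight of the heaviest edge of a walk (`0` for a walk without edges). -/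
def heaviest {V : Type*} (w : Sym2 V → ℝ≥0) {H : SimpleGraph V} {u v : V} (p : H.Walk u v) : ℝ≥0 :=
  (p.edges.map w).foldr max 0

/-- The weighted distance of `u` and `v` in `H`: the infimum of the lengths of the walks from `u`
to `v`; it is `∞` if there is none. -/
noncomputable def dist {V : Type*} (w : Sym2 V → ℝ≥0) (H : SimpleGraph V) (u v : V) : ℝ≥0∞ :=
  ⨅ p : H.Walk u v, (length w p : ℝ≥0∞)

/-- `p` is a shortest path between its end points. -/
def IsShortestPath {V : Type*} (w : Sym2 V → ℝ≥0) {H : SimpleGraph V} {u v : V}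
    (p : H.Walk u v) : Prop :=
  p.IsPath ∧ (length w p : ℝ≥0∞) = dist w H u v

/-- `H` is a `+c·W` spanner of `G`: a subgraph on the same vertices, with the same weights, such
that `d_H(u,v) ≤ d_G(u,v) + c · W(P)` for all `u`, `v` and *every* shortest `u`-`v` path `P` of
`G`, where `W(P)` is the weight of the heaviest edge of `P`. Hence the bound holds however ties
between shortest paths are broken. -/
def IsAdditiveSpanner {n : ℕ} (G : WeightedGraph n) (H : SimpleGraph (Fin n)) (c : ℝ) : Prop :=
  H ≤ G.graph ∧
    ∀ (u v : Fin n) (P : G.graph.Walk u v), IsShortestPath G.w P →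
      dist G.w H u v ≤ dist G.w G.graph u v + ENNReal.ofReal c * (heaviest G.w P : ℝ≥0∞)

end WeightedGraph

/-! ### The machine model

A deterministic random access machine with natural number registers and arrays (for counters,
addresses and flags) and real number registers and arrays. The only operations on natural numbers
are addition, truncated subtraction and comparison, the only operations on real numbers are
addition, subtraction and comparison; each operation and each memory access costs one step. In
particular there is no multiplication and no rounding, so unit cost is a realistic measure up to a
polynomial. A program is a finite text that does not depend on the input. -/

namespace RealRAM

/-- The memory: scalar registers and two-dimensional arrays, named by natural numbers. -/
@[ext]
structure State where
  nreg : ℕ → ℕ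
  narr : ℕ → ℕ → ℕ → ℕ
  rreg : ℕ → ℝ
  rarr : ℕ → ℕ → ℕ → ℝ

/-- Expressions with natural number values; `cell a i j` reads entry `(i, j)` of array `a`. -/
inductive NExp where
  | lit (k : ℕ)
  | reg (x : ℕ)
  | cell (a : ℕ) (i j : NExp)
  | add (e f : NExp)
  | sub (e f : NExp)

def NExp.eval (s : State) : NExp → ℕ
  | lit k => k
  | reg x => s.nreg x
  | cell a i j => s.narr a (i.eval s) (j.eval s)
  | add e f => e.eval s + f.eval s
  | sub e f => e.eval s - f.eval s

def NExp.cost : NExp → ℕ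
  | lit _ => 1
  | reg _ => 1
  | cell _ i j => i.cost + j.cost + 1
  | add e f => e.cost + f.cost + 1
  | sub e f => e.cost + f.cost + 1

/-- Expressions with real values. -/
inductive RExp where
  | lit (k : ℕ)
  | reg (x : ℕ)
  | cell (a : ℕ) (i j : NExp)
  | add (e f : RExp)
  | sub (e f : RExp)

noncomputable def RExp.eval (s : State) : RExp → ℝ
  | lit k => k
  | reg x => s.rreg x
  | cell a i j => s.rarr a (i.eval s) (j.eval s)
  | add e f => e.eval s + f.eval s
  | sub e f => e.eval s - f.eval s

def RExp.cost : RExp → ℕ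
  | lit _ => 1
  | reg _ => 1
  | cell _ i j => i.cost + j.cost + 1
  | add e f => e.cost + f.cost + 1
  | sub e f => e.cost + f.cost + 1

/-- Tests. -/
inductive Test where
  | nle (e f : NExp)
  | rle (e f : RExp)
  | not (b : Test)
  | and (b c : Test)

def Test.Holds (s : State) : Test → Prop
  | nle e f => e.eval s ≤ f.eval s
  | rle e f => e.eval s ≤ f.eval s
  | not b => ¬ b.Holds s
  | and b c => b.Holds s ∧ c.Holds s

def Test.cost : Test → ℕ
  | nle e f => e.cost + f.cost + 1
  | rle e f => e.cost + f.cost + 1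
  | not b => b.cost + 1
  | and b c => b.cost + c.cost + 1

/-- Programs: assignments to registers and array entries, composition, branching and
while-loops. -/
inductive Program where
  | skip
  | nset (x : ℕ) (e : NExp)
  | rset (x : ℕ) (e : RExp)
  | nput (a : ℕ) (i j : NExp) (e : NExp)
  | rput (a : ℕ) (i j : NExp) (e : RExp)
  | seq (c d : Program)
  | ite (b : Test) (c d : Program)
  | loop (b : Test) (c : Program)

/-- Overwriting one entry of one array. -/
def setCell {R : Type} (m : ℕ → ℕ → ℕ → R) (a i j : ℕ) (r : R) : ℕ → ℕ → ℕ → R :=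
  fun a' i' j' => if a' = a ∧ i' = i ∧ j' = j then r else m a' i' j'

/-- `Exec c s k t`: started in `s`, the program `c` halts in the state `t` after `k` steps. -/
inductive Exec : Program → State → ℕ → State → Prop
  | skip (s : State) : Exec .skip s 1 s
  | nset (s : State) (x : ℕ) (e : NExp) :
      Exec (.nset x e) s (e.cost + 1) { s with nreg := Function.update s.nreg x (e.eval s) }
  | rset (s : State) (x : ℕ) (e : RExp) :
      Exec (.rset x e) s (e.cost + 1) { s with rreg := Function.update s.rreg x (e.eval s) }
  | nput (s : State) (a : ℕ) (i j : NExp) (e : NExp) :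
      Exec (.nput a i j e) s (i.cost + j.cost + e.cost + 1)
        { s with narr := setCell s.narr a (i.eval s) (j.eval s) (e.eval s) }
  | rput (s : State) (a : ℕ) (i j : NExp) (e : RExp) :
      Exec (.rput a i j e) s (i.cost + j.cost + e.cost + 1)
        { s with rarr := setCell s.rarr a (i.eval s) (j.eval s) (e.eval s) }
  | seq {c d : Program} {s t r : State} {k l : ℕ} :
      Exec c s k t → Exec d t l r → Exec (.seq c d) s (k + l) r
  | ite_true {b : Test} {c d : Program} {s t : State} {k : ℕ} :
      b.Holds s → Exec c s k t → Exec (.ite b c d) s (b.cost + k + 1) t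
  | ite_false {b : Test} {c d : Program} {s t : State} {k : ℕ} :
      ¬ b.Holds s → Exec d s k t → Exec (.ite b c d) s (b.cost + k + 1) t
  | loop_done {b : Test} {c : Program} {s : State} :
      ¬ b.Holds s → Exec (.loop b c) s (b.cost + 1) s
  | loop_step {b : Test} {c : Program} {s t r : State} {k l : ℕ} :
      b.Holds s → Exec c s k t → Exec (.loop b c) t l r →
        Exec (.loop b c) s (b.cost + k + l + 1) r

/-- The machine is deterministic: final state and number of steps are determined by the program
and the initial state. -/
theorem Exec.deterministic {c : Program} {s t : State} {k : ℕ} (h : Exec c s k t) :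
    ∀ {l : ℕ} {r : State}, Exec c s l r → k = l ∧ t = r := by
  induction h with
  | skip => intro l r h'; cases h'; exact ⟨rfl, rfl⟩
  | nset => intro l r h'; cases h'; exact ⟨rfl, rfl⟩
  | rset => intro l r h'; cases h'; exact ⟨rfl, rfl⟩
  | nput => intro l r h'; cases h'; exact ⟨rfl, rfl⟩
  | rput => intro l r h'; cases h'; exact ⟨rfl, rfl⟩
  | seq _ _ ih₁ ih₂ =>
    intro l r h'
    cases h' with
    | seq h₁ h₂ =>
      obtain ⟨rfl, rfl⟩ := ih₁ h₁
      obtain ⟨rfl, rfl⟩ := ih₂ h₂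
      exact ⟨rfl, rfl⟩
  | ite_true hb _ ih =>
    intro l r h'
    cases h' with
    | ite_true _ h₁ => obtain ⟨rfl, rfl⟩ := ih h₁; exact ⟨rfl, rfl⟩
    | ite_false hb' _ => exact absurd hb hb'
  | ite_false hb _ ih =>
    intro l r h'
    cases h' with
    | ite_true hb' _ => exact absurd hb' hb
    | ite_false _ h₁ => obtain ⟨rfl, rfl⟩ := ih h₁; exact ⟨rfl, rfl⟩
  | loop_done hb =>
    intro l r h'
    cases h' with
    | loop_done _ => exact ⟨rfl, rfl⟩
    | loop_step hb' _ _ => exact absurd hb' hb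
  | loop_step hb _ _ ih₁ ih₂ =>
    intro l r h'
    cases h' with
    | loop_done hb' => exact absurd hb hb'
    | loop_step _ h₁ h₂ =>
      obtain ⟨rfl, rfl⟩ := ih₁ h₁
      obtain ⟨rfl, rfl⟩ := ih₂ h₂
      exact ⟨rfl, rfl⟩

open Classical in
/-- The initial memory for a weighted graph `G` and a real parameter `ε`: natural register `0`
holds the number of vertices, natural array `0` the adjacency matrix, real register `0` the
parameter, real array `0` the weights of the edges; everything else is `0`. -/
noncomputable def input {n : ℕ} (G : WeightedGraph n) (ε : ℝ) : State where
  nreg x := if x = 0 then n else 0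
  narr a i j := if a = 0 ∧ ∃ (hi : i < n) (hj : j < n), G.graph.Adj ⟨i, hi⟩ ⟨j, hj⟩ then 1 else 0
  rreg x := if x = 0 then ε else 0
  rarr a i j :=
    if h : a = 0 ∧ ∃ (hi : i < n) (hj : j < n), G.graph.Adj ⟨i, hi⟩ ⟨j, hj⟩ then
      (G.w s(⟨i, h.2.1⟩, ⟨j, h.2.2.1⟩) : ℝ)
    else 0

/-- The graph `H` is the output stored in `s`: natural array `1` is its adjacency matrix. -/
def Outputs {n : ℕ} (s : State) (H : SimpleGraph (Fin n)) : Prop :=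
  ∀ i j : Fin n, (H.Adj i j → s.narr 1 i j = 1) ∧ (¬ H.Adj i j → s.narr 1 i j = 0)

end RealRAM

/-! ### Distances in weighted graphs -/

namespace WeightedGraph

variable {V : Type*} {w : Sym2 V → ℝ≥0} {H K : SimpleGraph V} {u v x : V}

/-! Edges are processed by nondecreasing weight; `M` is the graph of processed edges and `H` the
spanner so far. With L about log n, d about n^ε and r about √(n/d), put κ = 2L + 3 and R = 3r. An
edge enters `H` if an end has degree below d in `H`, or if its ends have distance more than κ times
its weight in `H`. After each edge, of weight ω say, all pairs are inspected. If `M` contains a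
shortest path of `G` for the pair, and the distance in `H` exceeds its length by more than R(8 +
κ)ω, then a shortest walk in `M` with as few edges missing from `H` as possible is bought.

Stretch: when the last edge of a shortest path P is processed, its weight is at most W(P), and the
pair is repaired in that round. Later the distances in `H` only shrink. So the bound holds for every
shortest path, and R(8 + κ) = O(n^((1-ε)/2) log n).

Size: edges added for small degree raise the sum of min(deg, d), which is at most nd. Edges added
for large distance form a graph without cycles of at most κ + 1 edges (`sup_edge`), hence have at
most 2n members: a subgraph of minimum degree three would have doubling layers (`ncard_edgeSet_le`).
If a new bought walk meets an earlier one twice, `H` is already exact between the two vertices, so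
minimality leaves no missing edge between them. Hence, apart from one edge per earlier walk, missing
edges start at vertices never touched before (`Tight.card_missing_le`), and p purchases add at most
n + p² edges.

To bound p, the excess R(8 + κ)ω is cut into R levels (`Tight.exists_charge`). At each level the
walk has a missing edge, whose first end has at least d neighbours in `H`. Different levels are so
far apart in `H` that these neighbourhoods are disjoint, and an earlier purchase can have charged
vertices of only one of them. So a purchase charges at least (R - p)d new vertices, and R²d > 4n
forces p < R/2. The total is O(nd + n + R²) = O(n^(1+ε)).

The algorithm is written with counter loops only, so it halts in polynomial time (`exec_compile`),
and it is verified by loop invariants. Distances come from a Bellman–Ford recursion on pairs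
(length, missing edges) in lexicographic order. -/

theorem length_nil : length w (SimpleGraph.Walk.nil : H.Walk u u) = 0 := by
  simp [length]

theorem length_cons (h : H.Adj u v) (p : H.Walk v x) :
    length w (SimpleGraph.Walk.cons h p) = w s(u, v) + length w p := by
  simp [length]

theorem length_append (p : H.Walk u v) (q : H.Walk v x) :
    length w (p.append q) = length w p + length w q := by
  simp [length]

theorem length_reverse (p : H.Walk u v) : length w p.reverse = length w p := by
  simp [length, List.sum_reverse]

theorem length_mapLe (h : H ≤ K) (p : H.Walk u v) : length w (p.mapLe h) = length w p := by
  simp [length]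

theorem dist_le_length (p : H.Walk u v) : dist w H u v ≤ length w p := iInf_le _ p

theorem dist_self (u : V) : dist w H u u = 0 := by
  refine le_antisymm ?_ bot_le
  simpa [length_nil] using dist_le_length (w := w) (SimpleGraph.Walk.nil : H.Walk u u)

theorem dist_triangle (u v x : V) : dist w H u x ≤ dist w H u v + dist w H v x := by
  unfold dist
  refine ENNReal.le_iInf_add_iInf fun p q => ?_
  rw [← ENNReal.coe_add, ← length_append]
  exact iInf_le _ _

theorem dist_comm (u v : V) : dist w H u v = dist w H v u := by
  apply le_antisymm <;>
  · refine le_iInf fun p => ?_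
    rw [← length_reverse]
    exact iInf_le _ _

theorem dist_mono (h : H ≤ K) (u v : V) : dist w K u v ≤ dist w H u v := by
  refine le_iInf fun p => ?_
  rw [← length_mapLe h]
  exact iInf_le _ _

theorem dist_le_of_adj (h : H.Adj u v) : dist w H u v ≤ w s(u, v) := by
  simpa [length_cons, length_nil] using
    dist_le_length (w := w) (SimpleGraph.Walk.cons h .nil : H.Walk u v)

/-- The edges of the bypass are distinct and occur among those of `p`, so they form a sub-multiset;
weights are nonnegative. -/
theorem length_bypass_le [DecidableEq V] (p : H.Walk u v) : length w p.bypass ≤ length w p := by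
  unfold length
  obtain ⟨l, hl, hs⟩ := (p.bypass_isPath).edges_nodup.subperm p.edges_bypass_subset_edges
  rw [← (hl.map w).sum_eq]
  exact (hs.map w).sum_le_sum (by simp)

/-- In a finite graph the distance is attained. -/
theorem exists_length_eq_dist [Finite V] (h : dist w H u v ≠ ⊤) :
    ∃ p : H.Walk u v, (length w p : ℝ≥0∞) = dist w H u v := by
  classical
  have := Fintype.ofFinite V
  have hne : Nonempty (H.Walk u v) := by
    by_contra hcon
    rw [not_nonempty_iff] at hcon
    exact h (by simp [dist])
  -- There may be infinitely many walks but only finitely many paths, and bypassing turns a walk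
  -- into a path of at most the same length.
  have hfin : Finite (H.Path u v) := inferInstance
  have : Nonempty (H.Path u v) := ⟨hne.some.toPath⟩
  obtain ⟨p, hp⟩ := Finite.exists_min (fun p : H.Path u v => length w p.1)
  refine ⟨p.1, le_antisymm (le_iInf fun q => ?_) (dist_le_length _)⟩
  exact_mod_cast (hp q.toPath).trans (length_bypass_le q)

end WeightedGraph

/-! ### Walks and vertex sequences -/

section Sequences

variable {V : Type*} {K : SimpleGraph V}

/-- A sequence of vertices with consecutive ones adjacent gives walks between its members. -/
theorem exists_walk_of_seq (a : ℕ → V) {i j : ℕ} (hij : i ≤ j)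
    (h : ∀ k, i ≤ k → k < j → K.Adj (a k) (a (k + 1))) :
    ∃ q : K.Walk (a i) (a j), ∀ {A : Type} [AddCommMonoid A] (f : Sym2 V → A),
      (q.edges.map f).sum = ∑ k ∈ Finset.Ico i j, f s(a k, a (k + 1)) := by
  induction j, hij using Nat.le_induction with
  | base => exact ⟨.nil, fun f => by simp⟩
  | succ j hij ih =>
    obtain ⟨q, hq⟩ := ih fun k hk hkj => h k hk (by omega)
    refine ⟨q.concat (h j hij (by omega)), fun f => ?_⟩
    rw [Finset.sum_Ico_succ_top hij, ← hq f]
    simp [SimpleGraph.Walk.edges_concat]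

theorem sum_edges_eq_sum_getVert {A : Type*} [AddCommMonoid A] (f : Sym2 V → A) {u v : V}
    (p : K.Walk u v) :
    (p.edges.map f).sum = ∑ k ∈ Finset.range p.length, f s(p.getVert k, p.getVert (k + 1)) := by
  induction p with
  | nil => simp
  | cons h p ih =>
    rw [SimpleGraph.Walk.length_cons, Finset.sum_range_succ', add_comm]
    simp [ih]

theorem mem_edges_iff_getVert {u v : V} (p : K.Walk u v) (e : Sym2 V) :
    e ∈ p.edges ↔ ∃ k < p.length, e = s(p.getVert k, p.getVert (k + 1)) := by
  induction p with
  | nil => simp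
  | cons h p ih =>
    simp only [SimpleGraph.Walk.edges_cons, List.mem_cons, ih, SimpleGraph.Walk.length_cons]
    constructor
    · rintro (rfl | ⟨k, hk, rfl⟩)
      · exact ⟨0, by omega, by simp⟩
      · exact ⟨k + 1, by omega, by simp⟩
    · rintro ⟨k, hk, rfl⟩
      rcases k with _ | k
      · left; simp
      · right; exact ⟨k, by omega, by simp⟩

end Sequences

/-! ### Graphs of large girth -/

/-- Every cycle of `F` has more than `κ + 1` edges. -/
def SimpleGraph.LargeGirth {V : Type*} (κ : ℕ) (F : SimpleGraph V) : Prop :=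
  ∀ a b, F.Adj a b → ∀ q : (F.deleteEdges {s(a, b)}).Walk a b, κ < q.length

namespace SimpleGraph.LargeGirth

variable {V : Type*} {κ : ℕ} {F K : SimpleGraph V}

theorem bot : (⊥ : SimpleGraph V).LargeGirth κ := fun _ _ h => h.elim

theorem anti (hF : F.LargeGirth κ) (h : K ≤ F) : K.LargeGirth κ := fun a b hab q => by
  simpa using hF a b (h hab) (q.mapLe (SimpleGraph.deleteEdges_mono h))

/-- A walk in `F` with one more edge `xy` either avoids `xy`, or passes it once after shortening. -/
theorem walk_sup_edge {F E : SimpleGraph V} {x y : V} (hE : ∀ a b, E.Adj a b → F.Adj a b ∨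
      (a = x ∧ b = y) ∨ (a = y ∧ b = x)) {a b : V} (q : E.Walk a b) :
    (∃ p : F.Walk a b, p.length ≤ q.length) ∨
    (∃ (p : F.Walk a x) (p' : F.Walk y b), p.length + p'.length + 1 ≤ q.length) ∨
    (∃ (p : F.Walk a y) (p' : F.Walk x b), p.length + p'.length + 1 ≤ q.length) := by
  induction q with
  | nil => exact .inl ⟨.nil, by simp⟩
  | @cons a c b h q ih =>
    simp only [SimpleGraph.Walk.length_cons]
    rcases hE a c h with hF | ⟨rfl, rfl⟩ | ⟨rfl, rfl⟩
    · rcases ih with ⟨p, hp⟩ | ⟨p, p', hp⟩ | ⟨p, p', hp⟩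
      · exact .inl ⟨.cons hF p, by simpa⟩
      · exact .inr (.inl ⟨.cons hF p, p', by simp; omega⟩)
      · exact .inr (.inr ⟨.cons hF p, p', by simp; omega⟩)
    · rcases ih with ⟨p, hp⟩ | ⟨p, p', hp⟩ | ⟨p, p', hp⟩
      · exact .inr (.inl ⟨.nil, p, by simp; omega⟩)
      · exact .inr (.inl ⟨.nil, p', by simp; omega⟩)
      · exact .inl ⟨p', by omega⟩
    · rcases ih with ⟨p, hp⟩ | ⟨p, p', hp⟩ | ⟨p, p', hp⟩
      · exact .inr (.inr ⟨.nil, p, by simp; omega⟩)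
      · exact .inl ⟨p', by omega⟩
      · exact .inr (.inr ⟨.nil, p', by simp; omega⟩)

/-- Joining two vertices at distance more than `κ` creates no short cycle. -/
theorem sup_edge (hF : F.LargeGirth κ) {x y : V} (hxy : ∀ q : F.Walk x y, κ < q.length) :
    (F ⊔ SimpleGraph.edge x y).LargeGirth κ := by
  intro a b hab q
  have hle : F.deleteEdges {s(a, b)} ≤ F := SimpleGraph.deleteEdges_le _
  by_cases hF' : F.Adj a b
  · have hE : ∀ c e, ((F ⊔ SimpleGraph.edge x y).deleteEdges {s(a, b)}).Adj c e →
        (F.deleteEdges {s(a, b)}).Adj c e ∨ (c = x ∧ e = y) ∨ (c = y ∧ e = x) := by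
      intro c e hce
      simp only [SimpleGraph.deleteEdges_adj, SimpleGraph.sup_adj, SimpleGraph.edge_adj] at hce ⊢
      tauto
    rcases walk_sup_edge hE q with ⟨p, hp⟩ | ⟨p, p', hp⟩ | ⟨p, p', hp⟩
    · exact (hF a b hF' p).trans_le hp
    -- The walk uses the new edge; its two pieces, reversed and joined by ab, form a walk from x to
    -- y in `F`, which has more than κ edges.
    · have := hxy ((p.mapLe hle).reverse.append (.cons hF' (p'.mapLe hle).reverse))
      simp at this
      omega
    · have := hxy ((p'.mapLe hle).append (.cons hF'.symm (p.mapLe hle)))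
      simp at this
      omega
  · have hab' : (a = x ∧ b = y) ∨ (a = y ∧ b = x) := by
      simp only [SimpleGraph.sup_adj, SimpleGraph.edge_adj] at hab
      tauto
    -- Here the deleted edge is the new one, so what remains lies in `F`.
    have hle' : (F ⊔ SimpleGraph.edge x y).deleteEdges {s(a, b)} ≤ F := by
      intro c e hce
      simp only [SimpleGraph.deleteEdges_adj, SimpleGraph.sup_adj, SimpleGraph.edge_adj,
        Set.mem_singleton_iff, Sym2.eq_iff] at hce
      grind
    rcases hab' with ⟨rfl, rfl⟩ | ⟨rfl, rfl⟩
    · simpa using hxy (q.mapLe hle')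
    · simpa using hxy (q.mapLe hle').reverse

/-- The vertices at distance exactly `i` from `r`. -/
def layer (F : SimpleGraph V) (r : V) (i : ℕ) : Set V :=
  {v | (∃ p : F.Walk r v, p.length = i) ∧ ∀ p : F.Walk r v, i ≤ p.length}

/-- A vertex of the layer `i` has at most one neighbour in the layers up to `i`. -/
theorem eq_of_adj_layer (hF : F.LargeGirth κ) {r v x y : V} {i : ℕ} (hi : 2 * i + 1 ≤ κ)
    (hv : ∀ p : F.Walk r v, i ≤ p.length) (hvx : F.Adj v x) (hvy : F.Adj v y)
    (p : F.Walk r x) (hp : p.length ≤ i) (q : F.Walk r y) (hq : q.length ≤ i) : x = y := by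
  classical
  by_contra hxy
  -- A walk of at most `i` edges from `r` to another vertex cannot meet `v`: cut off there, it would
  -- reach `v` in fewer than `i` steps.
  have avoid : ∀ {z} (t : F.Walk r z), t.length ≤ i → v ≠ z → v ∉ t.support := by
    intro z t ht hz hmem
    have := SimpleGraph.Walk.length_takeUntil_lt_length hmem hz
    have := hv (t.takeUntil v hmem)
    omega
  have hd : ∀ {z} (t : F.Walk r z), t.length ≤ i → v ≠ z →
      ∀ e ∈ t.edges, e ∉ ({s(v, x)} : Set (Sym2 V)) := by
    rintro z t ht hz e he rfl
    exact avoid t ht hz (t.fst_mem_support_of_mem_edges he)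
  have h1 : (F.deleteEdges {s(v, x)}).Adj v y := by
    simp only [SimpleGraph.deleteEdges_adj, hvy, Set.mem_singleton_iff, Sym2.eq_iff, true_and]
    rintro (⟨-, rfl⟩ | ⟨h, -⟩)
    · exact hxy rfl
    · exact hvx.ne h
  -- From `v` to `y`, back to `r` and out to `x`: a walk avoiding vx with at most 2i + 1 ≤ κ edges.
  have := hF v x hvx (.cons h1 ((q.toDeleteEdges _ (hd q hq hvy.ne)).reverse.append
    (p.toDeleteEdges _ (hd p hp hvx.ne))))
  simp at this
  omega

/-- If all degrees are at least three, the layers double. -/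
theorem two_pow_le_ncard_layer [Finite V] (hF : F.LargeGirth κ) {r : V}
    (hdeg : ∀ v, (∃ _ : F.Walk r v, True) → 3 ≤ (F.neighborSet v).ncard) :
    ∀ i, 2 * i + 1 ≤ κ → 2 ^ i ≤ (layer F r i).ncard := by
  classical
  have := Fintype.ofFinite V
  intro i
  induction i with
  | zero =>
    intro _
    have : r ∈ layer F r 0 := ⟨⟨.nil, rfl⟩, by simp⟩
    exact (Set.ncard_pos (Set.toFinite _)).2 ⟨r, this⟩
  | succ i ih =>
    intro hi
    -- Double counting between consecutive layers: at least two neighbours upwards, at most one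
    -- downwards.
    have h2 := Finset.card_mul_le_card_mul (r := F.Adj) (s := (layer F r i).toFinset)
      (t := (layer F r (i + 1)).toFinset) (m := 2) (n := 1) ?_ ?_
    · rw [← Set.ncard_eq_toFinset_card', ← Set.ncard_eq_toFinset_card'] at h2
      have := ih (by omega)
      rw [pow_succ]
      omega
    · intro v hv
      obtain ⟨⟨p, hp⟩, hv'⟩ := Set.mem_toFinset.1 hv
      have h3 := hdeg v ⟨p, trivial⟩
      set N := (F.neighborSet v).toFinset
      have hN : 3 ≤ N.card := by rwa [← Set.ncard_eq_toFinset_card']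
      -- A neighbour not reached within `i` steps lies in the next layer. At most one of the three
      -- neighbours is reached earlier.
      have hsplit : N ⊆ N.filter (fun z => ∃ q : F.Walk r z, q.length ≤ i) ∪
          Finset.bipartiteAbove F.Adj (layer F r (i + 1)).toFinset v := by
        intro z hz
        have hvz : F.Adj v z := by simpa [N] using hz
        rw [Finset.mem_union, Finset.mem_filter]
        by_cases hq : ∃ q : F.Walk r z, q.length ≤ i
        · exact .inl ⟨hz, hq⟩
        · right
          push Not at hq
          simp only [Finset.mem_bipartiteAbove, Set.mem_toFinset]
          exact ⟨⟨⟨p.concat hvz, by simp [hp]⟩, fun q => hq q⟩, hvz⟩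
      have hone : (N.filter (fun z => ∃ q : F.Walk r z, q.length ≤ i)).card ≤ 1 := by
        rw [Finset.card_le_one]
        simp only [Finset.mem_filter, N, Set.mem_toFinset, SimpleGraph.mem_neighborSet]
        rintro x ⟨hx, q, hq⟩ y ⟨hy, q', hq'⟩
        exact eq_of_adj_layer hF (i := i) (by omega) hv' hx hy q hq q' hq'
      have := (Finset.card_le_card hsplit).trans (Finset.card_union_le _ _)
      omega
    · intro v hv
      obtain ⟨-, hv'⟩ := Set.mem_toFinset.1 hv
      rw [Finset.card_le_one]
      simp only [Finset.mem_bipartiteBelow, Set.mem_toFinset]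
      rintro x ⟨⟨⟨q, hq⟩, -⟩, hx⟩ y ⟨⟨⟨q', hq'⟩, -⟩, hy⟩
      exact eq_of_adj_layer hF hi hv' hx.symm hy.symm q (by omega) q' (by omega)

/-- A graph of logarithmic girth has linearly many edges. -/
theorem ncard_edgeSet_le [Fintype V] (hF : F.LargeGirth κ) {k : ℕ}
    (hk : Fintype.card V < 2 ^ k) (hκ : 2 * k + 1 ≤ κ) :
    F.edgeSet.ncard ≤ 2 * Fintype.card V := by
  classical
  -- Vertices of degree at most two are peeled off one by one, each taking at most two edges with
  -- it.
  suffices h : ∀ m, ∀ U : Finset V, U.card = m →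
      {e ∈ F.edgeSet | ∀ z ∈ e, z ∈ U}.ncard ≤ 2 * m by
    simpa using h _ Finset.univ rfl
  intro m
  induction m with
  | zero =>
    intro U hU
    rw [Finset.card_eq_zero] at hU
    subst hU
    have : {e ∈ F.edgeSet | ∀ z ∈ e, z ∈ (∅ : Finset V)} = ∅ := by
      ext e
      induction e with
      | _ a b => simpa using fun _ => ⟨a, by simp⟩
    rw [this]
    simp
  | succ m ih =>
    intro U hU
    obtain ⟨v, hvU, hv⟩ : ∃ v ∈ U, (U.filter (F.Adj v)).card ≤ 2 := by
      -- Otherwise the graph induced on `U` has minimum degree three, and its layer `k` would have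
      -- `2 ^ k` vertices, more than there are.
      by_contra! hcon
      let K : SimpleGraph V :=
        { Adj := fun a b => F.Adj a b ∧ a ∈ U ∧ b ∈ U
          symm := ⟨fun a b h => ⟨h.1.symm, h.2.2, h.2.1⟩⟩
          loopless := ⟨fun a h => F.loopless.irrefl a h.1⟩ }
      have hKF : K ≤ F := fun a b h => h.1
      obtain ⟨r, hr⟩ : U.Nonempty := Finset.card_pos.1 (by omega)
      have hmem : ∀ {a b}, K.Walk a b → a ∈ U → b ∈ U := by
        intro a b p
        induction p with
        | nil => exact id
        | cons h p ih => exact fun _ => ih h.2.2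
      have hd : ∀ v, (∃ _ : K.Walk r v, True) → 3 ≤ (K.neighborSet v).ncard := by
        rintro v ⟨p, -⟩
        have hvU := hmem p hr
        have : K.neighborSet v = (U.filter (F.Adj v) : Finset V) := by
          ext z
          simp [K, hvU, and_comm]
        rw [this, Set.ncard_coe_finset]
        exact hcon v hvU
      have h1 := two_pow_le_ncard_layer (hF.anti hKF) hd k hκ
      have h2 : (layer K r k).ncard ≤ Fintype.card V := by
        rw [← Nat.card_eq_fintype_card]
        exact Set.ncard_le_card _
      omega
    have hsub : {e ∈ F.edgeSet | ∀ z ∈ e, z ∈ U} ⊆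
        {e ∈ F.edgeSet | ∀ z ∈ e, z ∈ U.erase v} ∪
          ((U.filter (F.Adj v)).image fun z => s(v, z) : Finset (Sym2 V)) := by
      intro e
      induction e with
      | _ a b =>
        intro he
        simp only [Set.mem_ofPred_eq, SimpleGraph.mem_edgeSet, Sym2.mem_iff, forall_eq_or_imp,
          forall_eq, Set.mem_union, Finset.mem_erase, Finset.coe_image, Set.mem_image,
          Finset.coe_filter, Sym2.eq_iff] at he ⊢
        obtain ⟨hab, ha, hb⟩ := he
        by_cases hav : a = v
        · right; exact ⟨b, ⟨hb, hav ▸ hab⟩, .inl ⟨hav.symm, rfl⟩⟩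
        · by_cases hbv : b = v
          · right; exact ⟨a, ⟨ha, hbv ▸ hab.symm⟩, .inr ⟨hbv.symm, rfl⟩⟩
          · left; exact ⟨hab, ⟨hav, ha⟩, hbv, hb⟩
    have h1 := (Set.ncard_le_ncard hsub (Set.toFinite _)).trans (Set.ncard_union_le _ _)
    have h2 := ih (U.erase v) (by rw [Finset.card_erase_of_mem hvU]; omega)
    rw [Set.ncard_coe_finset] at h1
    have h3 : ((U.filter (F.Adj v)).image fun z => s(v, z)).card ≤ 2 :=
      Finset.card_image_le.trans hv
    omega

end SimpleGraph.LargeGirth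

/-! ### Buying a shortest path -/

open WeightedGraph

section Buying

variable {V : Type*} {w : Sym2 V → ℝ≥0} {G M H : SimpleGraph V}

open Classical in
/-- `1` for a pair that is not an edge of `H`. -/
noncomputable def missing (H : SimpleGraph V) (e : Sym2 V) : ℕ := if e ∈ H.edgeSet then 0 else 1

/-- The number of edges of a walk that are missing in `H`. -/
noncomputable def missCount (H : SimpleGraph V) {K : SimpleGraph V} {u v : V} (q : K.Walk u v) : ℕ :=
  (q.edges.map (missing H)).sum

/-- The weight of the segment from `i` to `j` of a sequence of vertices. -/
noncomputable def segLength (w : Sym2 V → ℝ≥0) (a : ℕ → V) (i j : ℕ) : ℝ≥0 :=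
  ∑ k ∈ Finset.Ico i j, w s(a k, a (k + 1))

theorem segLength_add (a : ℕ → V) {i j k : ℕ} (hij : i ≤ j) (hjk : j ≤ k) :
    segLength w a i j + segLength w a j k = segLength w a i k :=
  Finset.sum_Ico_consecutive _ hij hjk

theorem segLength_succ (a : ℕ → V) (i : ℕ) : segLength w a i (i + 1) = w s(a i, a (i + 1)) := by
  simp [segLength]

theorem missCount_eq_zero {u v : V} (h : H ≤ M) (q : H.Walk u v) : missCount H (q.mapLe h) = 0 := by
  simp only [missCount, SimpleGraph.Walk.edges_mapLe_eq_edges, List.sum_eq_zero_iff, List.mem_map]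
  rintro _ ⟨e, he, rfl⟩
  simp [missing, q.edges_subset_edgeSet he]

/-- A walk through the sequence `a` which is optimal on each of its segments. -/
structure Tight (w : Sym2 V → ℝ≥0) (G M H : SimpleGraph V) (a : ℕ → V) (l : ℕ) : Prop where
  adj : ∀ i < l, M.Adj (a i) (a (i + 1))
  short : ∀ i j, i ≤ j → j ≤ l → (segLength w a i j : ℝ≥0∞) ≤ dist w G (a i) (a j)
  miss_le : ∀ i j, i ≤ j → j ≤ l → ∀ q : M.Walk (a i) (a j), length w q ≤ segLength w a i j →
    ∑ k ∈ Finset.Ico i j, missing H s(a k, a (k + 1)) ≤ missCount H q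

/-- Optimality passes to segments by exchange. For lengths, the two outer pieces are finite and
cancel in the triangle inequality. For missing edges, the walk with its segment replaced by `q`
competes with `r`. -/
theorem Tight.of_walk (hMG : M ≤ G) {u v : V} (r : M.Walk u v)
    (hlen : (length w r : ℝ≥0∞) ≤ dist w G u v)
    (hmin : ∀ q : M.Walk u v, length w q ≤ length w r → missCount H r ≤ missCount H q) :
    Tight w G M H r.getVert r.length := by
  have hadj : ∀ i < r.length, M.Adj (r.getVert i) (r.getVert (i + 1)) :=
    fun i hi => r.adj_getVert_succ hi
  have hr : length w r = segLength w r.getVert 0 r.length := by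
    rw [length, sum_edges_eq_sum_getVert, segLength, Finset.range_eq_Ico]
  have hm : missCount H r = ∑ k ∈ Finset.Ico 0 r.length,
      missing H s(r.getVert k, r.getVert (k + 1)) := by
    rw [missCount, sum_edges_eq_sum_getVert, Finset.range_eq_Ico]
  refine ⟨hadj, fun i j hij hj => ?_, fun i j hij hj q hq => ?_⟩
  · obtain ⟨p, hp⟩ := exists_walk_of_seq r.getVert (Nat.zero_le i)
      (fun k _ hk => hadj k (by omega))
    obtain ⟨s, hs⟩ := exists_walk_of_seq r.getVert hj (fun k _ hk => hadj k hk)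
    have hp' : dist w G (r.getVert 0) (r.getVert i) ≤ segLength w r.getVert 0 i := by
      rw [segLength, ← hp w]
      exact (dist_mono hMG _ _).trans (dist_le_length p)
    have hs' : dist w G (r.getVert j) (r.getVert r.length) ≤ segLength w r.getVert j r.length := by
      rw [segLength, ← hs w]
      exact (dist_mono hMG _ _).trans (dist_le_length s)
    have h1 : (segLength w r.getVert 0 i : ℝ≥0∞) + segLength w r.getVert i j +
        segLength w r.getVert j r.length ≤ segLength w r.getVert 0 i +
          dist w G (r.getVert i) (r.getVert j) + segLength w r.getVert j r.length := by
      rw [← ENNReal.coe_add, ← ENNReal.coe_add, segLength_add _ (Nat.zero_le i) hij,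
        segLength_add _ (Nat.zero_le j) hj, ← hr]
      refine hlen.trans ?_
      calc dist w G u v = dist w G (r.getVert 0) (r.getVert r.length) := by simp
        _ ≤ dist w G (r.getVert 0) (r.getVert j) + dist w G (r.getVert j) (r.getVert r.length) :=
          dist_triangle _ _ _
        _ ≤ (dist w G (r.getVert 0) (r.getVert i) + dist w G (r.getVert i) (r.getVert j)) +
            dist w G (r.getVert j) (r.getVert r.length) := by
          gcongr
          exact dist_triangle _ _ _
        _ ≤ _ := by gcongr
    have h2 := (ENNReal.add_le_add_iff_right ENNReal.coe_ne_top).1 h1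
    exact (ENNReal.add_le_add_iff_left ENNReal.coe_ne_top).1 h2
  · obtain ⟨p, hp⟩ := exists_walk_of_seq r.getVert (Nat.zero_le i)
      (fun k _ hk => hadj k (by omega))
    obtain ⟨s, hs⟩ := exists_walk_of_seq r.getVert hj (fun k _ hk => hadj k hk)
    have key := hmin ((p.append (q.append s)).copy (by simp) (by simp)) (by
      rw [hr, ← segLength_add _ (Nat.zero_le i) (hij.trans hj), ← segLength_add _ hij hj]
      have h1 : length w p = segLength w r.getVert 0 i := hp w
      have h2 : length w s = segLength w r.getVert j r.length := hs w
      rw [← h1, ← h2]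
      simp only [length, SimpleGraph.Walk.edges_copy, SimpleGraph.Walk.edges_append, List.map_append,
        List.sum_append] at hq ⊢
      gcongr)
    rw [hm, ← Finset.sum_Ico_consecutive _ (Nat.zero_le i) (hij.trans hj),
      ← Finset.sum_Ico_consecutive _ hij hj] at key
    simp only [missCount, SimpleGraph.Walk.edges_copy, SimpleGraph.Walk.edges_append,
      List.map_append, List.sum_append, hp, hs] at key ⊢
    omega

variable {a : ℕ → V} {l : ℕ}

/-- Two vertices of a tight walk which `H` joins by a shortest path have no missing edge between
them. -/
theorem Tight.mem_edgeSet_of_dist_le [Finite V] (ht : Tight w G M H a l) (hHM : H ≤ M) (hMG : M ≤ G)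
    {i j : ℕ} (hij : i < j) (hj : j ≤ l) (hd : dist w H (a i) (a j) ≤ dist w G (a i) (a j)) :
    s(a i, a (i + 1)) ∈ H.edgeSet := by
  obtain ⟨p, hp⟩ := exists_walk_of_seq a hij.le (fun k _ hk => ht.adj k (by omega))
  have h1 : dist w G (a i) (a j) ≤ segLength w a i j := by
    rw [segLength, ← hp w]
    exact (dist_mono hMG _ _).trans (dist_le_length p)
  -- An optimal walk in `H` is at most as long as the segment and misses no edge, so by minimality
  -- the segment misses none.
  obtain ⟨q, hq⟩ := exists_length_eq_dist (w := w) (H := H) (u := a i) (v := a j)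
    (ne_top_of_le_ne_top ENNReal.coe_ne_top (hd.trans h1))
  have h2 := ht.miss_le i j hij.le hj (q.mapLe hHM) (by
    rw [length_mapLe]
    exact_mod_cast hq.le.trans (hd.trans h1))
  rw [missCount_eq_zero, Nat.le_zero, Finset.sum_eq_zero_iff] at h2
  have h3 := h2 i (by simp [hij])
  by_contra hcon
  simp [missing, hcon] at h3

/-- The vertices of the paths that have been bought. -/
noncomputable def touched [Fintype V] (L : List (Finset V × Finset V)) : Finset V :=
  open Classical in Finset.univ.filter fun x => ∃ c ∈ L, x ∈ c.1

/-- The neighbours that have been charged for the paths that have been bought. -/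
noncomputable def charged [Fintype V] (L : List (Finset V × Finset V)) : Finset V :=
  open Classical in Finset.univ.filter fun x => ∃ c ∈ L, x ∈ c.2

/-- A set of natural numbers each of which is assigned a member of a list, different numbers
different members, is not larger than the list. -/
theorem card_le_length_of_forall_mem {α : Type*} (L : List α) (P : Finset ℕ) (r : ℕ → α → Prop)
    (hP : ∀ i ∈ P, ∃ c ∈ L, r i c)
    (hr : ∀ c ∈ L, ∀ i ∈ P, ∀ j ∈ P, i < j → r i c → ¬ r j c) : P.card ≤ L.length := by
  have : ∀ i ∈ P, ∃ k : ℕ, ∃ h : k < L.length, r i L[k] := fun i hi => by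
    obtain ⟨c, hc, hrc⟩ := hP i hi
    obtain ⟨k, hk, rfl⟩ := List.mem_iff_getElem.1 hc
    exact ⟨k, hk, hrc⟩
  choose! k hk hrk using this
  have := Finset.card_le_card_of_injOn (s := P) (t := Finset.range L.length) k
    (fun i hi => by simpa using hk i hi) (by
      intro i hi j hj hij
      have hrj : r j (L[k i]'(hk i hi)) := by
        simp only [hij]
        exact hrk j hj
      rcases lt_trichotomy i j with h | h | h
      · exact absurd hrj (hr _ (List.getElem_mem _) i hi j hj h (hrk i hi))
      · exact h
      · exact absurd (hrk i hi) (hr _ (List.getElem_mem _) j hj i hi h hrj))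
  simpa using this

open Classical in
/-- The number of missing edges of a tight walk. -/
theorem Tight.card_missing_le [Fintype V] (ht : Tight w G M H a l) (hHM : H ≤ M) (hMG : M ≤ G)
    (L : List (Finset V × Finset V))
    (hL : ∀ c ∈ L, ∀ x ∈ c.1, ∀ y ∈ c.1, dist w H x y ≤ dist w G x y) :
    ((Finset.range l).filter fun i => s(a i, a (i + 1)) ∉ H.edgeSet).card ≤
      (((Finset.range (l + 1)).image a) \ touched L).card + L.length := by
  set P := (Finset.range l).filter fun i => s(a i, a (i + 1)) ∉ H.edgeSet with hP
  -- Missing edges are indexed by their first ends: untouched ends are counted as vertices, touched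
  -- ends by an earlier path containing them.
  rw [← Finset.card_filter_add_card_filter_not (s := P) (fun i => a i ∉ touched L)]
  have hPm : ∀ i ∈ P, i < l ∧ s(a i, a (i + 1)) ∉ H.edgeSet := fun i hi => by
    simpa [hP] using hi
  gcongr
  · refine Finset.card_le_card_of_injOn a (fun i hi => ?_) ?_
    · obtain ⟨h1, h2⟩ := Finset.mem_filter.1 hi
      simp only [Finset.coe_sdiff, Set.mem_sdiff, Finset.mem_coe, Finset.mem_image,
        Finset.mem_range]
      exact ⟨⟨i, by have := (hPm i h1).1; omega, rfl⟩, h2⟩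
    -- The walk may revisit a vertex. The two occurrences are at distance zero in `H`, so the edge
    -- leaving the first is not missing.
    · have main : ∀ i ∈ P, ∀ j ∈ P, i < j → a i ≠ a j := fun i hi j hj hij h =>
        (hPm i hi).2 (ht.mem_edgeSet_of_dist_le hHM hMG hij (hPm j hj).1.le
          (by simp [h, dist_self]))
      intro i hi j hj hij
      have hi' := (Finset.mem_filter.1 hi).1
      have hj' := (Finset.mem_filter.1 hj).1
      rcases lt_trichotomy i j with h | h | h
      · exact absurd hij (main i hi' j hj' h)
      · exact h
      · exact absurd hij.symm (main j hj' i hi' h)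
  · refine card_le_length_of_forall_mem L _ (fun i c => a i ∈ c.1) (fun i hi => ?_) ?_
    · have := (Finset.mem_filter.1 hi).2
      simpa [touched] using this
    · intro c hc i hi j hj hij h1 h2
      have hi' := hPm i (Finset.mem_filter.1 hi).1
      have hj' := hPm j (Finset.mem_filter.1 hj).1
      exact hi'.2 (ht.mem_edgeSet_of_dist_le hHM hMG hij hj'.1.le (hL c hc _ h1 _ h2))

/-- A tight walk whose end points are far apart in `H` has many neighbours that have not been
charged before. -/
theorem Tight.exists_charge [Fintype V] (ht : Tight w G M H a l) (hHM : H ≤ M) (hMG : M ≤ G)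
    {d κ R : ℕ} {ω : ℝ≥0} (hω : ∀ e ∈ M.edgeSet, w e ≤ ω)
    (hstretch : ∀ x y, M.Adj x y → dist w H x y ≤ κ * w s(x, y))
    (hlight : ∀ x y, M.Adj x y → ¬ H.Adj x y → d ≤ (H.neighborSet x).ncard)
    (L : List (Finset V × Finset V))
    (hL : ∀ c ∈ L, ∀ x ∈ c.1, ∀ y ∈ c.1, dist w H x y ≤ dist w G x y)
    (hL' : ∀ c ∈ L, ∀ z ∈ c.2, ∃ x ∈ c.1, H.Adj x z)
    (hbad : ¬ dist w H (a 0) (a l) ≤ segLength w a 0 l + (R * (8 + κ) : ℕ) * ω) :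
    ∃ T : Finset V, (R - L.length) * d ≤ T.card ∧ Disjoint T (charged L) ∧
      ∀ z ∈ T, ∃ i ≤ l, H.Adj (a i) z := by
  classical
  have hωH : ∀ {x y}, H.Adj x y → dist w H x y ≤ ω := fun h =>
    (dist_le_of_adj h).trans (by exact_mod_cast hω _ (hHM h))
  -- The excess is cut into `R` levels of size `(8 + κ) * ω`, and `I t` is the last position whose
  -- excess is within `t` levels. Position 0 always qualifies.
  let good : ℕ → ℕ → Prop := fun t i =>
    dist w H (a 0) (a i) ≤ segLength w a 0 i + (t * (8 + κ) : ℕ) * ω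
  let I : ℕ → ℕ := fun t => Nat.findGreatest (good t) l
  have good_mono : ∀ {t t' i}, t ≤ t' → good t i → good t' i := fun htt h => h.trans (by gcongr)
  have good_zero : ∀ t, good t 0 := fun t => by simp [good, dist_self]
  have good_I : ∀ t, good t (I t) := fun t =>
    Nat.findGreatest_spec (P := good t) (Nat.zero_le l) (good_zero t)
  have I_lt : ∀ t < R, I t < l := fun t htR => by
    refine lt_of_le_of_ne (Nat.findGreatest_le l) fun h => hbad ?_
    have := good_I t
    rw [h] at this
    exact good_mono htR.le this
  have not_good : ∀ t < R, ¬ good t (I t + 1) := fun t htR =>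
    Nat.findGreatest_is_greatest (Nat.lt_succ_self _) (I_lt t htR)
  have I_mono : ∀ t t', t ≤ t' → I t ≤ I t' := fun t t' h =>
    Nat.findGreatest_mono_left (fun i => good_mono h) l
  -- An edge of `H` would not increase the excess, so position `I t + 1` would still be good.
  have I_missing : ∀ t < R, ¬ H.Adj (a (I t)) (a (I t + 1)) := fun t htR h => not_good t htR <| by
    have h1 := good_I t
    have h2 : segLength w a 0 (I t + 1) = segLength w a 0 (I t) + w s(a (I t), a (I t + 1)) := by
      rw [← segLength_add a (Nat.zero_le (I t)) (Nat.le_succ _), segLength_succ]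
    simp only [good] at h1 ⊢
    rw [h2, ENNReal.coe_add]
    calc _ ≤ dist w H (a 0) (a (I t)) + dist w H (a (I t)) (a (I t + 1)) := dist_triangle _ _ _
      _ ≤ (segLength w a 0 (I t) + (t * (8 + κ) : ℕ) * ω) + w s(a (I t), a (I t + 1)) := by
        gcongr
        exact dist_le_of_adj h
      _ = _ := by ring
  -- Otherwise the excess at `I t' + 1` is that at `I t`, plus 8ω, plus at most κω for the next edge
  -- by the stretch bound. That is one level more, so the position would be good for t + 1 ≤ t'.
  have far : ∀ t t', t < t' → t' < R →
      ¬ dist w H (a (I t)) (a (I t')) ≤ segLength w a (I t) (I t') + 8 * ω := by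
    intro t t' htt htR hle
    apply not_good t' htR
    have h1 := good_I t
    have hI := I_mono t t' htt.le
    have h2 : segLength w a 0 (I t' + 1) =
        segLength w a 0 (I t) + segLength w a (I t) (I t') + w s(a (I t'), a (I t' + 1)) := by
      rw [← segLength_succ (w := w), segLength_add a (Nat.zero_le _) hI,
        segLength_add a (Nat.zero_le _) (Nat.le_succ _)]
    have h3 := hstretch _ _ (ht.adj _ (I_lt t' htR))
    have h4 : w s(a (I t'), a (I t' + 1)) ≤ ω := hω _ (ht.adj _ (I_lt t' htR))
    simp only [good] at h1 ⊢
    rw [h2, ENNReal.coe_add, ENNReal.coe_add]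
    calc dist w H (a 0) (a (I t' + 1))
        ≤ dist w H (a 0) (a (I t')) + dist w H (a (I t')) (a (I t' + 1)) := dist_triangle _ _ _
      _ ≤ (dist w H (a 0) (a (I t)) + dist w H (a (I t)) (a (I t'))) +
          dist w H (a (I t')) (a (I t' + 1)) := by gcongr; exact dist_triangle _ _ _
      _ ≤ ((segLength w a 0 (I t) + (t * (8 + κ) : ℕ) * ω) +
          (segLength w a (I t) (I t') + 8 * ω)) + κ * ω := by
        gcongr
        refine h3.trans ?_
        gcongr
      _ = segLength w a 0 (I t) + segLength w a (I t) (I t') +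
          ((t + 1) * (8 + κ) : ℕ) * ω := by push_cast; ring
      _ ≤ segLength w a 0 (I t) + segLength w a (I t) (I t') + (t' * (8 + κ) : ℕ) * ω := by
        gcongr; omega
      _ ≤ _ := add_le_add le_self_add le_rfl
  have hG : ∀ t t', t ≤ t' → t' < R →
      dist w G (a (I t)) (a (I t')) ≤ segLength w a (I t) (I t') := by
    intro t t' htt htR
    obtain ⟨p, hp⟩ := exists_walk_of_seq a (I_mono t t' htt)
      (fun k _ hk => ht.adj k (by have := I_lt t' htR; omega))
    rw [segLength, ← hp w]
    exact (dist_mono hMG _ _).trans (dist_le_length p)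
  let N : ℕ → Finset V := fun t => (H.neighborSet (a (I t))).toFinset
  have hN : ∀ {t z}, z ∈ N t ↔ H.Adj (a (I t)) z := by simp [N]
  have hNc : ∀ t < R, d ≤ (N t).card := fun t htR => by
    rw [← Set.ncard_eq_toFinset_card']
    exact hlight _ _ (ht.adj _ (I_lt t htR)) (I_missing t htR)
  -- A common neighbour would join the two positions in `H` within 2ω.
  have hNd : ∀ t t', t < t' → t' < R → Disjoint (N t) (N t') := by
    intro t t' htt htR
    rw [Finset.disjoint_left]
    intro z hz hz'
    apply far t t' htt htR
    calc _ ≤ dist w H (a (I t)) z + dist w H z (a (I t')) := dist_triangle _ _ _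
      _ ≤ ω + ω := by
        gcongr
        · exact hωH (hN.1 hz)
        · exact hωH (hN.1 hz').symm
      _ = 2 * ω := by ring
      _ ≤ 8 * ω := by gcongr; norm_num
      _ ≤ _ := le_add_self
  -- The levels whose neighbourhoods were partly charged before. Two of them cannot owe this to the
  -- same earlier path: each position is within 2ω of a vertex of that path, on which `H` is exact,
  -- so the detour along it would have excess at most 8ω.
  let B : Finset ℕ := (Finset.range R).filter fun t => ∃ c ∈ L, ∃ z ∈ N t, z ∈ c.2
  have hB : B.card ≤ L.length := by
    refine card_le_length_of_forall_mem L B (fun t c => ∃ z ∈ N t, z ∈ c.2)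
      (fun t ht => (Finset.mem_filter.1 ht).2) ?_
    rintro c hc t htB t' htB' htt ⟨z, hz, hzc⟩ ⟨z', hz', hzc'⟩
    have htR : t' < R := by simpa using (Finset.mem_filter.1 htB').1
    apply far t t' htt htR
    obtain ⟨x, hx, hxz⟩ := hL' c hc z hzc
    obtain ⟨y, hy, hyz⟩ := hL' c hc z' hzc'
    have e1 : dist w H (a (I t)) x ≤ 2 * ω := by
      calc _ ≤ dist w H (a (I t)) z + dist w H z x := dist_triangle _ _ _
        _ ≤ ω + ω := add_le_add (hωH (hN.1 hz)) (hωH hxz.symm)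
        _ = 2 * ω := by ring
    have e2 : dist w H y (a (I t')) ≤ 2 * ω := by
      calc _ ≤ dist w H y z' + dist w H z' (a (I t')) := dist_triangle _ _ _
        _ ≤ ω + ω := add_le_add (hωH hyz) (hωH (hN.1 hz').symm)
        _ = 2 * ω := by ring
    have hHG : H ≤ G := hHM.trans hMG
    have e3 : dist w H x y ≤ segLength w a (I t) (I t') + 4 * ω := by
      calc dist w H x y ≤ dist w G x y := hL c hc x hx y hy
        _ ≤ dist w G x (a (I t)) + dist w G (a (I t)) y := dist_triangle _ _ _
        _ ≤ dist w G x (a (I t)) + (dist w G (a (I t)) (a (I t')) + dist w G (a (I t')) y) := by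
          gcongr; exact dist_triangle _ _ _
        _ ≤ 2 * ω + (segLength w a (I t) (I t') + 2 * ω) := by
          gcongr
          · rw [WeightedGraph.dist_comm]
            exact (dist_mono hHG _ _).trans e1
          · exact hG t t' htt.le htR
          · rw [WeightedGraph.dist_comm]
            exact (dist_mono hHG _ _).trans e2
        _ = _ := by ring
    calc _ ≤ dist w H (a (I t)) y + dist w H y (a (I t')) := dist_triangle _ _ _
      _ ≤ (dist w H (a (I t)) x + dist w H x y) + dist w H y (a (I t')) := by
        gcongr; exact dist_triangle _ _ _
      _ ≤ (2 * ω + (segLength w a (I t) (I t') + 4 * ω)) + 2 * ω := by gcongr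
      _ = _ := by ring
  refine ⟨(Finset.range R \ B).biUnion N, ?_, ?_, ?_⟩
  · rw [Finset.card_biUnion]
    · calc (R - L.length) * d ≤ (Finset.range R \ B).card * d := by
            gcongr
            have := Finset.le_card_sdiff B (Finset.range R)
            simp only [Finset.card_range] at this
            omega
        _ = ∑ t ∈ Finset.range R \ B, d := by simp
        _ ≤ _ := Finset.sum_le_sum fun t htm => hNc t (by simp at htm; exact htm.1)
    · intro t h1 t' h2 hne
      replace h1 := Finset.mem_range.1 (Finset.mem_sdiff.1 h1).1
      replace h2 := Finset.mem_range.1 (Finset.mem_sdiff.1 h2).1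
      rcases lt_or_gt_of_ne hne with h | h
      · exact hNd t t' h h2
      · exact (hNd t' t h h1).symm
  · rw [Finset.disjoint_left]
    intro z hz hzc
    obtain ⟨t, htm, hzt⟩ := Finset.mem_biUnion.1 hz
    obtain ⟨htR, htB⟩ := Finset.mem_sdiff.1 htm
    apply htB
    obtain ⟨c, hc, hzc⟩ := (Finset.mem_filter.1 hzc).2
    exact Finset.mem_filter.2 ⟨htR, c, hc, z, hzt, hzc⟩
  · intro z hz
    obtain ⟨t, htm, hzt⟩ := Finset.mem_biUnion.1 hz
    exact ⟨I t, Nat.findGreatest_le l, hN.1 hzt⟩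

end Buying

/-! ### The invariant of the algorithm -/

section AddEdge

variable {V : Type*}

theorem mem_edgeSet_sup_edge {H : SimpleGraph V} {a b : V} (hab : a ≠ b) {e : Sym2 V} :
    e ∈ (H ⊔ SimpleGraph.edge a b).edgeSet ↔ e ∈ H.edgeSet ∨ e = s(a, b) := by
  simp [SimpleGraph.edgeSet_edge_of_ne hab, or_comm]

theorem adj_sup_edge {H : SimpleGraph V} {a b x y : V} (hab : a ≠ b) :
    (H ⊔ SimpleGraph.edge a b).Adj x y ↔ H.Adj x y ∨ s(x, y) = s(a, b) := by
  rw [← SimpleGraph.mem_edgeSet, mem_edgeSet_sup_edge hab, SimpleGraph.mem_edgeSet]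

theorem ncard_sup_edge_le {H : SimpleGraph V} {a b : V} (hab : a ≠ b) :
    (H ⊔ SimpleGraph.edge a b).edgeSet.ncard ≤ H.edgeSet.ncard + 1 := by
  rw [SimpleGraph.edgeSet_sup, SimpleGraph.edgeSet_edge_of_ne hab]
  exact (Set.ncard_union_le _ _).trans (by simp)

theorem WeightedGraph.length_le_mul {w : Sym2 V → ℝ≥0} {K : SimpleGraph V} {ω : ℝ≥0}
    (hω : ∀ e ∈ K.edgeSet, w e ≤ ω) {a b : V}
    (q : K.Walk a b) : length w q ≤ q.length * ω := by
  induction q with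
  | nil => simp [length]
  | cons h q ih =>
    rw [WeightedGraph.length_cons, SimpleGraph.Walk.length_cons]
    push_cast
    rw [add_mul, one_mul, add_comm]
    exact add_le_add ih (hω _ h)

theorem ncard_sup_edge [Finite V] {H : SimpleGraph V} {a b : V} (hab : a ≠ b) (h : ¬ H.Adj a b) :
    (H ⊔ SimpleGraph.edge a b).edgeSet.ncard = H.edgeSet.ncard + 1 := by
  rw [SimpleGraph.edgeSet_sup, SimpleGraph.edgeSet_edge_of_ne hab, Set.union_singleton,
    Set.ncard_insert_of_notMem (by simpa using h) (Set.toFinite _)]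

end AddEdge

section Invariant

variable {V : Type*} [Fintype V] {w : Sym2 V → ℝ≥0} {G M H H' : SimpleGraph V} {d κ R : ℕ}

/-- The bookkeeping of the edges of `H`: those added since an end point had small degree, those of
a graph `F` of large girth, and those of the paths that were bought. A pair in the list `L` consists
of the vertices of a bought path and of the neighbours charged for it. -/
structure Ledger (w : Sym2 V → ℝ≥0) (G : SimpleGraph V) (d κ R : ℕ) (H F : SimpleGraph V)
    (L : List (Finset V × Finset V)) : Prop where
  le : F ≤ H
  girth : F.LargeGirth κ
  card_le : H.edgeSet.ncard ≤ ∑ v, min (H.neighborSet v).ncard d + F.edgeSet.ncard +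
    (touched L).card + L.length ^ 2
  dist_le : ∀ c ∈ L, ∀ x ∈ c.1, ∀ y ∈ c.1, dist w H x y ≤ dist w G x y
  adj : ∀ c ∈ L, ∀ z ∈ c.2, ∃ x ∈ c.1, H.Adj x z
  charge : L.length * (R * d) ≤ 2 * (charged L).card

/-- The invariant: `M` consists of the edges of `G` processed so far, in the order of their weights,
and `H` is the spanner built so far. -/
structure SpannerInv (w : Sym2 V → ℝ≥0) (G : SimpleGraph V) (d κ R : ℕ) (M H : SimpleGraph V) :
    Prop where
  le : H ≤ M
  le_graph : M ≤ G
  sorted : ∀ e ∈ M.edgeSet, ∀ e' ∈ G.edgeSet, e' ∉ M.edgeSet → w e ≤ w e'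
  stretch : ∀ a b, M.Adj a b → dist w H a b ≤ κ * w s(a, b)
  light : ∀ a b, M.Adj a b → ¬ H.Adj a b → d ≤ (H.neighborSet a).ncard
  ledger : ∃ F L, Ledger w G d κ R H F L

theorem ncard_neighborSet_mono {H H' : SimpleGraph V} (h : H ≤ H') (v : V) :
    (H.neighborSet v).ncard ≤ (H'.neighborSet v).ncard :=
  Set.ncard_le_ncard (fun _ hx => h hx) (Set.toFinite _)

theorem sum_min_ncard_mono {H H' : SimpleGraph V} (h : H ≤ H') (d : ℕ) :
    ∑ v, min (H.neighborSet v).ncard d ≤ ∑ v, min (H'.neighborSet v).ncard d :=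
  Finset.sum_le_sum fun v _ => min_le_min_right _ (ncard_neighborSet_mono h v)

theorem SpannerInv.bot : SpannerInv w G d κ R ⊥ ⊥ where
  le := le_rfl
  le_graph := bot_le
  sorted := by simp
  stretch := by simp
  light := by simp
  ledger := ⟨⊥, [], le_rfl, .bot, by simp, by simp, by simp, by simp⟩

/-! ### The outcomes for one edge: only marked, added for small degree, added for large distance -/

section Mark

variable {a b : V}

/-- The new edge is heaviest among the marked ones, so its weight can serve as ω for its round. -/
theorem SpannerInv.le_weight (hI : SpannerInv w G d κ R M H) (hab : G.Adj a b) (hM : ¬ M.Adj a b) :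
    ∀ e ∈ (M ⊔ SimpleGraph.edge a b).edgeSet, w e ≤ w s(a, b) := by
  intro e he
  rcases (mem_edgeSet_sup_edge hab.ne).1 he with h | rfl
  · exact hI.sorted e h _ hab hM
  · exact le_rfl

theorem SpannerInv.sorted_sup_edge (hI : SpannerInv w G d κ R M H) (hab : G.Adj a b) (hM : ¬ M.Adj a b)
    (hmin : ∀ e ∈ G.edgeSet, e ∉ M.edgeSet → w s(a, b) ≤ w e) :
    ∀ e ∈ (M ⊔ SimpleGraph.edge a b).edgeSet, ∀ e' ∈ G.edgeSet,
    e' ∉ (M ⊔ SimpleGraph.edge a b).edgeSet → w e ≤ w e' := by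
  intro e he e' he' hn
  rw [mem_edgeSet_sup_edge hab.ne] at hn
  push Not at hn
  exact (hI.le_weight hab hM e he).trans (hmin e' he' hn.1)

theorem SpannerInv.le_graph_sup_edge (hI : SpannerInv w G d κ R M H) (hab : G.Adj a b) :
    M ⊔ SimpleGraph.edge a b ≤ G :=
  sup_le hI.le_graph (by
    intro x y hxy
    rw [SimpleGraph.edge_adj] at hxy
    rcases hxy with ⟨⟨rfl, rfl⟩ | ⟨rfl, rfl⟩, -⟩
    · exact hab
    · exact hab.symm)

/-- Marking an edge without adding it. -/
theorem SpannerInv.mark (hI : SpannerInv w G d κ R M H) (hab : G.Adj a b) (hM : ¬ M.Adj a b)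
    (hmin : ∀ e ∈ G.edgeSet, e ∉ M.edgeSet → w s(a, b) ≤ w e)
    (ha : d ≤ (H.neighborSet a).ncard)
    (hb : d ≤ (H.neighborSet b).ncard)
    (hd : dist w H a b ≤ κ * w s(a, b)) :
    SpannerInv w G d κ R (M ⊔ SimpleGraph.edge a b) H where
  le := hI.le.trans le_sup_left
  le_graph := hI.le_graph_sup_edge hab
  sorted := hI.sorted_sup_edge hab hM hmin
  stretch x y hxy := by
    rcases (adj_sup_edge hab.ne).1 hxy with h | h
    · exact hI.stretch x y h
    · rcases Sym2.eq_iff.1 h with ⟨rfl, rfl⟩ | ⟨rfl, rfl⟩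
      · exact hd
      · rwa [WeightedGraph.dist_comm, h]
  light x y hxy hn := by
    rcases (adj_sup_edge hab.ne).1 hxy with h | h
    · exact hI.light x y h hn
    · rcases Sym2.eq_iff.1 h with ⟨rfl, rfl⟩ | ⟨rfl, rfl⟩ <;> assumption
  ledger := hI.ledger

/-- An inserted edge is spanned by itself and is not missing, so only the bookkeeping depends on why
it was inserted. -/
theorem SpannerInv.add_of_ledger (hI : SpannerInv w G d κ R M H) (hab : G.Adj a b) (hM : ¬ M.Adj a b)
    (hmin : ∀ e ∈ G.edgeSet, e ∉ M.edgeSet → w s(a, b) ≤ w e) (hκ : 1 ≤ κ)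
    (hl : ∃ F L, Ledger w G d κ R (H ⊔ SimpleGraph.edge a b) F L) :
    SpannerInv w G d κ R (M ⊔ SimpleGraph.edge a b) (H ⊔ SimpleGraph.edge a b) where
  le := sup_le_sup_right hI.le _
  le_graph := hI.le_graph_sup_edge hab
  sorted := hI.sorted_sup_edge hab hM hmin
  stretch x y hxy := by
    rcases (adj_sup_edge hab.ne).1 hxy with h | h
    · exact (dist_mono le_sup_left _ _).trans (hI.stretch x y h)
    · have hadj : (H ⊔ SimpleGraph.edge a b).Adj x y := (adj_sup_edge hab.ne).2 (.inr h)
      refine (dist_le_of_adj hadj).trans ?_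
      exact le_mul_of_one_le_left bot_le (by exact_mod_cast hκ)
  light x y hxy hn := by
    rcases (adj_sup_edge hab.ne).1 hxy with h | h
    · exact (hI.light x y h fun h' => hn ((adj_sup_edge hab.ne).2 (.inl h'))).trans
        (ncard_neighborSet_mono le_sup_left _)
    · exact absurd ((adj_sup_edge hab.ne).2 (.inr h)) hn
  ledger := hl

/-- Adding an edge one of whose end points has small degree. -/
theorem SpannerInv.add_light (hI : SpannerInv w G d κ R M H) (hab : G.Adj a b) (hM : ¬ M.Adj a b)
    (hmin : ∀ e ∈ G.edgeSet, e ∉ M.edgeSet → w s(a, b) ≤ w e) (hκ : 1 ≤ κ)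
    (ha : (H.neighborSet a).ncard < d ∨ (H.neighborSet b).ncard < d) :
    SpannerInv w G d κ R (M ⊔ SimpleGraph.edge a b) (H ⊔ SimpleGraph.edge a b) := by
  refine hI.add_of_ledger hab hM hmin hκ ?_
  obtain ⟨F, L, hl⟩ := hI.ledger
  have hle : H ≤ H ⊔ SimpleGraph.edge a b := le_sup_left
  refine ⟨F, L, hl.le.trans hle, hl.girth, ?_,
    fun c hc x hx y hy => (dist_mono hle _ _).trans (hl.dist_le c hc x hx y hy),
    fun c hc z hz => (hl.adj c hc z hz).imp fun x hx => ⟨hx.1, hle hx.2⟩, hl.charge⟩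
  have hH : ¬ H.Adj a b := fun h => hM (hI.le h)
  -- An end of degree below `d` gains a neighbour, so its truncated degree grows and pays for the
  -- new edge.
  have main : ∀ x y, s(x, y) = s(a, b) → (H.neighborSet x).ncard < d →
      ∑ v, min (H.neighborSet v).ncard d <
        ∑ v, min ((H ⊔ SimpleGraph.edge a b).neighborSet v).ncard d := by
    intro x y hxy hx
    refine Finset.sum_lt_sum
      (fun v _ => min_le_min_right _ (ncard_neighborSet_mono hle v)) ⟨x, Finset.mem_univ _, ?_⟩
    have : (H.neighborSet x).ncard < ((H ⊔ SimpleGraph.edge a b).neighborSet x).ncard := by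
      refine Set.ncard_lt_ncard ⟨fun z hz => hle hz, fun hcon => ?_⟩ (Set.toFinite _)
      have h1 : H.Adj x y := hcon ((adj_sup_edge hab.ne).2 (.inr hxy))
      rw [← SimpleGraph.mem_edgeSet, hxy] at h1
      exact hH h1
    omega
  have h1 : ∑ v, min (H.neighborSet v).ncard d <
      ∑ v, min ((H ⊔ SimpleGraph.edge a b).neighborSet v).ncard d := by
    rcases ha with h | h
    · exact main a b rfl h
    · exact main b a Sym2.eq_swap h
  have h2 := ncard_sup_edge_le (H := H) hab.ne
  have h3 := hl.card_le
  omega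

/-- Adding an edge whose end points are far apart. -/
theorem SpannerInv.add_far (hI : SpannerInv w G d κ R M H) (hab : G.Adj a b) (hM : ¬ M.Adj a b)
    (hmin : ∀ e ∈ G.edgeSet, e ∉ M.edgeSet → w s(a, b) ≤ w e) (hκ : 1 ≤ κ)
    (hd : ¬ dist w H a b ≤ κ * w s(a, b)) :
    SpannerInv w G d κ R (M ⊔ SimpleGraph.edge a b) (H ⊔ SimpleGraph.edge a b) := by
  refine hI.add_of_ledger hab hM hmin hκ ?_
  obtain ⟨F, L, hl⟩ := hI.ledger
  have hle : H ≤ H ⊔ SimpleGraph.edge a b := le_sup_left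
  have hH : ¬ H.Adj a b := fun h => hM (hI.le h)
  refine ⟨F ⊔ SimpleGraph.edge a b, L, sup_le_sup_right hl.le _, hl.girth.sup_edge fun q => ?_, ?_,
    fun c hc x hx y hy => (dist_mono hle _ _).trans (hl.dist_le c hc x hx y hy),
    fun c hc z hz => (hl.adj c hc z hz).imp fun x hx => ⟨hx.1, hle hx.2⟩, hl.charge⟩
  -- All edges of `F` were processed earlier and weigh at most `w s(a, b)`, so a walk of at most κ
  -- of them would be too short.
  · by_contra! hq
    apply hd
    have hFM : ∀ e ∈ F.edgeSet, w e ≤ w s(a, b) := fun e he =>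
      hI.le_weight hab hM e (SimpleGraph.edgeSet_mono ((hl.le.trans hI.le).trans le_sup_left) he)
    calc dist w H a b ≤ length w (q.mapLe hl.le) := dist_le_length _
      _ ≤ (q.length * w s(a, b) : ℝ≥0) := by
        rw [WeightedGraph.length_mapLe]
        exact_mod_cast length_le_mul hFM q
      _ = (q.length : ℝ≥0∞) * w s(a, b) := by push_cast; rfl
      _ ≤ _ := by gcongr
  · have h1 := ncard_sup_edge_le (H := H) hab.ne
    have h2 := ncard_sup_edge hab.ne (fun h => hH (hl.le h))
    have h3 := hl.card_le
    have h4 := sum_min_ncard_mono hle d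
    omega

end Mark

/-- The number of bought paths is small. -/
theorem Ledger.two_mul_length_lt {F : SimpleGraph V} {L : List (Finset V × Finset V)}
    (hl : Ledger w G d κ R H F L) (hR : 4 * Fintype.card V < R * R * d) : 2 * L.length < R := by
  have h1 := hl.charge
  have h2 : (charged L).card ≤ Fintype.card V := Finset.card_le_univ _
  by_contra! hcon
  -- If R ≤ 2p for p bought paths, then R²d ≤ 2pRd ≤ 4|V|, against `hR`.
  have h3 : R * (R * d) ≤ 2 * L.length * (R * d) := Nat.mul_le_mul_right _ hcon
  nlinarith

/-- Buying a shortest path between two vertices that are far apart in `H`. -/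
theorem SpannerInv.buy (hI : SpannerInv w G d κ R M H) (hR : 4 * Fintype.card V < R * R * d)
    {u v : V} (r : M.Walk u v) (hlen : (length w r : ℝ≥0∞) ≤ dist w G u v)
    (hmiss : ∀ q : M.Walk u v, length w q ≤ length w r → missCount H r ≤ missCount H q)
    {ω : ℝ≥0} (hω : ∀ e ∈ M.edgeSet, w e ≤ ω)
    (hbad : ¬ dist w H u v ≤ length w r + (R * (8 + κ) : ℕ) * ω)
    (hH' : ∀ x y, H'.Adj x y ↔ H.Adj x y ∨ s(x, y) ∈ r.edges) :
    SpannerInv w G d κ R M H' := by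
  classical
  obtain ⟨F, L, hl⟩ := hI.ledger
  have hle : H ≤ H' := fun x y h => (hH' x y).2 (.inl h)
  have ht := Tight.of_walk (H := H) hI.le_graph r hlen hmiss
  have hHM : H' ≤ M := fun x y h => by
    rcases (hH' x y).1 h with h | h
    · exact hI.le h
    · exact r.edges_subset_edgeSet h
  refine ⟨hHM, hI.le_graph, hI.sorted, fun a b h => (dist_mono hle _ _).trans (hI.stretch a b h),
    fun a b h hn => (hI.light a b h fun h' => hn (hle h')).trans (ncard_neighborSet_mono hle a), ?_⟩
  have hp := hl.two_mul_length_lt hR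
  set a := r.getVert
  set l := r.length
  have hr : length w r = segLength w a 0 l := by
    rw [length, sum_edges_eq_sum_getVert, segLength, Finset.range_eq_Ico]
  obtain ⟨T, hT, hTd, hTa⟩ := ht.exists_charge hI.le hI.le_graph hω hI.stretch hI.light L
    hl.dist_le hl.adj (R := R) (by simpa [a, l, ← hr] using hbad)
  set S := (Finset.range (l + 1)).image a with hS
  have hadj' : ∀ i < l, H'.Adj (a i) (a (i + 1)) := fun i hi =>
    (hH' _ _).2 (.inr ((mem_edges_iff_getVert r _).2 ⟨i, hi, rfl⟩))
  -- Segments of the bought walk are shortest in `G` and now lie in `H'`, so `H'` is exact between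
  -- any two of its vertices.
  have hdist : ∀ i j, i ≤ j → j ≤ l → dist w H' (a i) (a j) ≤ dist w G (a i) (a j) := by
    intro i j hij hj
    obtain ⟨p, hp⟩ := exists_walk_of_seq a hij (fun k _ hk => hadj' k (by omega))
    refine le_trans ?_ (ht.short i j hij hj)
    rw [segLength, ← hp w]
    exact dist_le_length p
  have htouch : touched ((S, T) :: L) = touched L ∪ S \ touched L := by
    ext x
    simp only [touched, List.mem_cons, exists_eq_or_imp, Finset.mem_filter, Finset.mem_univ,
      true_and, Finset.mem_union, Finset.mem_sdiff]
    by_cases h : ∃ c ∈ L, x ∈ c.1 <;> simp [h]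
  have hcharge : charged ((S, T) :: L) = T ∪ charged L := by
    ext x
    simp only [charged, List.mem_cons, exists_eq_or_imp, Finset.mem_filter, Finset.mem_univ,
      true_and, Finset.mem_union]
  refine ⟨F, (S, T) :: L, hl.le.trans hle, hl.girth, ?_, ?_, ?_, ?_⟩
  · have h1 : H'.edgeSet ⊆ H.edgeSet ∪ (((Finset.range l).filter
        fun i => s(a i, a (i + 1)) ∉ H.edgeSet).image fun i => s(a i, a (i + 1)) :
          Finset (Sym2 V)) := by
      intro e he
      induction e with
      | _ x y =>
        by_cases h : H.Adj x y
        · exact .inl h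
        · right
          obtain ⟨i, hi, hxy⟩ :=
            (mem_edges_iff_getVert r _).1 (((hH' x y).1 he).resolve_left h)
          simp only [Finset.coe_image, Set.mem_image, Finset.coe_filter, Finset.mem_range]
          refine ⟨i, ⟨hi, ?_⟩, hxy.symm⟩
          rw [← hxy]
          exact h
    have h2 := (Set.ncard_le_ncard h1 (Set.toFinite _)).trans (Set.ncard_union_le _ _)
    rw [Set.ncard_coe_finset] at h2
    have h3 := h2.trans (Nat.add_le_add_left Finset.card_image_le _)
    have h4 := ht.card_missing_le hI.le hI.le_graph L hl.dist_le
    rw [← hS] at h4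
    have h5 := sum_min_ncard_mono hle d
    have h6 := hl.card_le
    rw [htouch, Finset.card_union_of_disjoint Finset.disjoint_sdiff, List.length_cons]
    -- The missing edges attributed to earlier paths are absorbed by the growth of the square.
    have h7 : L.length ^ 2 + L.length ≤ (L.length + 1) ^ 2 := by nlinarith
    omega
  · rintro c hc x hx y hy
    rcases List.mem_cons.1 hc with rfl | hc
    · obtain ⟨i, hi, rfl⟩ := Finset.mem_image.1 hx
      obtain ⟨j, hj, rfl⟩ := Finset.mem_image.1 hy
      rw [Finset.mem_range] at hi hj
      rcases le_total i j with hij | hij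
      · exact hdist i j hij (by omega)
      · rw [WeightedGraph.dist_comm, WeightedGraph.dist_comm (H := G)]
        exact hdist j i hij (by omega)
    · exact (dist_mono hle _ _).trans (hl.dist_le c hc x hx y hy)
  · rintro c hc z hz
    rcases List.mem_cons.1 hc with rfl | hc
    · obtain ⟨i, hi, hiz⟩ := hTa z hz
      exact ⟨a i, Finset.mem_image.2 ⟨i, by simp; omega, rfl⟩, hle hiz⟩
    · exact (hl.adj c hc z hz).imp fun x hx => ⟨hx.1, hle hx.2⟩
  · rw [hcharge, Finset.card_union_of_disjoint hTd, List.length_cons]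
    have h1 := hl.charge
    -- Fewer than R/2 paths came before, so at least half of Rd is charged afresh; hence the factor
    -- two in `charge`.
    have h2 : R * d ≤ 2 * ((R - L.length) * d) := by
      rw [← mul_assoc]
      exact Nat.mul_le_mul_right _ (by omega)
    have h3 : (L.length + 1) * (R * d) = L.length * (R * d) + R * d := by ring
    omega

/-- The number of edges of the spanner. -/
theorem SpannerInv.ncard_edgeSet_le (hI : SpannerInv w G d κ R M H)
    (hR : 4 * Fintype.card V < R * R * d) {k : ℕ} (hk : Fintype.card V < 2 ^ k)
    (hκ : 2 * k + 1 ≤ κ) :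
    H.edgeSet.ncard ≤ Fintype.card V * (d + 3) + R ^ 2 := by
  obtain ⟨F, L, hl⟩ := hI.ledger
  have h1 := hl.card_le
  have h2 := hl.girth.ncard_edgeSet_le hk hκ
  have h3 : (touched L).card ≤ Fintype.card V := Finset.card_le_univ _
  have h4 : ∑ v, min (H.neighborSet v).ncard d ≤ Fintype.card V * d := by
    refine (Finset.sum_le_sum fun v _ => min_le_right _ _).trans ?_
    simp
  have h5 : L.length ^ 2 ≤ R ^ 2 :=
    Nat.pow_le_pow_left (by have := hl.two_mul_length_lt hR; omega) 2
  nlinarith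

end Invariant

/-! ### Structured programs

Programs whose loops run a counter from `0` to the number in register `0`. They always halt, within
a number of steps that is a polynomial in that number, and their semantics is a function. -/

namespace RealRAM

inductive Cmd where
  | skip
  | nset (x : ℕ) (e : NExp)
  | rset (x : ℕ) (e : RExp)
  | nput (a : ℕ) (i j : NExp) (e : NExp)
  | rput (a : ℕ) (i j : NExp) (e : RExp)
  | seq (c d : Cmd)
  | ite (b : Test) (c d : Cmd)
  | forN (i : ℕ) (c : Cmd)

namespace Cmd

/-- The program text of a structured program. -/
def compile : Cmd → Program
  | skip => .skip
  | nset x e => .nset x e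
  | rset x e => .rset x e
  | nput a i j e => .nput a i j e
  | rput a i j e => .rput a i j e
  | seq c d => .seq c.compile d.compile
  | ite b c d => .ite b c.compile d.compile
  | forN i c => .seq (.nset i (.lit 0)) (.loop (.not (.nle (.reg 0) (.reg i)))
      (.seq c.compile (.nset i (.add (.reg i) (.lit 1)))))

end Cmd

/-- Overwriting a natural number register. -/
def State.setN (s : State) (x k : ℕ) : State := { s with nreg := Function.update s.nreg x k }

/-- `f` applied for the counter values `0`, …, `k - 1`. -/
def State.iter (f : State → State) (i : ℕ) (s : State) : ℕ → State
  | 0 => s.setN i 0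
  | k + 1 => (f (State.iter f i s k)).setN i (k + 1)

namespace Cmd

open Classical in
/-- The effect of a structured program on the memory. -/
noncomputable def run : Cmd → State → State
  | skip, s => s
  | nset x e, s => { s with nreg := Function.update s.nreg x (e.eval s) }
  | rset x e, s => { s with rreg := Function.update s.rreg x (e.eval s) }
  | nput a i j e, s => { s with narr := setCell s.narr a (i.eval s) (j.eval s) (e.eval s) }
  | rput a i j e, s => { s with rarr := setCell s.rarr a (i.eval s) (j.eval s) (e.eval s) }
  | seq c d, s => d.run (c.run s)
  | ite b c d, s => if b.Holds s then c.run s else d.run s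
  | forN i c, s => s.iter c.run i (s.nreg 0)

/-- The natural number registers a program may change. -/
def nregs : Cmd → List ℕ
  | nset x _ => [x]
  | seq c d => c.nregs ++ d.nregs
  | ite _ c d => c.nregs ++ d.nregs
  | forN i c => i :: c.nregs
  | _ => []

/-- The real registers a program may change. -/
def rregs : Cmd → List ℕ
  | rset x _ => [x]
  | seq c d => c.rregs ++ d.rregs
  | ite _ c d => c.rregs ++ d.rregs
  | forN _ c => c.rregs
  | _ => []

/-- The natural number arrays a program may change. -/
def narrs : Cmd → List ℕ
  | nput a _ _ _ => [a]
  | seq c d => c.narrs ++ d.narrs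
  | ite _ c d => c.narrs ++ d.narrs
  | forN _ c => c.narrs
  | _ => []

/-- The real arrays a program may change. -/
def rarrs : Cmd → List ℕ
  | rput a _ _ _ => [a]
  | seq c d => c.rarrs ++ d.rarrs
  | ite _ c d => c.rarrs ++ d.rarrs
  | forN _ c => c.rarrs
  | _ => []

/-- No loop body changes its own counter. -/
def wf : Cmd → Bool
  | seq c d => c.wf && d.wf
  | ite _ c d => c.wf && d.wf
  | forN i c => !c.nregs.contains i && c.wf
  | _ => true

/-- Several programs one after the other. -/
def block : List Cmd → Cmd
  | [] => skip
  | [c] => c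
  | c :: cs => seq c (block cs)

/-- Frame rule: this and its three analogues carry untouched parts of the memory through a program
by inspection of its text. -/
theorem run_nreg (c : Cmd) : ∀ (s : State) {x : ℕ}, x ∉ c.nregs → (c.run s).nreg x = s.nreg x := by
  induction c with
  | nset y e => intro s x hx; simp [nregs] at hx; simp [run, hx]
  | seq c d ihc ihd =>
    intro s x hx
    simp [nregs] at hx
    rw [run, ihd _ hx.2, ihc _ hx.1]
  | ite b c d ihc ihd =>
    intro s x hx
    simp [nregs] at hx
    rw [run]
    split
    · exact ihc _ hx.1
    · exact ihd _ hx.2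
  | forN i c ih =>
    intro s x hx
    simp only [nregs, List.mem_cons, not_or] at hx
    rw [run]
    generalize s.nreg 0 = k
    induction k with
    | zero => simp [State.iter, State.setN, hx.1]
    | succ k ihk => simp [State.iter, State.setN, hx.1, ih _ hx.2, ihk]
  | _ => intro s x _; rfl

theorem run_rreg (c : Cmd) : ∀ (s : State) {x : ℕ}, x ∉ c.rregs → (c.run s).rreg x = s.rreg x := by
  induction c with
  | rset y e => intro s x hx; simp [rregs] at hx; simp [run, hx]
  | seq c d ihc ihd =>
    intro s x hx
    simp [rregs] at hx
    rw [run, ihd _ hx.2, ihc _ hx.1]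
  | ite b c d ihc ihd =>
    intro s x hx
    simp [rregs] at hx
    rw [run]
    split
    · exact ihc _ hx.1
    · exact ihd _ hx.2
  | forN i c ih =>
    intro s x hx
    rw [run]
    generalize s.nreg 0 = k
    induction k with
    | zero => simp [State.iter, State.setN]
    | succ k ihk => simp [State.iter, State.setN, ih _ hx, ihk]
  | _ => intro s x _; rfl

theorem run_narr (c : Cmd) : ∀ (s : State) {x : ℕ}, x ∉ c.narrs → (c.run s).narr x = s.narr x := by
  induction c with
  | nput y i j e =>
    intro s x hx
    simp [narrs] at hx
    funext i j
    simp [run, setCell, hx]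
  | seq c d ihc ihd =>
    intro s x hx
    simp [narrs] at hx
    rw [run, ihd _ hx.2, ihc _ hx.1]
  | ite b c d ihc ihd =>
    intro s x hx
    simp [narrs] at hx
    rw [run]
    split
    · exact ihc _ hx.1
    · exact ihd _ hx.2
  | forN i c ih =>
    intro s x hx
    rw [run]
    generalize s.nreg 0 = k
    induction k with
    | zero => simp [State.iter, State.setN]
    | succ k ihk => simp [State.iter, State.setN, ih _ hx, ihk]
  | _ => intro s x _; rfl

theorem run_rarr (c : Cmd) : ∀ (s : State) {x : ℕ}, x ∉ c.rarrs → (c.run s).rarr x = s.rarr x := by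
  induction c with
  | rput y i j e =>
    intro s x hx
    simp [rarrs] at hx
    funext i j
    simp [run, setCell, hx]
  | seq c d ihc ihd =>
    intro s x hx
    simp [rarrs] at hx
    rw [run, ihd _ hx.2, ihc _ hx.1]
  | ite b c d ihc ihd =>
    intro s x hx
    simp [rarrs] at hx
    rw [run]
    split
    · exact ihc _ hx.1
    · exact ihd _ hx.2
  | forN i c ih =>
    intro s x hx
    rw [run]
    generalize s.nreg 0 = k
    induction k with
    | zero => simp [State.iter, State.setN]
    | succ k ihk => simp [State.iter, State.setN, ih _ hx, ihk]
  | _ => intro s x _; rfl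

/-- A bound for the running time, as a polynomial in the content of register `0`. -/
noncomputable def costPoly : Cmd → Polynomial ℕ
  | skip => 1
  | nset _ e => Polynomial.C (e.cost + 1)
  | rset _ e => Polynomial.C (e.cost + 1)
  | nput _ i j e => Polynomial.C (i.cost + j.cost + e.cost + 1)
  | rput _ i j e => Polynomial.C (i.cost + j.cost + e.cost + 1)
  | seq c d => c.costPoly + d.costPoly
  | ite b c d => Polynomial.C (b.cost + 1) + c.costPoly + d.costPoly
  | forN _ c => Polynomial.X * (c.costPoly + 9) + 7

/-- Beyond the body, a round costs 4 for the test, 4 for the increment and 1 for the loop step; the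
final failed test costs 5. Here `m` counts the remaining rounds. -/
theorem exec_loop {c : Cmd} {i n K : ℕ} {s : State} (hi : i ∉ c.nregs) (h0 : 0 ∉ c.nregs)
    (hi0 : i ≠ 0) (hs : s.nreg 0 = n)
    (hc : ∀ t : State, t.nreg 0 = n → ∃ k ≤ K, Exec c.compile t k (c.run t)) (m j : ℕ)
    (hm : j + m = n) :
    ∃ k ≤ m * (K + 9) + 5, Exec (.loop (.not (.nle (.reg 0) (.reg i)))
      (.seq c.compile (.nset i (.add (.reg i) (.lit 1))))) (s.iter c.run i j) k
        (s.iter c.run i n) := by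
  have h0' : ∀ j, (s.iter c.run i j).nreg 0 = n := by
    intro j
    induction j with
    | zero => simp [State.iter, State.setN, hi0.symm, hs]
    | succ j ih => simp [State.iter, State.setN, hi0.symm, run_nreg c _ h0, ih]
  have hi' : ∀ j, (s.iter c.run i j).nreg i = j := by
    intro j
    induction j <;> simp [State.iter, State.setN]
  induction m generalizing j with
  | zero =>
    obtain rfl : j = n := by omega
    refine ⟨_, ?_, Exec.loop_done ?_⟩
    · simp [Test.cost, NExp.cost]
    · simp [Test.Holds, NExp.eval, h0', hi']
  | succ m ih =>
    obtain ⟨k, hk, hek⟩ := hc (s.iter c.run i j) (h0' j)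
    obtain ⟨k', hk', hek'⟩ := ih (j + 1) (by omega)
    -- `State.iter` overwrites the counter while the program increments it. They agree because the
    -- body leaves the counter alone.
    have hstep : s.iter c.run i (j + 1) = { c.run (s.iter c.run i j) with
        nreg := Function.update (c.run (s.iter c.run i j)).nreg i
          ((NExp.add (.reg i) (.lit 1)).eval (c.run (s.iter c.run i j))) } := by
      simp [State.iter, State.setN, NExp.eval, run_nreg c _ hi, hi']
    rw [hstep] at hek'
    refine ⟨_, ?_, Exec.loop_step ?_ (Exec.seq hek (Exec.nset _ _ _)) hek'⟩
    · simp only [Test.cost, NExp.cost]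
      rw [Nat.succ_mul]
      omega
    · simp only [Test.Holds, NExp.eval, h0', hi']
      omega

/-- A structured program halts in polynomial time. -/
theorem exec_compile (c : Cmd) : c.wf = true → 0 ∉ c.nregs → ∀ s : State,
    ∃ k ≤ c.costPoly.eval (s.nreg 0), Exec c.compile s k (c.run s) := by
  induction c with
  | skip => exact fun _ _ s => ⟨1, by simp [costPoly], Exec.skip s⟩
  | nset x e => exact fun _ _ s => ⟨_, by simp [costPoly], Exec.nset s x e⟩
  | rset x e => exact fun _ _ s => ⟨_, by simp [costPoly], Exec.rset s x e⟩
  | nput a i j e => exact fun _ _ s => ⟨_, by simp [costPoly], Exec.nput s a i j e⟩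
  | rput a i j e => exact fun _ _ s => ⟨_, by simp [costPoly], Exec.rput s a i j e⟩
  | seq c d ihc ihd =>
    intro hw h0 s
    simp only [wf, Bool.and_eq_true] at hw
    simp only [nregs, List.mem_append, not_or] at h0
    obtain ⟨k, hk, hek⟩ := ihc hw.1 h0.1 s
    obtain ⟨l, hl, hel⟩ := ihd hw.2 h0.2 (c.run s)
    rw [run_nreg c s h0.1] at hl
    exact ⟨k + l, by simp [costPoly]; omega, hek.seq hel⟩
  | ite b c d ihc ihd =>
    intro hw h0 s
    simp only [wf, Bool.and_eq_true] at hw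
    simp only [nregs, List.mem_append, not_or] at h0
    by_cases hb : b.Holds s
    · obtain ⟨k, hk, hek⟩ := ihc hw.1 h0.1 s
      refine ⟨_, ?_, by simpa [run, compile, hb] using Exec.ite_true hb hek⟩
      simp [costPoly]
      omega
    · obtain ⟨k, hk, hek⟩ := ihd hw.2 h0.2 s
      refine ⟨_, ?_, by simpa [run, compile, hb] using Exec.ite_false hb hek⟩
      simp [costPoly]
      omega
  | forN i c ih =>
    intro hw h0 s
    simp only [wf, Bool.and_eq_true, Bool.not_eq_true', List.contains_eq_mem,
      decide_eq_false_iff_not] at hw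
    simp only [nregs, List.mem_cons, not_or] at h0
    obtain ⟨k, hk, hek⟩ := exec_loop hw.1 h0.2 (Ne.symm h0.1) (s := s) rfl
      (fun t ht => by simpa [ht] using ih hw.2 h0.2 t) (s.nreg 0) 0 (Nat.zero_add _)
    refine ⟨_, ?_, Exec.seq (Exec.nset _ _ _) hek⟩
    simp [costPoly, NExp.cost]
    omega

/-- Loops are analysed by invariants. -/
theorem run_for_induction {c : Cmd} {i : ℕ} {s : State} (Inv : ℕ → State → Prop) {n : ℕ}
    (hn : s.nreg 0 = n) (hi0 : i ≠ 0) (h0 : 0 ∉ c.nregs) (hinit : Inv 0 (s.setN i 0))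
    (hstep : ∀ j < n, ∀ t : State, t.nreg 0 = n → t.nreg i = j → Inv j t →
      Inv (j + 1) ((c.run t).setN i (j + 1))) :
    Inv n ((Cmd.forN i c).run s) := by
  have main : ∀ j ≤ n, Inv j (s.iter c.run i j) ∧ (s.iter c.run i j).nreg 0 = n ∧
      (s.iter c.run i j).nreg i = j := by
    intro j
    induction j with
    | zero => exact fun _ => ⟨hinit, by simp [State.iter, State.setN, hi0.symm, hn],
        by simp [State.iter, State.setN]⟩
    | succ j ih =>
      intro hj
      obtain ⟨h1, h2, h3⟩ := ih (by omega)
      exact ⟨hstep j (by omega) _ h2 h3 h1,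
        by simp [State.iter, State.setN, hi0.symm, run_nreg c _ h0, h2],
        by simp [State.iter, State.setN]⟩
  rw [run, hn]
  exact (main n le_rfl).1

end Cmd

/-- Disjunction. -/
def Test.or (b c : Test) : Test := .not (.and (.not b) (.not c))

theorem Test.or_holds {b c : Test} {s : State} :
    (b.or c).Holds s ↔ b.Holds s ∨ c.Holds s := by
  simp only [Test.or, Test.Holds]
  tauto

end RealRAM

/-! ### Shortest walks by dynamic programming -/

namespace RealRAM

/-- Lexicographic comparison of pairs of a length and a number of missing edges. -/
def LexLe (l : ℝ) (m : ℕ) (l' : ℝ) (m' : ℕ) : Prop := l < l' ∨ l = l' ∧ m ≤ m'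

theorem LexLe.refl (l : ℝ) (m : ℕ) : LexLe l m l m := .inr ⟨rfl, le_rfl⟩

theorem LexLe.trans {l l' l'' : ℝ} {m m' m'' : ℕ} (h : LexLe l m l' m') (h' : LexLe l' m' l'' m'') :
    LexLe l m l'' m'' := by
  rcases h with h | ⟨rfl, h⟩
  · rcases h' with h' | ⟨rfl, h'⟩
    · exact .inl (h.trans h')
    · exact .inl h
  · rcases h' with h' | ⟨rfl, h'⟩
    · exact .inl h'
    · exact .inr ⟨rfl, h.trans h'⟩

theorem LexLe.add {l l' : ℝ} {m m' : ℕ} (h : LexLe l m l' m') (c : ℝ) (k : ℕ) :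
    LexLe (l + c) (m + k) (l' + c) (m' + k) := by
  rcases h with h | ⟨rfl, h⟩
  · exact .inl (by linarith)
  · exact .inr ⟨rfl, by omega⟩

/-- The entry `(f', l', m', p')` (reachability flag, length, missing edges, predecessor) of the
vertex `x` in the next layer is the best one that arises from the entries `(f, l, m)` of the
present layer by staying at `x` or by moving to `x` from some `y < Y`. -/
structure Relaxed (f : ℕ → ℕ) (l : ℕ → ℝ) (m : ℕ → ℕ) (adj : ℕ → ℕ) (wt : ℕ → ℝ) (ms : ℕ → ℕ)
    (x Y f' : ℕ) (l' : ℝ) (m' p' : ℕ) : Prop where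
  sound : 1 ≤ f' → (p' = x ∧ 1 ≤ f x ∧ l' = l x ∧ m' = m x) ∨
    (p' < Y ∧ 1 ≤ adj p' ∧ 1 ≤ f p' ∧ l' = l p' + wt p' ∧ m' = m p' + ms p')
  stay : 1 ≤ f x → 1 ≤ f' ∧ LexLe l' m' (l x) (m x)
  move : ∀ y < Y, 1 ≤ f y → 1 ≤ adj y → 1 ≤ f' ∧ LexLe l' m' (l y + wt y) (m y + ms y)

variable {f : ℕ → ℕ} {l : ℕ → ℝ} {m adj : ℕ → ℕ} {wt : ℕ → ℝ} {ms : ℕ → ℕ} {x Y f' : ℕ} {l' : ℝ}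
  {m' p' : ℕ}

theorem Relaxed.init : Relaxed f l m adj wt ms x 0 (f x) (l x) (m x) x :=
  ⟨fun h => .inl ⟨rfl, h, rfl, rfl⟩, fun h => ⟨h, LexLe.refl _ _⟩, by simp⟩

/-- Each alternative of the test makes the new candidate lexicographically at most the old entry, or
the old entry is unset. By transitivity it then dominates all earlier candidates. -/
theorem Relaxed.update (h : Relaxed f l m adj wt ms x Y f' l' m' p') (hf : 1 ≤ f Y) (ha : 1 ≤ adj Y)
    (hc : f' ≤ 0 ∨ ¬ l' ≤ l Y + wt Y ∨ l Y + wt Y ≤ l' ∧ ¬ m' ≤ m Y + ms Y) :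
    Relaxed f l m adj wt ms x (Y + 1) 1 (l Y + wt Y) (m Y + ms Y) Y := by
  have key : ∀ l₀ m₀, 1 ≤ f' ∧ LexLe l' m' l₀ m₀ → LexLe (l Y + wt Y) (m Y + ms Y) l₀ m₀ := by
    rintro l₀ m₀ ⟨h1, h2⟩
    refine LexLe.trans ?_ h2
    rcases hc with hc | hc | hc
    · omega
    · exact .inl (not_le.1 hc)
    · rcases hc.1.lt_or_eq with h3 | h3
      · exact .inl h3
      · exact .inr ⟨h3, by omega⟩
  refine ⟨fun _ => .inr ⟨by omega, ha, hf, rfl, rfl⟩, fun hx => ⟨le_rfl, key _ _ (h.stay hx)⟩,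
    fun y hy hfy hay => ⟨le_rfl, ?_⟩⟩
  rcases Nat.lt_succ_iff_lt_or_eq.1 hy with hy | rfl
  · exact key _ _ (h.move y hy hfy hay)
  · exact LexLe.refl _ _

theorem Relaxed.keep (h : Relaxed f l m adj wt ms x Y f' l' m' p')
    (hc : ¬ (1 ≤ f Y ∧ 1 ≤ adj Y ∧
      (f' ≤ 0 ∨ ¬ l' ≤ l Y + wt Y ∨ l Y + wt Y ≤ l' ∧ ¬ m' ≤ m Y + ms Y))) :
    Relaxed f l m adj wt ms x (Y + 1) f' l' m' p' := by
  refine ⟨fun hf => ?_, h.stay, fun y hy hfy hay => ?_⟩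
  · rcases h.sound hf with h | ⟨h, h'⟩
    · exact .inl h
    · exact .inr ⟨by omega, h'⟩
  · rcases Nat.lt_succ_iff_lt_or_eq.1 hy with hy | rfl
    · exact h.move y hy hfy hay
    · have hc' : ¬ (f' ≤ 0 ∨ ¬ l' ≤ l y + wt y ∨ l y + wt y ≤ l' ∧ ¬ m' ≤ m y + ms y) :=
        fun h => hc ⟨hfy, hay, h⟩
      push Not at hc'
      refine ⟨by omega, ?_⟩
      rcases hc'.2.1.lt_or_eq with h3 | h3
      · exact .inl h3
      · exact .inr ⟨h3, hc'.2.2 h3.ge⟩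

/-- `Relaxed` for the tables in the memory: the arrays `o`, `o + 1`, `o + 2` hold the flags, the
numbers of missing edges and the predecessors, the real array `o` the lengths. -/
def State.RelaxedAt (s : State) (A o k x Y : ℕ) : Prop :=
  Relaxed (s.narr o k) (s.rarr o k) (s.narr (o + 1) k) (fun y => s.narr A y x)
    (fun y => s.rarr 0 y x) (fun y => 1 - s.narr 1 y x) x Y (s.narr o (k + 1) x)
    (s.rarr o (k + 1) x) (s.narr (o + 1) (k + 1) x) (s.narr (o + 2) (k + 1) x)

namespace Cmd

open NExp in
/-- Trying to improve the entry of the vertex in register `22` by moving there from the vertex in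
register `23`. -/
def relax (A o : ℕ) : Cmd :=
  .ite (.and (.nle (lit 1) (cell o (reg 21) (reg 23))) (.and (.nle (lit 1) (cell A (reg 23) (reg 22)))
      (.or (.nle (cell o (add (reg 21) (lit 1)) (reg 22)) (lit 0))
        (.or (.not (.rle (.cell o (add (reg 21) (lit 1)) (reg 22))
              (.add (.cell o (reg 21) (reg 23)) (.cell 0 (reg 23) (reg 22)))))
          (.and (.rle (.add (.cell o (reg 21) (reg 23)) (.cell 0 (reg 23) (reg 22)))
              (.cell o (add (reg 21) (lit 1)) (reg 22)))
            (.not (.nle (cell (o + 1) (add (reg 21) (lit 1)) (reg 22))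
              (add (cell (o + 1) (reg 21) (reg 23))
                (sub (lit 1) (cell 1 (reg 23) (reg 22)))))))))))
    (block [
      nput o (add (reg 21) (lit 1)) (reg 22) (lit 1),
      rput o (add (reg 21) (lit 1)) (reg 22)
        (.add (.cell o (reg 21) (reg 23)) (.cell 0 (reg 23) (reg 22))),
      nput (o + 1) (add (reg 21) (lit 1)) (reg 22)
        (add (cell (o + 1) (reg 21) (reg 23)) (sub (lit 1) (cell 1 (reg 23) (reg 22)))),
      nput (o + 2) (add (reg 21) (lit 1)) (reg 22) (reg 23)])
    skip

open NExp in
/-- Computing the entry of the vertex in register `22` in the layer after that in register `21`. -/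
def entry (A o : ℕ) : Cmd :=
  block [
    nput o (add (reg 21) (lit 1)) (reg 22) (cell o (reg 21) (reg 22)),
    rput o (add (reg 21) (lit 1)) (reg 22) (.cell o (reg 21) (reg 22)),
    nput (o + 1) (add (reg 21) (lit 1)) (reg 22) (cell (o + 1) (reg 21) (reg 22)),
    nput (o + 2) (add (reg 21) (lit 1)) (reg 22) (reg 22),
    forN 23 (relax A o)]

open NExp in
/-- Computing the lightest walks in the graph of array `A` from the vertex in register `20`, for
each number of edges up to that of the vertices. Among walks of the same length those with few edges
missing in the graph of array `1` are preferred. -/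
def shortest (A o : ℕ) : Cmd :=
  block [
    forN 22 (nput o (lit 0) (reg 22) (lit 0)),
    nput o (lit 0) (reg 20) (lit 1),
    rput o (lit 0) (reg 20) (.lit 0),
    nput (o + 1) (lit 0) (reg 20) (lit 0),
    forN 21 (forN 22 (entry A o))]

end Cmd

/-- The states `s` and `t` agree except for the entry `(i, j)` of the arrays `o`, `o + 1` and
`o + 2`. -/
structure AgreeOff (o i j : ℕ) (s t : State) : Prop where
  narr : ∀ a i' j', ¬ (i' = i ∧ j' = j) → t.narr a i' j' = s.narr a i' j'
  rarr : ∀ a i' j', ¬ (i' = i ∧ j' = j) → t.rarr a i' j' = s.rarr a i' j'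
  narr_lt : ∀ a < o, t.narr a = s.narr a
  rarr_lt : ∀ a < o, t.rarr a = s.rarr a

theorem AgreeOff.trans {o i j : ℕ} {s t r : State} (h : AgreeOff o i j s t)
    (h' : AgreeOff o i j t r) : AgreeOff o i j s r :=
  ⟨fun a i' j' hn => (h'.narr a i' j' hn).trans (h.narr a i' j' hn),
    fun a i' j' hn => (h'.rarr a i' j' hn).trans (h.rarr a i' j' hn),
    fun a ha => (h'.narr_lt a ha).trans (h.narr_lt a ha),
    fun a ha => (h'.rarr_lt a ha).trans (h.rarr_lt a ha)⟩

theorem AgreeOff.setN {o i j : ℕ} {s t : State} (h : AgreeOff o i j s t) (x k : ℕ) :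
    AgreeOff o i j s (t.setN x k) :=
  ⟨h.narr, h.rarr, h.narr_lt, h.rarr_lt⟩

/-- The relation reads row `k'`, the entry `x'` of the next row, and arrays below `o`; the
overwritten cell is none of these. -/
theorem AgreeOff.relaxedAt {A o k x k' x' Y : ℕ} {s t : State} (hA : A < o) (ho : 1 < o)
    (h : AgreeOff o (k + 1) x s t) (hk : k' < k ∨ k' = k ∧ x' ≠ x) (hr : s.RelaxedAt A o k' x' Y) :
    t.RelaxedAt A o k' x' Y := by
  have e1 : ∀ a, t.narr a k' = s.narr a k' := fun a => by
    funext j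
    exact h.narr a k' j (by omega)
  have e2 : ∀ a, t.rarr a k' = s.rarr a k' := fun a => by
    funext j
    exact h.rarr a k' j (by omega)
  have e3 : ∀ a, t.narr a (k' + 1) x' = s.narr a (k' + 1) x' := fun a => h.narr a _ _ (by omega)
  have e4 : ∀ a, t.rarr a (k' + 1) x' = s.rarr a (k' + 1) x' := fun a => h.rarr a _ _ (by omega)
  unfold State.RelaxedAt at hr ⊢
  simpa only [e1, e2, e3, e4, h.narr_lt A hA, h.narr_lt 1 ho, h.rarr_lt 0 (by omega)] using hr

theorem setCell_of_row_ne {R : Type} (m : ℕ → ℕ → ℕ → R) {a i j a' i' : ℕ} {r : R} (h : i' ≠ i) :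
    setCell m a i j r a' i' = m a' i' := by
  funext j'
  simp [setCell, h]

/-! ### Filling the tables layer by layer -/

open Cmd

theorem relax_spec {A o k x y : ℕ} (hA : A < o) (ho : 1 < o) {t : State} (hk : t.nreg 21 = k)
    (hx : t.nreg 22 = x) (hy : t.nreg 23 = y) (hr : t.RelaxedAt A o k x y) :
    ((relax A o).run t).RelaxedAt A o k x (y + 1) ∧
      AgreeOff o (k + 1) x t ((relax A o).run t) := by
  subst hk hx hy
  rw [relax, run]
  split_ifs with hc
  · simp only [Test.or_holds, Test.Holds, NExp.eval, RExp.eval] at hc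
    constructor
    · have := hr.update hc.1 hc.2.1 hc.2.2
      simpa [State.RelaxedAt, block, run, setCell, NExp.eval, RExp.eval, setCell_of_row_ne, hA.ne,
        (show o ≠ 0 by omega), ho.ne, (show A ≠ o + 1 by omega), (show A ≠ o + 2 by omega),
        (show (0 : ℕ) ≠ o by omega)]
        using this
    · constructor
      · rintro a i' j' hn
        have h1 : ∀ b, ¬ (a = b ∧ i' = t.nreg 21 + 1 ∧ j' = t.nreg 22) := fun b h => hn h.2
        simp [block, run, setCell, NExp.eval, h1]
      · rintro a i' j' hn
        have h1 : ∀ b, ¬ (a = b ∧ i' = t.nreg 21 + 1 ∧ j' = t.nreg 22) := fun b h => hn h.2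
        simp [block, run, setCell, NExp.eval, h1]
      · intro a ha
        funext i j
        simp [block, run, setCell, ha.ne, (show a ≠ o + 1 by omega), (show a ≠ o + 2 by omega)]
      · intro a ha
        funext i j
        simp [block, run, setCell, ha.ne]
  · simp only [Test.or_holds, Test.Holds, NExp.eval, RExp.eval] at hc
    exact ⟨hr.keep hc, by simp [run], by simp [run], by simp [run], by simp [run]⟩

theorem entry_spec {A o k x n : ℕ} (hA : A < o) (ho : 1 < o) {t : State} (hn : t.nreg 0 = n)
    (hk : t.nreg 21 = k) (hx : t.nreg 22 = x) :
    ((entry A o).run t).RelaxedAt A o k x n ∧ AgreeOff o (k + 1) x t ((entry A o).run t) := by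
  rw [entry]
  simp only [block, run.eq_6]
  set t' := (nput (o + 2) (.add (.reg 21) (.lit 1)) (.reg 22) (.reg 22)).run _ with ht'
  have hinit : t'.RelaxedAt A o k x 0 ∧ AgreeOff o (k + 1) x t t' := by
    subst hk hx
    constructor
    · have := Relaxed.init (f := t.narr o (t.nreg 21)) (l := t.rarr o (t.nreg 21))
        (m := t.narr (o + 1) (t.nreg 21)) (adj := fun y => t.narr A y (t.nreg 22))
        (wt := fun y => t.rarr 0 y (t.nreg 22)) (ms := fun y => 1 - t.narr 1 y (t.nreg 22))
        (x := t.nreg 22)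
      simpa [ht', State.RelaxedAt, block, run, setCell, NExp.eval, RExp.eval, setCell_of_row_ne,
        hA.ne, (show o ≠ 0 by omega), ho.ne, (show A ≠ o + 1 by omega), (show A ≠ o + 2 by omega),
        (show (0 : ℕ) ≠ o by omega)] using this
    · constructor
      · rintro a i' j' hn
        have h1 : ∀ b, ¬ (a = b ∧ i' = t.nreg 21 + 1 ∧ j' = t.nreg 22) := fun b h => hn h.2
        simp [ht', run, setCell, NExp.eval, h1]
      · rintro a i' j' hn
        have h1 : ∀ b, ¬ (a = b ∧ i' = t.nreg 21 + 1 ∧ j' = t.nreg 22) := fun b h => hn h.2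
        simp [ht', run, setCell, NExp.eval, h1]
      · intro a ha
        funext i j
        simp [ht', run, setCell, ha.ne, (show a ≠ o + 1 by omega), (show a ≠ o + 2 by omega)]
      · intro a ha
        funext i j
        simp [ht', run, setCell, ha.ne]
  have h0 : t'.nreg 0 = n := by simpa [ht', run] using hn
  have h21 : t'.nreg 21 = k := by simpa [ht', run] using hk
  have h22 : t'.nreg 22 = x := by simpa [ht', run] using hx
  have main := run_for_induction (c := relax A o) (i := 23) (s := t')
    (fun j r => r.RelaxedAt A o k x j ∧ AgreeOff o (k + 1) x t r ∧ r.nreg 21 = k ∧ r.nreg 22 = x)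
    h0 (by decide) (by simp [relax, nregs, block])
    ⟨hinit.1, hinit.2.setN _ _, by simp [State.setN, h21], by simp [State.setN, h22]⟩ ?_
  · exact ⟨main.1, main.2.1⟩
  · rintro j hj r hr0 hrj ⟨h1, h2, h3, h4⟩
    obtain ⟨h5, h6⟩ := relax_spec hA ho h3 h4 hrj h1
    exact ⟨h5, h2.trans (h6.setN _ _), by simpa [State.setN, relax, nregs, block, run_nreg] using h3,
      by simpa [State.setN, relax, nregs, block, run_nreg] using h4⟩

/-- What `shortest A o` has computed. -/
structure State.Table (s : State) (A o n u : ℕ) : Prop where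
  flag : s.narr o 0 u = 1
  len : s.rarr o 0 u = 0
  miss : s.narr (o + 1) 0 u = 0
  other : ∀ x < n, x ≠ u → s.narr o 0 x = 0
  step : ∀ k < n, ∀ x < n, s.RelaxedAt A o k x n

theorem shortest_spec {A o n u : ℕ} (hA : A < o) (ho : 1 < o) {s : State} (hn : s.nreg 0 = n)
    (hu : s.nreg 20 = u) : ((shortest A o).run s).Table A o n u := by
  rw [shortest]
  simp only [block, run.eq_6]
  set s₁ := (forN 22 (nput o (.lit 0) (.reg 22) (.lit 0))).run s with hs₁
  have h1 : ∀ x < n, s₁.narr o 0 x = 0 := by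
    refine run_for_induction (fun j r => ∀ x < j, r.narr o 0 x = 0) hn (by decide)
      (by simp [nregs]) (by simp) ?_
    rintro j hj r hr0 hrj ih x hx
    by_cases hxj : x = j
    · simp [State.setN, run, setCell, NExp.eval, hrj, hxj]
    · simpa [State.setN, run, setCell, NExp.eval, hrj, hxj] using ih x (by omega)
  have hn₁ : s₁.nreg 0 = n := by rw [hs₁, run_nreg _ _ (by simp [nregs]), hn]
  have hu₁ : s₁.nreg 20 = u := by rw [hs₁, run_nreg _ _ (by simp [nregs]), hu]
  set s₂ := (nput (o + 1) (.lit 0) (.reg 20) (.lit 0)).run _ with hs₂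
  have hn₂ : s₂.nreg 0 = n := by simpa [hs₂, run] using hn₁
  let Row (t : State) : Prop := t.narr o 0 u = 1 ∧ t.rarr o 0 u = 0 ∧ t.narr (o + 1) 0 u = 0 ∧
    ∀ x < n, x ≠ u → t.narr o 0 x = 0
  have h2 : Row s₂ := by
    subst hu₁
    refine ⟨?_, ?_, ?_, fun x hx hxu => ?_⟩
    · simp [hs₂, run, setCell, NExp.eval]
    · simp [hs₂, run, setCell, NExp.eval, RExp.eval]
    · simp [hs₂, run, setCell, NExp.eval]
    · simpa [hs₂, run, setCell, NExp.eval, hxu] using h1 x hx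
  -- Relaxation writes only to rows `k + 1`, so row zero survives.
  have hRow : ∀ {k x t r}, AgreeOff o (k + 1) x t r → Row t → Row r := by
    rintro k x t r h ⟨e1, e2, e3, e4⟩
    exact ⟨by rw [h.narr _ _ _ (by omega), e1], by rw [h.rarr _ _ _ (by omega), e2],
      by rw [h.narr _ _ _ (by omega), e3],
      fun x hx hxu => by rw [h.narr _ _ _ (by omega), e4 x hx hxu]⟩
  have main := run_for_induction (c := forN 22 (entry A o)) (i := 21) (s := s₂)
    (fun j t => Row t ∧ ∀ k < j, ∀ x < n, t.RelaxedAt A o k x n) hn₂ (by decide)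
    (by simp [nregs, entry, relax, block]) ⟨h2, by simp⟩ ?_
  · exact ⟨main.1.1, main.1.2.1, main.1.2.2.1, main.1.2.2.2, main.2⟩
  · rintro j hj t ht0 ht21 ⟨ht1, ht2⟩
    have inner := run_for_induction (c := entry A o) (i := 22) (s := t)
      (fun i r => Row r ∧ (∀ k < j, ∀ x < n, r.RelaxedAt A o k x n) ∧
        (∀ x < i, r.RelaxedAt A o j x n) ∧ r.nreg 21 = j) ht0 (by decide)
      (by simp [nregs, entry, relax, block]) ⟨ht1, ht2, by simp, by simpa [State.setN] using ht21⟩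
      ?_
    · refine ⟨inner.1, fun k hk x hx => ?_⟩
      rcases Nat.lt_succ_iff_lt_or_eq.1 hk with hk | rfl
      · exact inner.2.1 k hk x hx
      · exact inner.2.2.1 x hx
    · rintro i hi r hr0 hr22 ⟨hr1, hr2, hr3, hr21⟩
      obtain ⟨e1, e2⟩ := entry_spec hA ho hr0 hr21 hr22
      replace e2 := e2.setN 22 (i + 1)
      refine ⟨hRow e2 hr1, fun k hk x hx => e2.relaxedAt hA ho (.inl hk) (hr2 k hk x hx),
        fun x hx => ?_, ?_⟩
      · rcases Nat.lt_succ_iff_lt_or_eq.1 hx with hx | rfl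
        · exact e2.relaxedAt hA ho (.inr ⟨rfl, by omega⟩) (hr3 x hx)
        · exact e1
      · simpa [State.setN, entry, relax, nregs, block, run_nreg] using hr21

end RealRAM

/-! ### Graphs in the memory -/

namespace RealRAM

variable {n : ℕ}

/-- The natural number array `A` is the adjacency matrix of `K`. -/
def State.Rep (s : State) (A : ℕ) (K : SimpleGraph (Fin n)) : Prop :=
  ∀ i j : Fin n, (K.Adj i j → s.narr A i j = 1) ∧ (¬ K.Adj i j → s.narr A i j = 0)

theorem State.Rep.le_iff {s : State} {A : ℕ} {K : SimpleGraph (Fin n)} (h : s.Rep A K)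
    (i j : Fin n) : 1 ≤ s.narr A i j ↔ K.Adj i j := by
  by_cases hij : K.Adj i j
  · simp [hij, (h i j).1 hij]
  · simp [hij, (h i j).2 hij]

theorem State.Rep.congr {s t : State} {A : ℕ} {K : SimpleGraph (Fin n)} (h : s.Rep A K)
    (hst : t.narr A = s.narr A) : t.Rep A K := by
  simpa only [State.Rep, hst] using h

/-- The real array `0` contains the weights of the edges of `G`. -/
def State.RepWeight (s : State) (G : WeightedGraph n) : Prop :=
  ∀ i j : Fin n, G.graph.Adj i j → s.rarr 0 i j = G.w s(i, j)

theorem missing_eq {s : State} {H : SimpleGraph (Fin n)} (h : s.Rep 1 H) (i j : Fin n) :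
    1 - s.narr 1 i j = missing H s(i, j) := by
  by_cases hij : H.Adj i j
  · simp [missing, hij, (h i j).1 hij]
  · simp [missing, hij, (h i j).2 hij]

theorem missCount_bypass_le {H K : SimpleGraph (Fin n)} {u v : Fin n} (q : K.Walk u v) :
    missCount H q.bypass ≤ missCount H q := by
  unfold missCount
  obtain ⟨l, hl, hs⟩ := (q.bypass_isPath).edges_nodup.subperm q.edges_bypass_subset_edges
  rw [← (hl.map _).sum_eq]
  exact (hs.map _).sum_le_sum (by simp)

/-! ### Correctness of the tables -/

section Table

variable {G : WeightedGraph n} {K H : SimpleGraph (Fin n)} {s : State} {A o : ℕ} {u : Fin n}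

/-- Induction along the walk towards the source: the previous layer is at least as good as the tail,
and adding the first edge preserves the order. Staying put carries walks with few edges to later
layers. -/
theorem State.Table.complete (hT : s.Table A o n u) (hK : s.Rep A K) (hH : s.Rep 1 H)
    (hw : s.RepWeight G) (hKG : K ≤ G.graph) {x : Fin n} (q : K.Walk x u) :
    ∀ k ≤ n, q.length ≤ k → 1 ≤ s.narr o k x ∧
      LexLe (s.rarr o k x) (s.narr (o + 1) k x) (length G.w q) (missCount H q) := by
  have hT' := hT.step
  induction q with
  | nil =>
    intro k hk _
    induction k with
    | zero => exact ⟨hT.flag.ge, .inr ⟨by simp [hT.len, length], by simp [hT.miss]⟩⟩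
    | succ k ih =>
      obtain ⟨h1, h2⟩ := ih (by omega) (by simp)
      obtain ⟨h3, h4⟩ := (hT' k hk _ (Fin.is_lt _)).stay h1
      exact ⟨h3, h4.trans h2⟩
  | @cons x y z hxy q ih =>
    intro k hk hq
    rw [SimpleGraph.Walk.length_cons] at hq
    obtain ⟨k, rfl⟩ : ∃ k', k = k' + 1 := ⟨k - 1, by omega⟩
    obtain ⟨h1, h2⟩ := ih hT k (by omega) (by omega)
    obtain ⟨h3, h4⟩ := (hT' k (by omega) x x.2).move y y.2 h1 ((hK.le_iff y x).2 hxy.symm)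
    refine ⟨h3, h4.trans ?_⟩
    have := h2.add (G.w s(x, y)) (missing H s(x, y))
    rw [missing_eq hH, hw y x (hKG hxy.symm), Sym2.eq_swap]
    rw [WeightedGraph.length_cons, NNReal.coe_add, add_comm (G.w s(x, y) : ℝ)]
    have hm : missCount H (SimpleGraph.Walk.cons hxy q) = missCount H q + missing H s(x, y) := by
      simp [missCount, add_comm]
    rwa [hm]

/-- The alternatives for the predecessor of an entry of the table. -/
theorem State.Table.pred (hT : s.Table A o n u) (hK : s.Rep A K) (hH : s.Rep 1 H)
    (hw : s.RepWeight G) (hKG : K ≤ G.graph) {k : ℕ} (hk : k < n) (x : Fin n)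
    (hx : 1 ≤ s.narr o (k + 1) x) :
    ∃ y : Fin n, s.narr (o + 2) (k + 1) x = y ∧ 1 ≤ s.narr o k y ∧
      ((y = x ∧ s.rarr o (k + 1) x = s.rarr o k x ∧
          s.narr (o + 1) (k + 1) x = s.narr (o + 1) k x) ∨
        (K.Adj x y ∧ s.rarr o (k + 1) x = s.rarr o k y + G.w s(x, y) ∧
          s.narr (o + 1) (k + 1) x = s.narr (o + 1) k y + missing H s(x, y))) := by
  rcases (hT.step k hk x x.2).sound hx with ⟨h1, h2, h3, h4⟩ | ⟨h1, h2, h3, h4, h5⟩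
  · exact ⟨x, h1, h2, .inl ⟨rfl, h3, h4⟩⟩
  · obtain ⟨y, hy⟩ : ∃ y : Fin n, s.narr (o + 2) (k + 1) x = y := ⟨⟨_, h1⟩, rfl⟩
    rw [hy] at h2 h3 h4 h5
    have hyx := (hK.le_iff y x).1 h2
    refine ⟨y, hy, h3, .inr ⟨hyx.symm, ?_, ?_⟩⟩
    · rw [h4, hw y x (hKG hyx), Sym2.eq_swap]
    · rw [h5, missing_eq hH, Sym2.eq_swap]

theorem State.Table.eq_of_zero (hT : s.Table A o n u) {x : Fin n} (hx : 1 ≤ s.narr o 0 x) :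
    x = u := by
  by_contra h
  have := hT.other x x.2 (fun h' => h (Fin.ext h'))
  omega

/-- Following the predecessors down the layers spells out a walk of exactly the recorded length. -/
theorem State.Table.sound (hT : s.Table A o n u) (hK : s.Rep A K) (hH : s.Rep 1 H)
    (hw : s.RepWeight G) (hKG : K ≤ G.graph) : ∀ k ≤ n, ∀ x : Fin n, 1 ≤ s.narr o k x →
      ∃ q : K.Walk x u, (length G.w q : ℝ) = s.rarr o k x := by
  intro k
  induction k with
  | zero =>
    intro _ x hx
    obtain rfl := hT.eq_of_zero hx
    exact ⟨.nil, by simp [length, hT.len]⟩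
  | succ k ih =>
    intro hk x hx
    obtain ⟨y, -, hy, ⟨rfl, h1, h2⟩ | ⟨h1, h2, h3⟩⟩ := hT.pred hK hH hw hKG hk x hx
    · rw [h1]
      exact ih (by omega) y hy
    · obtain ⟨q, hq⟩ := ih (by omega) y hy
      exact ⟨.cons h1 q, by rw [WeightedGraph.length_cons, h2, ← hq]; push_cast; ring⟩

/-- The bypass has fewer than `n` edges and is no worse in either coordinate, so layer `n` is
optimal among all walks. -/
theorem State.Table.lexLe (hT : s.Table A o n u) (hK : s.Rep A K) (hH : s.Rep 1 H)
    (hw : s.RepWeight G) (hKG : K ≤ G.graph) {x : Fin n} (q : K.Walk x u) :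
    1 ≤ s.narr o n x ∧
      LexLe (s.rarr o n x) (s.narr (o + 1) n x) (length G.w q) (missCount H q) := by
  have hlt := q.bypass_isPath.length_lt
  rw [Fintype.card_fin] at hlt
  obtain ⟨h1, h2⟩ := hT.complete hK hH hw hKG q.bypass n le_rfl hlt.le
  refine ⟨h1, h2.trans ?_⟩
  have h3 : (length G.w q.bypass : ℝ) ≤ length G.w q := by
    exact_mod_cast WeightedGraph.length_bypass_le q
  rcases h3.lt_or_eq with h | h
  · exact .inl h
  · exact .inr ⟨h, missCount_bypass_le q⟩

theorem State.Table.dist_eq_top (hT : s.Table A o n u) (hK : s.Rep A K) (hH : s.Rep 1 H)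
    (hw : s.RepWeight G) (hKG : K ≤ G.graph) {x : Fin n} (hx : ¬ 1 ≤ s.narr o n x) :
    dist G.w K x u = ⊤ := by
  have : IsEmpty (K.Walk x u) := ⟨fun q => hx (hT.lexLe hK hH hw hKG q).1⟩
  simp [WeightedGraph.dist]

theorem State.Table.dist_eq (hT : s.Table A o n u) (hK : s.Rep A K) (hH : s.Rep 1 H)
    (hw : s.RepWeight G) (hKG : K ≤ G.graph) {x : Fin n} (hx : 1 ≤ s.narr o n x) :
    dist G.w K x u = ENNReal.ofReal (s.rarr o n x) ∧ 0 ≤ s.rarr o n x := by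
  obtain ⟨q, hq⟩ := hT.sound hK hH hw hKG n le_rfl x hx
  rw [← hq, ENNReal.ofReal_coe_nnreal]
  refine ⟨le_antisymm (dist_le_length q) (le_iInf fun q' => ?_), NNReal.coe_nonneg _⟩
  have h := (hT.lexLe hK hH hw hKG q').2
  rw [← hq] at h
  have : (length G.w q : ℝ) ≤ length G.w q' := by
    rcases h with h | ⟨h, -⟩
    · exact h.le
    · exact h.le
  exact_mod_cast this

end Table

namespace Cmd

/-- Adding the edge between the vertices in the registers `x` and `y` to the graph of array `A`. -/
def addEdge (A x y : ℕ) : Cmd :=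
  block [nput A (.reg x) (.reg y) (.lit 1), nput A (.reg y) (.reg x) (.lit 1)]

/-- Adding the walk from the vertex in register `19` along the predecessors to the graph of
array `1`. -/
def buyPath (o : ℕ) : Cmd :=
  block [
    nset 24 (.reg 19),
    forN 17 (block [
      nset 25 (.cell (o + 2) (.sub (.reg 0) (.reg 17)) (.reg 24)),
      ite (.and (.nle (.reg 25) (.reg 24)) (.nle (.reg 24) (.reg 25))) skip (addEdge 1 25 24),
      nset 24 (.reg 25)])]

end Cmd

open Cmd

theorem addEdge_rep {A x y : ℕ} {s : State} {K : SimpleGraph (Fin n)} (hK : s.Rep A K)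
    {a b : Fin n} (hab : a ≠ b) (hx : s.nreg x = a) (hy : s.nreg y = b) :
    ((addEdge A x y).run s).Rep A (K ⊔ SimpleGraph.edge a b) := by
  intro i j
  rw [adj_sup_edge hab, Sym2.eq_iff]
  simp only [addEdge, block, run, NExp.eval, setCell, hx, hy, true_and, ← Fin.ext_iff]
  constructor
  · intro h
    split_ifs with h1 h2
    · rfl
    · rfl
    · exact (hK i j).1 (by tauto)
  · intro h
    rw [if_neg (by tauto), if_neg (by tauto)]
    exact (hK i j).2 (by tauto)

/-- At counter value j the current vertex belongs to layer n - j. The walk collected so far and the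
entry at the current vertex add up to the entry at `v`, in both coordinates. At layer zero only the
source is flagged. The entries are those of the initial state, so missing edges are counted relative
to `H`, not to the growing graph. -/
theorem buyPath_spec {G : WeightedGraph n} {K H : SimpleGraph (Fin n)} {s : State} {A o : ℕ}
    {u v : Fin n} (hT : s.Table A o n u) (hK : s.Rep A K) (hH : s.Rep 1 H)
    (hw : s.RepWeight G) (hKG : K ≤ G.graph) (h0 : s.nreg 0 = n) (h19 : s.nreg 19 = v)
    (hv : 1 ≤ s.narr o n v) :
    ∃ (r : K.Walk v u) (H' : SimpleGraph (Fin n)), (length G.w r : ℝ) = s.rarr o n v ∧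
      missCount H r = s.narr (o + 1) n v ∧
      (∀ x y, H'.Adj x y ↔ H.Adj x y ∨ s(x, y) ∈ r.edges) ∧ ((buyPath o).run s).Rep 1 H' := by
  rw [buyPath]
  simp only [block, run.eq_6]
  set s₁ := (nset 24 (.reg 19)).run s with hs₁
  have main := run_for_induction (s := s₁) (i := 17)
    (c := (nset 25 (.cell (o + 2) (.sub (.reg 0) (.reg 17)) (.reg 24))).seq
      ((ite (.and (.nle (.reg 25) (.reg 24)) (.nle (.reg 24) (.reg 25))) skip
        (addEdge 1 25 24)).seq (nset 24 (.reg 25))))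
    (fun j t => t.narr (o + 2) = s.narr (o + 2) ∧
      ∃ (y : Fin n) (r : K.Walk v y) (H' : SimpleGraph (Fin n)), t.nreg 24 = y ∧
        1 ≤ s.narr o (n - j) y ∧ (length G.w r : ℝ) + s.rarr o (n - j) y = s.rarr o n v ∧
        missCount H r + s.narr (o + 1) (n - j) y = s.narr (o + 1) n v ∧
        (∀ x y, H'.Adj x y ↔ H.Adj x y ∨ s(x, y) ∈ r.edges) ∧ t.Rep 1 H')
    (n := n) (by simpa [hs₁, run] using h0) (by decide) (by simp [nregs, addEdge, block])
    ⟨by simp [State.setN, hs₁, run], v, .nil, H, by simp [State.setN, hs₁, run, NExp.eval, h19],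
      by simpa using hv, by simp [length], by simp [missCount], by simp, hH⟩ ?_
  · obtain ⟨-, y, r, H', -, h2, h3, h4, h5, h6⟩ := main
    rw [Nat.sub_self] at h2 h3 h4
    obtain rfl := hT.eq_of_zero h2
    rw [hT.len, add_zero] at h3
    rw [hT.miss, add_zero] at h4
    exact ⟨r, H', h3, h4, h5, h6⟩
  · rintro j hj t ht0 ht17 ⟨hpar, x, r, H', hx, h1, h2, h3, h4, h5⟩
    obtain ⟨k, hk⟩ : ∃ k, n - j = k + 1 := ⟨n - j - 1, by omega⟩
    have hk' : n - (j + 1) = k := by omega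
    rw [hk] at h1 h2 h3
    rw [hk']
    obtain ⟨y, hy, hyk, hcase⟩ := hT.pred hK hH hw hKG (by omega) x h1
    set t₁ := (nset 25 (.cell (o + 2) (.sub (.reg 0) (.reg 17)) (.reg 24))).run t with ht₁
    have e25 : t₁.nreg 25 = y := by
      simp [ht₁, run, NExp.eval, ht0, ht17, hx, hk, hpar, hy]
    have e24 : t₁.nreg 24 = x := by simp [ht₁, run, hx]
    have e1 : t₁.narr = t.narr := by simp [ht₁, run]
    have hrun : ∀ c : Cmd, ((nset 25 (.cell (o + 2) (.sub (.reg 0) (.reg 17)) (.reg 24))).seq c).run t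
        = c.run t₁ := fun c => rfl
    rw [hrun]
    -- A vertex that is its own predecessor means that the walk stays put in this layer; a genuine
    -- move is along an edge, hence to another vertex.
    have hb : (Test.and (.nle (.reg 25) (.reg 24)) (.nle (.reg 24) (.reg 25))).Holds t₁ ↔
        y = x := by
      simp only [Test.Holds, NExp.eval, e25, e24, Fin.ext_iff]
      omega
    rcases hcase with ⟨rfl, h6, h7⟩ | ⟨h6, h7, h8⟩
    · refine ⟨?_, y, r, H', ?_, hyk, by rw [← h6, h2], by rw [← h7, h3], h4, ?_⟩
      · simp only [State.setN, run, hb, if_true]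
        rw [e1, hpar]
      · simp [State.setN, run, hb, NExp.eval, e25]
      · refine h5.congr ?_
        simp only [State.setN, run, hb, if_true]
        rw [e1]
    · have hne : y ≠ x := h6.ne'
      have h5' : t₁.Rep 1 H' := h5.congr (by rw [e1])
      refine ⟨?_, y, r.concat h6, H' ⊔ SimpleGraph.edge y x, ?_, hyk, ?_, ?_, ?_, ?_⟩
      · simp only [State.setN, run, hb, if_neg hne]
        rw [run_narr _ _ (by simp [addEdge, block, narrs]), e1, hpar]
      · simp only [State.setN, run, hb, if_neg hne, NExp.eval]
        rw [run_nreg _ _ (by simp [addEdge, block, nregs]), e25]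
        simp
      · rw [← h2, h7]
        simp only [length, SimpleGraph.Walk.edges_concat, List.concat_eq_append, List.map_append,
          List.map_cons, List.map_nil, List.sum_append, List.sum_singleton]
        push_cast
        ring
      · rw [← h3, h8]
        simp only [missCount, SimpleGraph.Walk.edges_concat, List.concat_eq_append, List.map_append,
          List.map_cons, List.map_nil, List.sum_append, List.sum_singleton]
        ring
      · intro a b
        rw [adj_sup_edge hne, h4]
        simp only [SimpleGraph.Walk.edges_concat, List.concat_eq_append, List.mem_append,
          List.mem_singleton]
        rw [Sym2.eq_swap (a := y), or_assoc]
      · have := addEdge_rep h5' hne e25 e24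
        refine this.congr ?_
        simp only [State.setN, run, hb, if_neg hne]

end RealRAM

/-! ### Processing one edge -/

namespace RealRAM

variable {n : ℕ}

namespace Cmd

/-- Adding `e` to the real register `x`, as many times as register `k` says. -/
def addTimes (i k x : ℕ) (e : RExp) : Cmd :=
  forN i (ite (.not (.nle (.reg k) (.reg i))) (rset x (.add (.reg x) e)) skip)

/-- Multiplication by repeated addition. Every loop runs for the number in register 0, so the
multiplier must not exceed it, and the surplus rounds do nothing. By `he`, the value of `e` is
unaffected by the accumulator. -/
theorem addTimes_spec {i k x : ℕ} {e : RExp} {s : State} {v : ℝ} (hi0 : i ≠ 0) (hik : k ≠ i)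
    (hk : s.nreg k ≤ s.nreg 0) (he : ∀ t : State, (∀ y, y ≠ x → t.rreg y = s.rreg y) → e.eval t = v) :
    ((addTimes i k x e).run s).rreg x = s.rreg x + s.nreg k * v := by
  have := run_for_induction (s := s) (i := i)
    (c := ite (.not (.nle (.reg k) (.reg i))) (rset x (.add (.reg x) e)) skip)
    (fun j t => t.nreg k = s.nreg k ∧ (∀ y, y ≠ x → t.rreg y = s.rreg y) ∧
      t.rreg x = s.rreg x + (min j (s.nreg k) : ℕ) * v) rfl hi0 (by simp [nregs])
    ⟨by simp [State.setN, hik], by simp [State.setN], by simp [State.setN]⟩ ?_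
  · simpa [hk, addTimes] using this.2.2
  · rintro j hj t ht0 hti ⟨h1, h2, h3⟩
    by_cases hjk : s.nreg k ≤ j
    · have hb : ¬ (Test.not (.nle (.reg k) (.reg i))).Holds t := by
        simpa [Test.Holds, NExp.eval, h1, hti] using hjk
      rw [run, if_neg hb]
      refine ⟨by simp [State.setN, run, hik, h1], by simpa [State.setN, run] using h2, ?_⟩
      simp only [State.setN, run, h3]
      rw [min_eq_right hjk, min_eq_right (by omega)]
    · have hb : (Test.not (.nle (.reg k) (.reg i))).Holds t := by
        simpa [Test.Holds, NExp.eval, h1, hti] using hjk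
      rw [run, if_pos hb]
      refine ⟨by simp [State.setN, run, hik, h1], fun y hy => by simp [State.setN, run, hy, h2], ?_⟩
      simp only [State.setN, run, RExp.eval, Function.update_self, h3, he t h2]
      rw [min_eq_left (by omega), min_eq_left (by omega)]
      push_cast
      ring

/-- Selecting an unmarked edge of minimal weight. -/
def selectEdge : Cmd :=
  block [nset 10 (.lit 0),
    forN 11 (forN 12 (ite
      (.and (.nle (.lit 1) (.cell 0 (.reg 11) (.reg 12)))
        (.and (.nle (.cell 2 (.reg 11) (.reg 12)) (.lit 0))
          (.or (.nle (.reg 10) (.lit 0)) (.not (.rle (.reg 3) (.cell 0 (.reg 11) (.reg 12)))))))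
      (block [nset 10 (.lit 1), nset 13 (.reg 11), nset 14 (.reg 12),
        rset 3 (.cell 0 (.reg 11) (.reg 12))])
      skip))]

/-- Computing the degrees of the ends of the selected edge in the graph of array `1`. -/
def degrees : Cmd :=
  block [nset 15 (.lit 0), nset 16 (.lit 0),
    forN 17 (block [nset 15 (.add (.reg 15) (.cell 1 (.reg 13) (.reg 17))),
      nset 16 (.add (.reg 16) (.cell 1 (.reg 14) (.reg 17)))])]

/-- Computing the stretch that is allowed for the selected edge. -/
def edgeBound : Cmd :=
  block [rset 4 (.lit 0), addTimes 17 2 4 (.add (.reg 3) (.reg 3)),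
    rset 4 (.add (.reg 4) (.add (.reg 3) (.add (.reg 3) (.reg 3))))]

/-- Computing the additive stretch that is allowed for paths whose heaviest edge is the selected
one. -/
def pathBound : Cmd :=
  block [rset 6 (.add (.reg 3) (.reg 3)), rset 6 (.add (.reg 6) (.reg 6)),
    rset 6 (.add (.reg 4) (.add (.reg 6) (.reg 6))),
    rset 5 (.lit 0), addTimes 17 5 5 (.add (.reg 6) (.add (.reg 6) (.reg 6)))]

/-- Adding the selected edge, if an end has small degree or if the ends are far apart. -/
def addSelected : Cmd :=
  ite (.or (.not (.nle (.reg 4) (.reg 15))) (.or (.not (.nle (.reg 4) (.reg 16)))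
      (.or (.not (.nle (.lit 1) (.cell 20 (.reg 0) (.reg 14))))
        (.not (.rle (.cell 20 (.reg 0) (.reg 14)) (.reg 4))))))
    (addEdge 1 13 14) skip

/-- Computing the three tables for the source in register `18`. -/
def tables : Cmd :=
  block [nset 20 (.reg 18), shortest 0 10, shortest 1 20, shortest 2 30]

/-- Buying a path between the vertices in the registers `18` and `19`, if there is need. -/
def servePair : Cmd :=
  .seq tables
    (ite (.and (.nle (.lit 1) (.cell 30 (.reg 0) (.reg 19)))
      (.and (.rle (.cell 30 (.reg 0) (.reg 19)) (.cell 10 (.reg 0) (.reg 19)))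
        (.or (.not (.nle (.lit 1) (.cell 20 (.reg 0) (.reg 19))))
          (.not (.rle (.cell 20 (.reg 0) (.reg 19))
            (.add (.cell 30 (.reg 0) (.reg 19)) (.reg 5)))))))
      (buyPath 30) skip)

/-- Deciding about the selected edge. -/
def insertSelected : Cmd :=
  block [degrees, edgeBound, nset 20 (.reg 13), shortest 1 20, addSelected]

/-- Processing the selected edge. -/
def processEdge : Cmd :=
  block [insertSelected, addEdge 2 13 14, pathBound, forN 18 (forN 19 servePair)]

/-- A program does not change the parameters or the graphs. -/
def frames (c : Cmd) : Bool :=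
  [0, 2, 4, 5].all (fun x => !c.nregs.contains x) && [0, 1, 2].all (fun x => !c.narrs.contains x) &&
    !c.rarrs.contains 0

end Cmd

open Cmd

/-- The data that the memory holds between the steps of the algorithm: the parameters, the weighted
graph `G`, the graph `M` of the marked edges and the spanner `H`. -/
structure State.Ctx (s : State) (G : WeightedGraph n) (L d r : ℕ) (M H : SimpleGraph (Fin n)) :
    Prop where
  size : s.nreg 0 = n
  log : s.nreg 2 = L
  deg : s.nreg 4 = d
  root : s.nreg 5 = r
  graph : s.Rep 0 G.graph
  spanner : s.Rep 1 H
  marked : s.Rep 2 M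
  weight : s.RepWeight G

section Steps

variable {G : WeightedGraph n} {L d r : ℕ} {M H : SimpleGraph (Fin n)} {s : State}

theorem State.Ctx.run (h : s.Ctx G L d r M H) (c : Cmd) (hc : c.frames = true) :
    (c.run s).Ctx G L d r M H := by
  simp only [Cmd.frames, List.all_cons, List.all_nil, Bool.and_eq_true, Bool.not_eq_true',
    List.contains_eq_mem, decide_eq_false_iff_not, and_true] at hc
  obtain ⟨⟨⟨h0, h2, h4, h5⟩, a0, a1, a2⟩, r0⟩ := hc
  refine ⟨?_, ?_, ?_, ?_, h.graph.congr (run_narr c s a0), h.spanner.congr (run_narr c s a1),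
    h.marked.congr (run_narr c s a2), ?_⟩
  · rw [run_nreg c s h0, h.size]
  · rw [run_nreg c s h2, h.log]
  · rw [run_nreg c s h4, h.deg]
  · rw [run_nreg c s h5, h.root]
  · simpa only [State.RepWeight, run_rarr c s r0] using h.weight

theorem State.Ctx.setN (h : s.Ctx G L d r M H) {x : ℕ} (k : ℕ) (hx : x ∉ [0, 2, 4, 5]) :
    (s.setN x k).Ctx G L d r M H := by
  simp only [List.mem_cons, List.not_mem_nil, or_false, not_or] at hx
  refine ⟨?_, ?_, ?_, ?_, h.graph, h.spanner, h.marked, h.weight⟩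
  · simp [State.setN, Ne.symm hx.1, h.size]
  · simp [State.setN, Ne.symm hx.2.1, h.log]
  · simp [State.setN, Ne.symm hx.2.2.1, h.deg]
  · simp [State.setN, Ne.symm hx.2.2.2, h.root]

/-- Changing array `1` only. -/
theorem State.Ctx.run_spanner (h : s.Ctx G L d r M H) (c : Cmd) {H' : SimpleGraph (Fin n)}
    (hn : ∀ x ∈ [0, 2, 4, 5], x ∉ c.nregs) (ha : ∀ x ∈ [0, 2], x ∉ c.narrs) (hr : 0 ∉ c.rarrs)
    (hH' : (c.run s).Rep 1 H') : (c.run s).Ctx G L d r M H' := by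
  refine ⟨?_, ?_, ?_, ?_, h.graph.congr (run_narr c s (ha _ (by simp))), hH',
    h.marked.congr (run_narr c s (ha _ (by simp))), ?_⟩
  · rw [run_nreg c s (hn _ (by simp)), h.size]
  · rw [run_nreg c s (hn _ (by simp)), h.log]
  · rw [run_nreg c s (hn _ (by simp)), h.deg]
  · rw [run_nreg c s (hn _ (by simp)), h.root]
  · simpa only [State.RepWeight, run_rarr c s hr] using h.weight

/-- Changing array `2` only. -/
theorem State.Ctx.run_marked (h : s.Ctx G L d r M H) (c : Cmd) {M' : SimpleGraph (Fin n)}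
    (hn : ∀ x ∈ [0, 2, 4, 5], x ∉ c.nregs) (ha : ∀ x ∈ [0, 1], x ∉ c.narrs) (hr : 0 ∉ c.rarrs)
    (hM' : (c.run s).Rep 2 M') : (c.run s).Ctx G L d r M' H := by
  refine ⟨?_, ?_, ?_, ?_, h.graph.congr (run_narr c s (ha _ (by simp))),
    h.spanner.congr (run_narr c s (ha _ (by simp))), hM', ?_⟩
  · rw [run_nreg c s (hn _ (by simp)), h.size]
  · rw [run_nreg c s (hn _ (by simp)), h.log]
  · rw [run_nreg c s (hn _ (by simp)), h.deg]
  · rw [run_nreg c s (hn _ (by simp)), h.root]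
  · simpa only [State.RepWeight, run_rarr c s hr] using h.weight

/-- The result of selecting among the pairs with the property `P`. -/
def State.Selected (s : State) (G : WeightedGraph n) (M : SimpleGraph (Fin n)) (P : ℕ → ℕ → Prop) :
    Prop :=
  (s.nreg 10 = 0 ∧ ∀ i j : Fin n, P i j → G.graph.Adj i j → M.Adj i j) ∨
  (s.nreg 10 = 1 ∧ ∃ a b : Fin n, s.nreg 13 = a ∧ s.nreg 14 = b ∧ G.graph.Adj a b ∧ ¬ M.Adj a b ∧
    s.rreg 3 = G.w s(a, b) ∧
    ∀ i j : Fin n, P i j → G.graph.Adj i j → ¬ M.Adj i j → G.w s(a, b) ≤ G.w s(i, j))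

/-- The double loop keeps the selection correct for the pairs scanned so far. While register 10 is
zero, the first candidate is accepted whatever the weight register contains. -/
theorem selectEdge_spec (hs : s.Ctx G L d r M H) :
    (selectEdge.run s).Selected G M fun _ _ => True := by
  rw [selectEdge]
  simp only [block, run.eq_6]
  set s₁ := (nset 10 (.lit 0)).run s with hs₁
  have hc₁ : s₁.Ctx G L d r M H := hs.run _ rfl
  have main := run_for_induction (s := s₁) (i := 11) (n := n)
    (c := forN 12 (ite
      (.and (.nle (.lit 1) (.cell 0 (.reg 11) (.reg 12)))
        (.and (.nle (.cell 2 (.reg 11) (.reg 12)) (.lit 0))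
          (.or (.nle (.reg 10) (.lit 0)) (.not (.rle (.reg 3) (.cell 0 (.reg 11) (.reg 12)))))))
      ((nset 10 (.lit 1)).seq ((nset 13 (.reg 11)).seq ((nset 14 (.reg 12)).seq
        (rset 3 (.cell 0 (.reg 11) (.reg 12))))))
      skip))
    (fun k t => t.Ctx G L d r M H ∧ t.Selected G M fun i _ => i < k) hc₁.size (by decide)
    (by simp [nregs])
    ⟨hc₁.setN _ (by decide), .inl ⟨by simp [State.setN, hs₁, run, NExp.eval], by simp⟩⟩ ?_
  · rcases main.2 with ⟨h1, h2⟩ | ⟨h1, a, b, h2, h3, h4, h5, h6, h7⟩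
    · exact .inl ⟨h1, fun i j _ => h2 i j i.2⟩
    · exact .inr ⟨h1, a, b, h2, h3, h4, h5, h6, fun i j _ => h7 i j i.2⟩
  · rintro k hk t - ht11 ⟨hc, hsel⟩
    have inner := run_for_induction (s := t) (i := 12) (n := n)
      (c := ite
        (.and (.nle (.lit 1) (.cell 0 (.reg 11) (.reg 12)))
          (.and (.nle (.cell 2 (.reg 11) (.reg 12)) (.lit 0))
            (.or (.nle (.reg 10) (.lit 0)) (.not (.rle (.reg 3) (.cell 0 (.reg 11) (.reg 12)))))))
        ((nset 10 (.lit 1)).seq ((nset 13 (.reg 11)).seq ((nset 14 (.reg 12)).seq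
          (rset 3 (.cell 0 (.reg 11) (.reg 12))))))
        skip)
      (fun l t => t.Ctx G L d r M H ∧ t.nreg 11 = k ∧
        t.Selected G M fun i j => i < k ∨ i = k ∧ j < l) hc.size (by decide)
      (by simp [nregs])
      ⟨hc.setN _ (by decide), by simpa [State.setN] using ht11, by
        simpa [State.Selected, State.setN] using hsel⟩ ?_
    · refine ⟨inner.1.setN _ (by decide), ?_⟩
      have h := inner.2.2
      have hP : ∀ i j : Fin n, (i : ℕ) < k + 1 → ((i : ℕ) < k ∨ (i : ℕ) = k ∧ (j : ℕ) < n) :=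
        fun i j hi => by have := j.2; omega
      rcases h with ⟨h1, h2⟩ | ⟨h1, a, b, h2, h3, h4, h5, h6, h7⟩
      · exact .inl ⟨h1, fun i j hi => h2 i j (hP i j hi)⟩
      · exact .inr ⟨h1, a, b, h2, h3, h4, h5, h6, fun i j hi => h7 i j (hP i j hi)⟩
    · rintro l hl t - ht12 ⟨hc, ht11, hsel⟩
      refine ⟨(hc.run _ rfl).setN _ (by decide), ?_, ?_⟩
      · rw [State.setN]
        simp only [Function.update_of_ne (show (11 : ℕ) ≠ 12 by decide)]
        rw [run_nreg _ _ (by simp [nregs]), ht11]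
      have hP : ∀ i j : Fin n, ((i : ℕ) < k ∨ (i : ℕ) = k ∧ (j : ℕ) < l + 1) →
          ((i : ℕ) < k ∨ (i : ℕ) = k ∧ (j : ℕ) < l) ∨ (i = ⟨k, hk⟩ ∧ j = ⟨l, hl⟩) := by
        intro i j h
        simp only [Fin.ext_iff]
        omega
      have hG := hc.graph.le_iff ⟨k, hk⟩ ⟨l, hl⟩
      have hM := hc.marked.le_iff ⟨k, hk⟩ ⟨l, hl⟩
      have hW := hc.weight ⟨k, hk⟩ ⟨l, hl⟩
      simp only at hG hM hW
      have hM' : t.narr 2 k l ≤ 0 ↔ ¬ M.Adj ⟨k, hk⟩ ⟨l, hl⟩ := by rw [← hM]; omega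
      rw [run]
      split_ifs with hb
      · simp only [Test.or_holds, Test.Holds, NExp.eval, RExp.eval, ht11, ht12, hG, hM'] at hb
        obtain ⟨hb1, hb2, hb3⟩ := hb
        rw [hW hb1] at hb3
        refine .inr ⟨by simp [State.setN, run, NExp.eval], ⟨k, hk⟩, ⟨l, hl⟩, ?_, ?_, hb1, hb2, ?_, ?_⟩
        · simp [State.setN, run, NExp.eval, ht11]
        · simp [State.setN, run, NExp.eval, ht12]
        · simp [State.setN, run, RExp.eval, NExp.eval, ht11, ht12, hW hb1]
        · intro i j hij hadj hn
          rcases hP i j hij with hij | ⟨rfl, rfl⟩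
          · rcases hsel with ⟨h1, h2⟩ | ⟨h1, a, b, h2, h3, h4, h5, h6, h7⟩
            · exact absurd (h2 i j hij hadj) hn
            · have h8 := h7 i j hij hadj hn
              rcases hb3 with hb3 | hb3
              · omega
              · rw [h6, not_le] at hb3
                exact le_trans (by exact_mod_cast hb3.le) h8
          · exact le_rfl
      · simp only [Test.or_holds, Test.Holds, NExp.eval, RExp.eval, ht11, ht12, hG, hM'] at hb
        rcases hsel with ⟨h1, h2⟩ | ⟨h1, a, b, h2, h3, h4, h5, h6, h7⟩
        · refine .inl ⟨by simpa [State.setN, run] using h1, fun i j hij hadj => ?_⟩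
          rcases hP i j hij with hij | ⟨rfl, rfl⟩
          · exact h2 i j hij hadj
          · by_contra hcon
            exact hb ⟨hadj, hcon, .inl (by omega)⟩
        · refine .inr ⟨by simpa [State.setN, run] using h1, a, b, by simpa [State.setN, run] using h2,
            by simpa [State.setN, run] using h3, h4, h5, by simpa [State.setN, run] using h6,
            fun i j hij hadj hn => ?_⟩
          rcases hP i j hij with hij | ⟨rfl, rfl⟩
          · exact h7 i j hij hadj hn
          · by_contra! hcon
            refine hb ⟨hadj, hn, .inr ?_⟩
            rw [h6, hW hadj, not_le]
            exact_mod_cast hcon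

end Steps

end RealRAM

/-! ### Degrees, thresholds, and the decisions about an edge and about a pair -/

namespace RealRAM

open Cmd

variable {n : ℕ} {G : WeightedGraph n} {L d r : ℕ} {M H : SimpleGraph (Fin n)} {s : State}

theorem State.Rep.sum_eq (h : s.Rep 1 H) (a : Fin n) :
    ∑ c ∈ Finset.range n, s.narr 1 a c = (H.neighborSet a).ncard := by
  classical
  have hN : (H.neighborSet a).toFinset = Finset.univ.filter (H.Adj a) := by
    ext
    simp
  rw [Finset.sum_range, Set.ncard_eq_toFinset_card', hN, Finset.card_filter]
  refine Finset.sum_congr rfl fun c _ => ?_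
  by_cases hc : H.Adj a c
  · simp [hc, (h a c).1 hc]
  · simp [hc, (h a c).2 hc]

theorem degrees_spec (hs : s.Ctx G L d r M H) {a b : Fin n} (h13 : s.nreg 13 = a)
    (h14 : s.nreg 14 = b) : (degrees.run s).nreg 15 = (H.neighborSet a).ncard ∧
      (degrees.run s).nreg 16 = (H.neighborSet b).ncard := by
  rw [degrees]
  simp only [block, run.eq_6]
  rw [← hs.spanner.sum_eq a, ← hs.spanner.sum_eq b]
  set s₁ := (nset 16 (.lit 0)).run _ with hs₁
  have h0 : s₁.nreg 0 = n := by simpa [hs₁, run] using hs.size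
  have main := run_for_induction (s := s₁) (i := 17)
    (c := (nset 15 (.add (.reg 15) (.cell 1 (.reg 13) (.reg 17)))).seq
      (nset 16 (.add (.reg 16) (.cell 1 (.reg 14) (.reg 17)))))
    (fun j t => t.narr = s.narr ∧ t.nreg 13 = a ∧ t.nreg 14 = b ∧
      t.nreg 15 = ∑ c ∈ Finset.range j, s.narr 1 a c ∧
      t.nreg 16 = ∑ c ∈ Finset.range j, s.narr 1 b c) h0 (by decide) (by simp [nregs])
    ⟨by simp [State.setN, hs₁, run], by simp [State.setN, hs₁, run, h13],
      by simp [State.setN, hs₁, run, h14], by simp [State.setN, hs₁, run, NExp.eval],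
      by simp [State.setN, hs₁, run, NExp.eval]⟩ ?_
  · exact main.2.2.2
  · rintro j - t - h17 ⟨e1, e2, e3, e4, e5⟩
    refine ⟨by simp [State.setN, run, e1], by simp [State.setN, run, e2],
      by simp [State.setN, run, e3], ?_, ?_⟩
    · simp [State.setN, run, NExp.eval, e1, e2, e4, h17, Finset.sum_range_succ]
    · simp [State.setN, run, NExp.eval, e1, e3, e5, h17, Finset.sum_range_succ]

theorem edgeBound_spec (hs : s.Ctx G L d r M H) (hL : L ≤ n) :
    (edgeBound.run s).rreg 4 = (2 * L + 3 : ℕ) * s.rreg 3 := by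
  rw [edgeBound]
  simp only [block, run.eq_6]
  have h := addTimes_spec (i := 17) (k := 2) (x := 4) (e := .add (.reg 3) (.reg 3))
    (s := (rset 4 (.lit 0)).run s) (v := s.rreg 3 + s.rreg 3) (by decide) (by decide)
    (by simpa [run, hs.log, hs.size] using hL) (fun t ht => by simp [RExp.eval, ht, run])
  have h3 : ((addTimes 17 2 4 (.add (.reg 3) (.reg 3))).run ((rset 4 (.lit 0)).run s)).rreg 3 =
      s.rreg 3 := by
    rw [run_rreg _ _ (by simp [addTimes, rregs])]
    simp [run]
  rw [run.eq_3]
  simp only [RExp.eval, Function.update_self, h, h3]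
  simp only [run, RExp.eval, hs.log, Function.update_self]
  push_cast
  ring

theorem pathBound_spec (hs : s.Ctx G L d r M H) (hr : r ≤ n) :
    (pathBound.run s).rreg 5 = r * (3 * (s.rreg 4 + 8 * s.rreg 3)) := by
  rw [pathBound]
  simp only [block, run.eq_6]
  set s₁ := (rset 5 (.lit 0)).run _ with hs₁
  have h6 : s₁.rreg 6 = s.rreg 4 + 8 * s.rreg 3 := by
    simp [hs₁, run, RExp.eval]
    ring
  have h5 : s₁.rreg 5 = 0 := by simp [hs₁, run, RExp.eval]
  have hn5 : s₁.nreg 5 = r := by simpa [hs₁, run] using hs.root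
  have hn0 : s₁.nreg 0 = n := by simpa [hs₁, run] using hs.size
  have h := addTimes_spec (i := 17) (k := 5) (x := 5) (e := .add (.reg 6) (.add (.reg 6) (.reg 6)))
    (s := s₁) (v := 3 * (s.rreg 4 + 8 * s.rreg 3)) (by decide) (by decide)
    (by rw [hn5, hn0]; exact hr) (fun t ht => by
      simp only [RExp.eval, ht 6 (by decide), h6]
      ring)
  rw [h, h5, hn5, zero_add]

theorem State.Table.congr {A o u : ℕ} {t : State} (h : s.Table A o n u)
    (h1 : ∀ a ∈ [o, o + 1, o + 2, A, 1], t.narr a = s.narr a) (h2 : t.rarr o = s.rarr o)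
    (h3 : t.rarr 0 = s.rarr 0) : t.Table A o n u := by
  have e1 := h1 o (by simp)
  have e2 := h1 (o + 1) (by simp)
  have e3 := h1 (o + 2) (by simp)
  have e4 := h1 A (by simp)
  have e5 := h1 1 (by simp)
  obtain ⟨f1, f2, f3, f4, f5⟩ := h
  refine ⟨by rw [e1, f1], by rw [h2, f2], by rw [e2, f3], fun x hx hxu => by rw [e1, f4 x hx hxu],
    fun k hk x hx => ?_⟩
  have := f5 k hk x hx
  unfold State.RelaxedAt at this ⊢
  rwa [e1, e2, e3, e4, e5, h2, h3]

/-- Deciding about the selected edge. -/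
theorem insertSelected_spec {R : ℕ} (hs : s.Ctx G L d r M H) (hL : L ≤ n)
    (hI : SpannerInv G.w G.graph d (2 * L + 3) R M H) {a b : Fin n} (h13 : s.nreg 13 = a)
    (h14 : s.nreg 14 = b) (hab : G.graph.Adj a b) (hM : ¬ M.Adj a b) (h3 : s.rreg 3 = G.w s(a, b))
    (hmin : ∀ e ∈ G.graph.edgeSet, e ∉ M.edgeSet → G.w s(a, b) ≤ G.w e) :
    ∃ H', H ≤ H' ∧ (insertSelected.run s).Ctx G L d r M H' ∧
      SpannerInv G.w G.graph d (2 * L + 3) R (M ⊔ SimpleGraph.edge a b) H' ∧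
      (insertSelected.run s).rreg 4 = (2 * L + 3 : ℕ) * G.w s(a, b) := by
  rw [insertSelected]
  simp only [block, run.eq_6]
  set s₁ := degrees.run s with hs₁
  set s₂ := edgeBound.run s₁ with hs₂
  set s₃ := (nset 20 (.reg 13)).run s₂ with hs₃
  set s₄ := (shortest 1 20).run s₃ with hs₄
  have c₁ : s₁.Ctx G L d r M H := hs.run _ rfl
  have c₂ : s₂.Ctx G L d r M H := c₁.run _ rfl
  have c₃ : s₃.Ctx G L d r M H := c₂.run _ rfl
  have c₄ : s₄.Ctx G L d r M H := c₃.run _ rfl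
  have hd := degrees_spec hs h13 h14
  have h3' : s₁.rreg 3 = G.w s(a, b) := by rw [hs₁, run_rreg _ _ (by decide), h3]
  have hreg : ∀ x, x ∉ (degrees.seq (edgeBound.seq ((nset 20 (.reg 13)).seq (shortest 1 20)))).nregs →
      s₄.nreg x = s.nreg x := fun x hx =>
    run_nreg (degrees.seq (edgeBound.seq ((nset 20 (.reg 13)).seq (shortest 1 20)))) s hx
  have hreg' : ∀ x, x ∉ (edgeBound.seq ((nset 20 (.reg 13)).seq (shortest 1 20))).nregs →
      s₄.nreg x = s₁.nreg x := fun x hx =>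
    run_nreg (edgeBound.seq ((nset 20 (.reg 13)).seq (shortest 1 20))) s₁ hx
  have e13 : s₄.nreg 13 = a := by rw [hreg 13 (by decide), h13]
  have e14 : s₄.nreg 14 = b := by rw [hreg 14 (by decide), h14]
  have e15 : s₄.nreg 15 = (H.neighborSet a).ncard := by rw [hreg' 15 (by decide), hd.1]
  have e16 : s₄.nreg 16 = (H.neighborSet b).ncard := by rw [hreg' 16 (by decide), hd.2]
  have er4 : s₄.rreg 4 = (2 * L + 3 : ℕ) * G.w s(a, b) := by
    rw [hs₄, run_rreg _ _ (by decide), hs₃, run_rreg _ _ (by decide), hs₂, edgeBound_spec c₁ hL, h3']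
  have e20 : s₃.nreg 20 = a := by
    have : s₂.nreg 13 = a := by
      rw [hs₂, run_nreg _ _ (by decide), hs₁, run_nreg _ _ (by decide), h13]
    simp [hs₃, run, NExp.eval, this]
  have hT : s₄.Table 1 20 n a := shortest_spec (by decide) (by decide) c₃.size e20
  have hHG : H ≤ G.graph := hI.le.trans hI.le_graph
  have htest : (Test.or (.not (.nle (.reg 4) (.reg 15))) (.or (.not (.nle (.reg 4) (.reg 16)))
      (.or (.not (.nle (.lit 1) (.cell 20 (.reg 0) (.reg 14))))
        (.not (.rle (.cell 20 (.reg 0) (.reg 14)) (.reg 4)))))).Holds s₄ ↔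
      ((H.neighborSet a).ncard < d ∨ (H.neighborSet b).ncard < d) ∨
        ¬ dist G.w H a b ≤ (2 * L + 3 : ℕ) * G.w s(a, b) := by
    simp only [Test.or_holds, Test.Holds, NExp.eval, RExp.eval, c₄.size, c₄.deg, e14, e15, e16, er4,
      not_le, or_assoc]
    refine or_congr Iff.rfl (or_congr Iff.rfl ?_)
    rw [WeightedGraph.dist_comm]
    -- If the flag is unset, the stored length is meaningless; the distance is then infinite and the
    -- ends count as far apart.
    by_cases hf : 1 ≤ s₄.narr 20 n b
    · obtain ⟨h1, h2⟩ := hT.dist_eq c₄.spanner c₄.spanner c₄.weight hHG hf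
      rw [h1]
      have h5 : ((2 * L + 3 : ℕ) : ℝ≥0∞) * G.w s(a, b) =
          ENNReal.ofReal ((2 * L + 3 : ℕ) * G.w s(a, b)) := by
        rw [ENNReal.ofReal_mul (by positivity), ENNReal.ofReal_natCast,
          ENNReal.ofReal_coe_nnreal]
      rw [h5, ENNReal.ofReal_lt_ofReal_iff_of_nonneg (by positivity)]
      simp only [not_lt.2 hf, false_or]
    · rw [hT.dist_eq_top c₄.spanner c₄.spanner c₄.weight hHG hf]
      simp only [not_le.1 hf, true_or, true_iff]
      exact ENNReal.mul_lt_top (ENNReal.natCast_lt_top _) ENNReal.coe_lt_top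
  rw [addSelected, run]
  by_cases hb : ((H.neighborSet a).ncard < d ∨ (H.neighborSet b).ncard < d) ∨
      ¬ dist G.w H a b ≤ (2 * L + 3 : ℕ) * G.w s(a, b)
  · rw [if_pos (htest.2 hb)]
    refine ⟨H ⊔ SimpleGraph.edge a b, le_sup_left,
      c₄.run_spanner _ (by decide) (by decide) (by decide)
        (addEdge_rep c₄.spanner hab.ne e13 e14), ?_, ?_⟩
    · rcases hb with hb | hb
      · exact hI.add_light hab hM hmin (by omega) hb
      · exact hI.add_far hab hM hmin (by omega) hb
    · rw [run_rreg _ _ (by decide), er4]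
  · rw [if_neg (fun h => hb (htest.1 h))]
    push Not at hb
    exact ⟨H, le_rfl, c₄.run _ rfl, hI.mark hab hM hmin hb.1.1 hb.1.2 hb.2, er4⟩

/-- The three computations use disjoint work arrays, so the earlier tables stay valid. -/
theorem tables_spec (hs : s.Ctx G L d r M H) {u : Fin n} (h18 : s.nreg 18 = u) :
    (tables.run s).Table 0 10 n u ∧ (tables.run s).Table 1 20 n u ∧
      (tables.run s).Table 2 30 n u := by
  set t := tables.run s
  set s₀ := (nset 20 (.reg 18)).run s with hs₀
  set s₁ := (shortest 0 10).run s₀ with hs₁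
  set s₂ := (shortest 1 20).run s₁ with hs₂
  have htt : t = (shortest 2 30).run s₂ := rfl
  have c₀ : s₀.Ctx G L d r M H := hs.run _ rfl
  have c₁ : s₁.Ctx G L d r M H := c₀.run _ rfl
  have c₂ : s₂.Ctx G L d r M H := c₁.run _ rfl
  have e₀ : s₀.nreg 20 = u := by simp [hs₀, run, NExp.eval, h18]
  have e₁ : s₁.nreg 20 = u := by rw [hs₁, run_nreg _ _ (by decide), e₀]
  have e₂ : s₂.nreg 20 = u := by rw [hs₂, run_nreg _ _ (by decide), e₁]
  have t10 : s₁.Table 0 10 n u := shortest_spec (by decide) (by decide) c₀.size e₀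
  have t20 : s₂.Table 1 20 n u := shortest_spec (by decide) (by decide) c₁.size e₁
  have t30 : t.Table 2 30 n u := shortest_spec (by decide) (by decide) c₂.size e₂
  have hn1 : ∀ a ∉ (shortest 1 20).narrs, s₂.narr a = s₁.narr a := fun a ha => run_narr _ _ ha
  have hr1 : ∀ a ∉ (shortest 1 20).rarrs, s₂.rarr a = s₁.rarr a := fun a ha => run_rarr _ _ ha
  have hn2 : ∀ a ∉ (shortest 2 30).narrs, t.narr a = s₂.narr a := fun a ha => run_narr _ _ ha
  have hr2 : ∀ a ∉ (shortest 2 30).rarrs, t.rarr a = s₂.rarr a := fun a ha => run_rarr _ _ ha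
  refine ⟨t10.congr (fun a ha => ?_) ?_ ?_, t20.congr (fun a ha => hn2 a ?_) (hr2 _ (by decide))
    (hr2 _ (by decide)), t30⟩
  · have h1 : a ∉ (shortest 2 30).narrs ∧ a ∉ (shortest 1 20).narrs := by
      revert a
      decide
    rw [hn2 a h1.1, hn1 a h1.2]
  · rw [hr2 _ (by decide), hr1 _ (by decide)]
  · rw [hr2 _ (by decide), hr1 _ (by decide)]
  · revert a
    decide

/-- Buying a path between two vertices, if there is need. -/
theorem servePair_spec {R κ : ℕ} (hs : s.Ctx G L d r M H) (hR : 4 * n < R * R * d)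
    (hI : SpannerInv G.w G.graph d κ R M H) {u v : Fin n} (h18 : s.nreg 18 = u)
    (h19 : s.nreg 19 = v) {ω : ℝ≥0} (hω : ∀ e ∈ M.edgeSet, G.w e ≤ ω)
    (h5 : s.rreg 5 = (R * (8 + κ) : ℕ) * (ω : ℝ)) :
    ∃ H', H ≤ H' ∧ (servePair.run s).Ctx G L d r M H' ∧ SpannerInv G.w G.graph d κ R M H' ∧
      (dist G.w M v u ≤ dist G.w G.graph v u →
        dist G.w H' v u ≤ dist G.w G.graph v u + (R * (8 + κ) : ℕ) * ω) := by
  rw [servePair, run.eq_6]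
  set t := tables.run s with ht
  have c : t.Ctx G L d r M H := hs.run _ rfl
  have e19 : t.nreg 19 = v := by rw [ht, run_nreg _ _ (by decide), h19]
  have er5 : t.rreg 5 = (R * (8 + κ) : ℕ) * (ω : ℝ) := by rw [ht, run_rreg _ _ (by decide), h5]
  obtain ⟨T10, T20, T30⟩ := tables_spec hs h18
  rw [← ht] at T10 T20 T30
  clear_value t
  have hHG : H ≤ G.graph := hI.le.trans hI.le_graph
  have hβ : ((R * (8 + κ) : ℕ) : ℝ≥0∞) * ω = ENNReal.ofReal ((R * (8 + κ) : ℕ) * (ω : ℝ)) := by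
    rw [ENNReal.ofReal_mul (by positivity), ENNReal.ofReal_natCast, ENNReal.ofReal_coe_nnreal]
  have hβ0 : (0 : ℝ) ≤ (R * (8 + κ) : ℕ) * (ω : ℝ) := by positivity
  -- The test reads only the flag for `M`; as `M` is a subgraph of `G`, it also certifies the entry
  -- for `G`.
  have hG : 1 ≤ t.narr 30 n v → 1 ≤ t.narr 10 n v := by
    intro h
    by_contra hcon
    have h1 := T10.dist_eq_top c.graph c.spanner c.weight le_rfl hcon
    have h2 := (T30.dist_eq c.marked c.spanner c.weight hI.le_graph h).1
    have h3 := dist_mono (w := G.w) hI.le_graph v u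
    rw [h1, h2, top_le_iff] at h3
    exact ENNReal.ofReal_ne_top h3
  rw [run.eq_7]
  split_ifs with hb
  · simp only [Test.or_holds, Test.Holds, NExp.eval, RExp.eval, c.size, e19, er5] at hb
    obtain ⟨hf, hle, hbad⟩ := hb
    obtain ⟨p, H', hp1, hp2, hH', hrep⟩ := buyPath_spec T30 c.marked c.spanner c.weight hI.le_graph
      c.size e19 hf
    obtain ⟨hd1, hd2⟩ := T10.dist_eq c.graph c.spanner c.weight le_rfl (hG hf)
    have hlen : (length G.w p : ℝ≥0∞) ≤ dist G.w G.graph v u := by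
      rw [hd1, ← ENNReal.ofReal_coe_nnreal, hp1]
      exact ENNReal.ofReal_le_ofReal hle
    have hle' : H ≤ H' := fun x y h => (hH' x y).2 (.inl h)
    refine ⟨H', hle', c.run_spanner _ (by decide) (by decide) (by decide) hrep,
      hI.buy (by simpa using hR) p hlen (fun q hq => ?_) hω ?_ hH', fun _ => ?_⟩
    -- Lexicographic optimality of the table: a walk in `M` that is no longer than `p` cannot miss
    -- fewer edges.
    · have h := (T30.lexLe c.marked c.spanner c.weight hI.le_graph q).2
      rw [← hp1, ← hp2] at h
      have hq' : (length G.w q : ℝ) ≤ length G.w p := by exact_mod_cast hq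
      rcases h with h | h
      · linarith
      · exact h.2
    · rw [hβ, ← ENNReal.ofReal_coe_nnreal, hp1]
      rcases hbad with hbad | hbad
      · rw [T20.dist_eq_top c.spanner c.spanner c.weight hHG hbad, top_le_iff]
        exact ENNReal.add_ne_top.2 ⟨ENNReal.ofReal_ne_top, ENNReal.ofReal_ne_top⟩
      · by_cases hf2 : 1 ≤ t.narr 20 n v
        · have h0 : 0 ≤ t.rarr 30 n v := by rw [← hp1]; positivity
          rw [(T20.dist_eq c.spanner c.spanner c.weight hHG hf2).1, ← ENNReal.ofReal_add h0 hβ0,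
            ENNReal.ofReal_le_ofReal_iff (by positivity)]
          exact hbad
        · rw [T20.dist_eq_top c.spanner c.spanner c.weight hHG hf2, top_le_iff]
          exact ENNReal.add_ne_top.2 ⟨ENNReal.ofReal_ne_top, ENNReal.ofReal_ne_top⟩
    -- The bought walk lies in `H'` and is shortest in `G`, so no additive error is left.
    · refine le_trans ?_ le_self_add
      refine le_trans ?_ hlen
      have hsub : ∀ e ∈ p.edges, e ∈ H'.edgeSet := by
        intro e he
        induction e with
        | _ x y => exact (hH' x y).2 (.inr he)
      have := dist_le_length (w := G.w) (p.transfer H' hsub)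
      rwa [length, SimpleGraph.Walk.edges_transfer] at this
  · simp only [Test.or_holds, Test.Holds, NExp.eval, RExp.eval, c.size, e19, er5] at hb
    refine ⟨H, le_rfl, c.run _ rfl, hI, fun hd => ?_⟩
    by_cases hf : 1 ≤ t.narr 30 n v
    · obtain ⟨hM1, hM2⟩ := T30.dist_eq c.marked c.spanner c.weight hI.le_graph hf
      obtain ⟨hG1, hG2⟩ := T10.dist_eq c.graph c.spanner c.weight le_rfl (hG hf)
      have hle : t.rarr 30 n v ≤ t.rarr 10 n v := by
        rwa [hM1, hG1, ENNReal.ofReal_le_ofReal_iff hG2] at hd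
      have h2 : 1 ≤ t.narr 20 n v ∧
          t.rarr 20 n v ≤ t.rarr 30 n v + (R * (8 + κ) : ℕ) * (ω : ℝ) := by
        by_contra hcon
        exact hb ⟨hf, hle, by tauto⟩
      rw [(T20.dist_eq c.spanner c.spanner c.weight hHG h2.1).1, hβ, hG1,
        ← ENNReal.ofReal_add hG2 hβ0]
      exact ENNReal.ofReal_le_ofReal (by linarith [h2.2])
    · rw [T30.dist_eq_top c.marked c.spanner c.weight hI.le_graph hf, top_le_iff] at hd
      simp [hd]

end RealRAM

/-! ### The rounds of the algorithm -/

namespace RealRAM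

open Cmd

variable {n : ℕ} {G : WeightedGraph n} {L d r : ℕ} {M H : SimpleGraph (Fin n)} {s : State}

/-- `H` preserves the distances between the ends of shortest paths in `M`, up to `β` times the
weight of the heaviest edge. -/
def Served (G : WeightedGraph n) (β : ℕ) (M H : SimpleGraph (Fin n)) : Prop :=
  ∀ (u v : Fin n) (P : G.graph.Walk u v), (∀ e ∈ P.edges, e ∈ M.edgeSet) →
    (length G.w P : ℝ≥0∞) = dist G.w G.graph u v →
    dist G.w H u v ≤ dist G.w G.graph u v + β * heaviest G.w P

theorem le_heaviest {V : Type*} {w : Sym2 V → ℝ≥0} {K : SimpleGraph V} {u v : V} (p : K.Walk u v)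
    {e : Sym2 V} (he : e ∈ p.edges) : w e ≤ heaviest w p := by
  unfold heaviest
  generalize p.edges = l at he
  induction l with
  | nil => simp at he
  | cons f l ih =>
    rw [List.map_cons, List.foldr_cons]
    rcases List.mem_cons.1 he with rfl | he
    · exact le_max_left _ _
    · exact (ih he).trans (le_max_right _ _)

/-- `M` is fixed while `H` grows, so a pair once served remains served. -/
theorem serveAll_spec {R κ : ℕ} (hs : s.Ctx G L d r M H) (hR : 4 * n < R * R * d)
    (hI : SpannerInv G.w G.graph d κ R M H) {ω : ℝ≥0} (hω : ∀ e ∈ M.edgeSet, G.w e ≤ ω)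
    (h5 : s.rreg 5 = (R * (8 + κ) : ℕ) * (ω : ℝ)) :
    ∃ H', H ≤ H' ∧ ((forN 18 (forN 19 servePair)).run s).Ctx G L d r M H' ∧
      SpannerInv G.w G.graph d κ R M H' ∧
      ∀ u v : Fin n, dist G.w M v u ≤ dist G.w G.graph v u →
        dist G.w H' v u ≤ dist G.w G.graph v u + (R * (8 + κ) : ℕ) * ω := by
  let Good (t : State) (P : ℕ → ℕ → Prop) : Prop :=
    t.rreg 5 = (R * (8 + κ) : ℕ) * (ω : ℝ) ∧
    ∃ H', H ≤ H' ∧ t.Ctx G L d r M H' ∧ SpannerInv G.w G.graph d κ R M H' ∧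
      ∀ u v : Fin n, P u v → dist G.w M v u ≤ dist G.w G.graph v u →
        dist G.w H' v u ≤ dist G.w G.graph v u + (R * (8 + κ) : ℕ) * ω
  have main := run_for_induction (s := s) (i := 18) (n := n) (c := forN 19 servePair)
    (fun j t => Good t fun u _ => u < j) hs.size (by decide) (by decide)
    ⟨h5, H, le_rfl, hs.setN _ (by decide), hI, by simp⟩ ?_
  · obtain ⟨-, H', h1, h2, h3, h4⟩ := main
    exact ⟨H', h1, h2, h3, fun u v => h4 u v u.2⟩
  · rintro j hj t ht0 ht18 ⟨ht5, H₁, hH₁, hc₁, hI₁, hs₁⟩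
    have inner := run_for_induction (s := t) (i := 19) (n := n) (c := servePair)
      (fun l t => t.nreg 18 = j ∧ Good t fun u v => u < j ∨ u = j ∧ v < l) ht0 (by decide) (by decide)
      ⟨by simpa [State.setN] using ht18, ht5, H₁, hH₁, hc₁.setN _ (by decide), hI₁,
        by simpa using hs₁⟩ ?_
    · obtain ⟨-, e5, H', h1, h2, h3, h4⟩ := inner
      exact ⟨e5, H', h1, h2.setN _ (by decide), h3,
        fun u v hu => h4 u v (by have := v.2; omega)⟩
    · rintro l hl t - ht19 ⟨ht18, ht5, H₂, hH₂, hc₂, hI₂, hs₂⟩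
      obtain ⟨H', h1, h2, h3, h4⟩ := servePair_spec hc₂ hR hI₂ (u := ⟨j, hj⟩) (v := ⟨l, hl⟩) ht18
        ht19 hω ht5
      refine ⟨?_, ?_, H', hH₂.trans h1, h2.setN _ (by decide), h3, fun u v huv hd => ?_⟩
      · rw [State.setN]
        simp only [Function.update_of_ne (show (18 : ℕ) ≠ 19 by decide)]
        rw [run_nreg _ _ (by decide), ht18]
      · rw [State.setN]
        simp only
        rw [run_rreg _ _ (by decide), ht5]
      · by_cases huv' : (u : ℕ) < j ∨ (u : ℕ) = j ∧ (v : ℕ) < l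
        · exact (dist_mono h1 _ _).trans (hs₂ u v huv' hd)
        · obtain rfl : u = ⟨j, hj⟩ := Fin.ext (by simp only; omega)
          obtain rfl : v = ⟨l, hl⟩ := Fin.ext (by simp only; omega)
          exact h4 hd

theorem processEdge_spec (hs : s.Ctx G L d r M H) (hL : L ≤ n) (hr : r ≤ n)
    (hR : 4 * n < (3 * r) * (3 * r) * d)
    (hI : SpannerInv G.w G.graph d (2 * L + 3) (3 * r) M H)
    (hS : Served G (3 * r * (8 + (2 * L + 3))) M H) {a b : Fin n} (h13 : s.nreg 13 = a)
    (h14 : s.nreg 14 = b) (hab : G.graph.Adj a b) (hM : ¬ M.Adj a b) (h3 : s.rreg 3 = G.w s(a, b))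
    (hmin : ∀ e ∈ G.graph.edgeSet, e ∉ M.edgeSet → G.w s(a, b) ≤ G.w e) :
    ∃ H', (processEdge.run s).Ctx G L d r (M ⊔ SimpleGraph.edge a b) H' ∧
      SpannerInv G.w G.graph d (2 * L + 3) (3 * r) (M ⊔ SimpleGraph.edge a b) H' ∧
      Served G (3 * r * (8 + (2 * L + 3))) (M ⊔ SimpleGraph.edge a b) H' := by
  rw [processEdge]
  simp only [block, run.eq_6]
  obtain ⟨H₁, hle₁, hc₁, hI₁, h4⟩ := insertSelected_spec hs hL hI h13 h14 hab hM h3 hmin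
  set s₁ := insertSelected.run s with hs₁
  set s₂ := (addEdge 2 13 14).run s₁ with hs₂
  set s₃ := pathBound.run s₂ with hs₃
  have e13 : s₁.nreg 13 = a := by rw [hs₁, run_nreg _ _ (by decide), h13]
  have e14 : s₁.nreg 14 = b := by rw [hs₁, run_nreg _ _ (by decide), h14]
  have c₂ : s₂.Ctx G L d r (M ⊔ SimpleGraph.edge a b) H₁ :=
    hc₁.run_marked _ (by decide) (by decide) (by decide) (addEdge_rep hc₁.marked hab.ne e13 e14)
  have c₃ : s₃.Ctx G L d r (M ⊔ SimpleGraph.edge a b) H₁ := c₂.run _ rfl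
  have e5 : s₃.rreg 5 = (3 * r * (8 + (2 * L + 3)) : ℕ) * (G.w s(a, b) : ℝ) := by
    have e3 : s₂.rreg 3 = G.w s(a, b) := by
      rw [hs₂, run_rreg _ _ (by decide), hs₁, run_rreg _ _ (by decide), h3]
    have e4 : s₂.rreg 4 = (2 * L + 3 : ℕ) * (G.w s(a, b) : ℝ) := by
      rw [hs₂, run_rreg _ _ (by decide), h4]
    rw [hs₃, pathBound_spec c₂ hr, e4, e3]
    push_cast
    ring
  obtain ⟨H', hle', hc', hI', hserve⟩ := serveAll_spec c₃ hR hI₁ (hI.le_weight hab hM) e5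
  refine ⟨H', hc', hI', fun u v P hP hlen => ?_⟩
  -- If the new edge lies on `P`, then `M` has just come to contain `P`, and the weight used in this
  -- round is at most that of the heaviest edge of `P`. Otherwise `P` lay in the old `M`.
  by_cases hmem : s(a, b) ∈ P.edges
  · have h1 : dist G.w (M ⊔ SimpleGraph.edge a b) u v ≤ dist G.w G.graph u v := by
      have := dist_le_length (w := G.w) (P.transfer (M ⊔ SimpleGraph.edge a b) hP)
      rwa [length, SimpleGraph.Walk.edges_transfer, ← length, hlen] at this
    refine (hserve v u h1).trans ?_
    gcongr
    exact le_heaviest P hmem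
  · have h1 : ∀ e ∈ P.edges, e ∈ M.edgeSet := by
      intro e he
      rcases (mem_edgeSet_sup_edge hab.ne).1 (hP e he) with h | rfl
      · exact h
      · exact absurd he hmem
    exact (dist_mono (hle₁.trans hle') _ _).trans (hS u v P h1 hlen)

namespace Cmd

/-- One round of the algorithm. -/
def round : Cmd := .seq selectEdge (ite (.nle (.lit 1) (.reg 10)) processEdge skip)

/-- Computing the least `L` with `n ≤ 2 ^ L`, in register `2`. -/
def computeLog : Cmd :=
  block [nset 1 (.lit 1), nset 2 (.lit 0),
    forN 3 (ite (.not (.nle (.reg 0) (.reg 1)))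
      (.seq (nset 1 (.add (.reg 1) (.reg 1))) (nset 2 (.add (.reg 2) (.lit 1)))) skip)]

/-- Computing the largest `2 ^ e` with `e ≤ ε L`, in register `4`. -/
def computeDeg : Cmd :=
  block [rset 1 (.lit 0), addTimes 3 2 1 (.reg 0), nset 4 (.lit 1), rset 2 (.lit 1),
    forN 3 (ite (.rle (.reg 2) (.reg 1))
      (.seq (nset 4 (.add (.reg 4) (.reg 4))) (rset 2 (.add (.reg 2) (.lit 1)))) skip)]

/-- Computing the least `r` with `n ≤ r ^ 2 d`, in register `5`. -/
def computeRoot : Cmd :=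
  block [nset 5 (.lit 0), nset 6 (.lit 0), nset 7 (.reg 4),
    forN 3 (ite (.not (.nle (.reg 0) (.reg 6)))
      (.seq (nset 6 (.add (.reg 6) (.reg 7))) (.seq (nset 7 (.add (.reg 7) (.add (.reg 4) (.reg 4))))
        (nset 5 (.add (.reg 5) (.lit 1))))) skip)]

/-- Computing all parameters. -/
def parameters : Cmd := block [computeLog, computeDeg, computeRoot]

/-- The whole algorithm. -/
def spanner : Cmd := .seq parameters (forN 8 (forN 9 round))

end Cmd

/-- The pairs of vertices whose edge has not been marked. -/
def unmarked (G : WeightedGraph n) (M : SimpleGraph (Fin n)) : Set (Fin n × Fin n) :=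
  {p | G.graph.Adj p.1 p.2 ∧ ¬ M.Adj p.1 p.2}

/-- The invariant of the rounds. -/
def State.RoundInv (s : State) (G : WeightedGraph n) (L d r k : ℕ) : Prop :=
  ∃ M H, s.Ctx G L d r M H ∧ SpannerInv G.w G.graph d (2 * L + 3) (3 * r) M H ∧
    Served G (3 * r * (8 + (2 * L + 3))) M H ∧ (unmarked G M).ncard ≤ n * n - k

theorem round_spec (hL : L ≤ n) (hr : r ≤ n) (hR : 4 * n < (3 * r) * (3 * r) * d) {k : ℕ}
    (hs : s.RoundInv G L d r k) : (Cmd.round.run s).RoundInv G L d r (k + 1) := by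
  obtain ⟨M, H, hc, hI, hS, hcard⟩ := hs
  have hsel := selectEdge_spec hc
  have hc₁ : (selectEdge.run s).Ctx G L d r M H := hc.run _ rfl
  rw [Cmd.round, run.eq_6]
  set s₁ := selectEdge.run s
  rcases hsel with ⟨h1, h2⟩ | ⟨h1, a, b, h2, h3, h4, h5, h6, h7⟩
  · have hb : ¬ (Test.nle (.lit 1) (.reg 10)).Holds s₁ := by simp [Test.Holds, NExp.eval, h1]
    rw [run.eq_7, if_neg hb]
    refine ⟨M, H, hc₁, hI, hS, ?_⟩
    have : unmarked G M = ∅ := by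
      ext p
      simp only [unmarked, Set.mem_ofPred_eq, Set.mem_empty_iff_false, iff_false, not_and, not_not]
      exact h2 p.1 p.2 trivial
    simp [this]
  · have hb : (Test.nle (.lit 1) (.reg 10)).Holds s₁ := by simp [Test.Holds, NExp.eval, h1]
    rw [run.eq_7, if_pos hb]
    obtain ⟨H', e1, e2, e3⟩ := processEdge_spec hc₁ hL hr hR hI hS h2 h3 h4 h5 h6 (fun e he hn => by
      induction e with
      | _ x y => exact h7 x y trivial he hn)
    refine ⟨_, H', e1, e2, e3, ?_⟩
    have hlt : (unmarked G (M ⊔ SimpleGraph.edge a b)).ncard < (unmarked G M).ncard := by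
      refine Set.ncard_lt_ncard ⟨fun p hp => ⟨hp.1, fun h => hp.2 (Or.inl h)⟩, fun hcon => ?_⟩
        (Set.toFinite _)
      exact (hcon (show (a, b) ∈ unmarked G M from ⟨h4, h5⟩)).2 ((adj_sup_edge h4.ne).2 (.inr rfl))
    omega

/-- There are at most n² unmarked ordered pairs, and every round removes one as long as any is left.
-/
theorem rounds_spec (hL : L ≤ n) (hr : r ≤ n) (hR : 4 * n < (3 * r) * (3 * r) * d)
    (hn : s.nreg 0 = n) (hs : s.RoundInv G L d r 0) :
    ((forN 8 (forN 9 Cmd.round)).run s).RoundInv G L d r (n * n) := by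
  have setN : ∀ {t : State} {k x : ℕ} (y : ℕ), x ∉ [0, 2, 4, 5] → t.RoundInv G L d r k →
      (t.setN x y).RoundInv G L d r k := by
    rintro t k x y hx ⟨M, H, h1, h2⟩
    exact ⟨M, H, h1.setN _ hx, h2⟩
  refine run_for_induction (fun j t => t.RoundInv G L d r (j * n)) hn (by decide) (by decide)
    (by simpa using setN 0 (by decide) hs) ?_
  intro j hj t ht0 _ ht
  have inner := run_for_induction (s := t) (i := 9) (n := n) (c := Cmd.round)
    (fun l t => t.RoundInv G L d r (j * n + l)) ht0 (by decide) (by decide)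
    (setN 0 (by decide) ht) (fun l hl t _ _ ht => setN _ (by decide) (round_spec hL hr hR ht))
  have := setN (x := 8) (j + 1) (by decide) inner
  rwa [← Nat.succ_mul] at this

end RealRAM

/-! ### The parameters -/

namespace RealRAM

open Cmd

/-- The doubling reaches `n` within `n` rounds because n < 2^n. -/
theorem computeLog_spec {n : ℕ} {s : State} (hn : s.nreg 0 = n) :
    n ≤ 2 ^ (computeLog.run s).nreg 2 ∧
      ((computeLog.run s).nreg 2 = 0 ∨ 2 ^ ((computeLog.run s).nreg 2 - 1) < n) ∧
      (computeLog.run s).nreg 2 ≤ n := by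
  rw [computeLog]
  simp only [block, run.eq_6]
  have := run_for_induction (s := (nset 2 (.lit 0)).run ((nset 1 (.lit 1)).run s)) (i := 3)
    (c := ite (.not (.nle (.reg 0) (.reg 1)))
      (.seq (nset 1 (.add (.reg 1) (.reg 1))) (nset 2 (.add (.reg 2) (.lit 1)))) skip)
    (fun j t => t.nreg 1 = 2 ^ t.nreg 2 ∧ (t.nreg 2 = 0 ∨ 2 ^ (t.nreg 2 - 1) < n) ∧
      (n ≤ 2 ^ t.nreg 2 ∨ t.nreg 2 = j) ∧ t.nreg 2 ≤ j) (n := n) (by simp [run, hn]) (by decide)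
    (by decide) (by simp [State.setN, run, NExp.eval]) ?_
  · obtain ⟨-, h2, h3, h4⟩ := this
    refine ⟨?_, h2, h4⟩
    rcases h3 with h3 | h3
    · exact h3
    · rw [h3]
      exact Nat.lt_two_pow_self.le
  · rintro j hj t ht0 - ⟨h1, h2, h3, h4⟩
    by_cases hb : n ≤ 2 ^ t.nreg 2
    · have hb' : ¬ (Test.not (.nle (.reg 0) (.reg 1))).Holds t := by
        simpa [Test.Holds, NExp.eval, ht0, h1] using hb
      rw [run, if_neg hb']
      exact ⟨by simp [State.setN, run, h1], by simpa [State.setN, run] using h2, .inl hb,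
        by simp [State.setN, run]; omega⟩
    · have hb' : (Test.not (.nle (.reg 0) (.reg 1))).Holds t := by
        simpa [Test.Holds, NExp.eval, ht0, h1] using hb
      rw [run, if_pos hb']
      refine ⟨by simp [State.setN, run, NExp.eval, h1, pow_succ, mul_two], .inr ?_, .inr ?_, ?_⟩
      · simpa [State.setN, run, NExp.eval] using hb
      · simp [State.setN, run, NExp.eval]; omega
      · simp [State.setN, run, NExp.eval]; omega

theorem computeDeg_spec {n L : ℕ} {s : State} {ε : ℝ} (hn : s.nreg 0 = n) (hL : s.nreg 2 = L)
    (hLn : L ≤ n) (hε : s.rreg 0 = ε) (h0 : 0 ≤ ε) (h1 : ε ≤ 1) :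
    ∃ e : ℕ, (computeDeg.run s).nreg 4 = 2 ^ e ∧ (e : ℝ) ≤ ε * L ∧ ε * L < e + 1 := by
  rw [computeDeg]
  simp only [block, run.eq_6]
  have hx : ((addTimes 3 2 1 (.reg 0)).run ((rset 1 (.lit 0)).run s)).rreg 1 = ε * L := by
    rw [addTimes_spec (v := ε) (by decide) (by decide) (by simp [run, hn, hL, hLn])
      (fun t ht => by simp [RExp.eval, ht 0, run, hε])]
    simp [run, RExp.eval, hL, mul_comm]
  have hn' : ((addTimes 3 2 1 (.reg 0)).run ((rset 1 (.lit 0)).run s)).nreg 0 = n := by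
    rw [run_nreg _ _ (by decide), run_nreg _ _ (by decide), hn]
  set s' := (addTimes 3 2 1 (.reg 0)).run ((rset 1 (.lit 0)).run s)
  have hLn' : ε * L ≤ n := by
    have : (L : ℝ) ≤ n := by exact_mod_cast hLn
    nlinarith [(Nat.cast_nonneg L : (0 : ℝ) ≤ L)]
  have := run_for_induction (s := (rset 2 (.lit 1)).run ((nset 4 (.lit 1)).run s')) (i := 3)
    (c := ite (.rle (.reg 2) (.reg 1))
      (.seq (nset 4 (.add (.reg 4) (.reg 4))) (rset 2 (.add (.reg 2) (.lit 1)))) skip)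
    (fun j t => t.rreg 1 = ε * L ∧ ∃ e : ℕ, t.nreg 4 = 2 ^ e ∧ t.rreg 2 = e + 1 ∧ (e : ℝ) ≤ ε * L ∧
      (ε * L < e + 1 ∨ e = j)) (n := n) (by simp [run, hn']) (by decide)
    (by decide) ⟨by simp [State.setN, run, hx], 0, by simp [State.setN, run, NExp.eval],
      by simp [State.setN, run, RExp.eval], by push_cast; positivity, .inr rfl⟩ ?_
  · obtain ⟨-, e, h2, -, h3, h4⟩ := this
    refine ⟨e, h2, h3, ?_⟩
    -- If every round raised the exponent, it equals `n`, and εL ≤ n < n + 1.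
    rcases h4 with h4 | rfl
    · exact h4
    · linarith
  · rintro j hj t - - ⟨h1, e, h2, h3, h4, h5⟩
    by_cases hb : (e : ℝ) + 1 ≤ ε * L
    · have hb' : (Test.rle (.reg 2) (.reg 1)).Holds t := by
        simpa [Test.Holds, RExp.eval, h1, h3] using hb
      rw [run, if_pos hb']
      refine ⟨by simp [State.setN, run, h1], e + 1,
        by simp [State.setN, run, NExp.eval, h2, pow_succ, mul_two],
        by simp [State.setN, run, RExp.eval, h3], by push_cast; exact hb, .inr ?_⟩
      rcases h5 with h5 | rfl
      · exact absurd hb (not_le.2 h5)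
      · rfl
    · have hb' : ¬ (Test.rle (.reg 2) (.reg 1)).Holds t := by
        simpa [Test.Holds, RExp.eval, h1, h3] using hb
      rw [run, if_neg hb']
      exact ⟨by simp [State.setN, run, h1], e, by simp [State.setN, run, h2],
        by simp [State.setN, run, h3], h4, .inl (not_le.1 hb)⟩

/-- Squares without multiplication: register 6 holds r²d, and register 7 the difference (2r + 1)d to
the next value. -/
theorem computeRoot_spec {n d : ℕ} {s : State} (hn : s.nreg 0 = n) (hd : s.nreg 4 = d)
    (hd0 : 1 ≤ d) :
    ∃ r, (computeRoot.run s).nreg 5 = r ∧ n ≤ r ^ 2 * d ∧ (r = 0 ∨ (r - 1) ^ 2 * d < n) ∧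
      r ≤ n := by
  rw [computeRoot]
  simp only [block, run.eq_6]
  have := run_for_induction
    (s := (nset 7 (.reg 4)).run ((nset 6 (.lit 0)).run ((nset 5 (.lit 0)).run s))) (i := 3)
    (c := ite (.not (.nle (.reg 0) (.reg 6)))
      (.seq (nset 6 (.add (.reg 6) (.reg 7))) (.seq (nset 7 (.add (.reg 7) (.add (.reg 4) (.reg 4))))
        (nset 5 (.add (.reg 5) (.lit 1))))) skip)
    (fun j t => t.nreg 4 = d ∧ ∃ r, t.nreg 5 = r ∧ t.nreg 6 = r ^ 2 * d ∧
      t.nreg 7 = (2 * r + 1) * d ∧ (r = 0 ∨ (r - 1) ^ 2 * d < n) ∧ (n ≤ r ^ 2 * d ∨ r = j) ∧ r ≤ j)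
    (n := n) (by simp [run, hn]) (by decide) (by decide)
    ⟨by simp [State.setN, run, hd], 0, by simp [State.setN, run, NExp.eval, hd]⟩ ?_
  · obtain ⟨-, r, h1, -, -, h2, h3, h4⟩ := this
    refine ⟨r, h1, ?_, h2, h4⟩
    rcases h3 with h3 | rfl
    · exact h3
    · nlinarith [Nat.le_self_pow two_ne_zero r]
  · rintro j hj t ht0 - ⟨h0, r, h1, h2, h3, h4, h5, h6⟩
    by_cases hb : n ≤ r ^ 2 * d
    · have hb' : ¬ (Test.not (.nle (.reg 0) (.reg 6))).Holds t := by
        simpa [Test.Holds, NExp.eval, ht0, h2] using hb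
      rw [run, if_neg hb']
      exact ⟨by simp [State.setN, run, h0], r, by simp [State.setN, run, h1],
        by simp [State.setN, run, h2], by simp [State.setN, run, h3], h4, .inl hb, by omega⟩
    · have hb' : (Test.not (.nle (.reg 0) (.reg 6))).Holds t := by
        simpa [Test.Holds, NExp.eval, ht0, h2] using hb
      rw [run, if_pos hb']
      refine ⟨by simp [State.setN, run, h0], r + 1, by simp [State.setN, run, NExp.eval, h1], ?_, ?_,
        .inr ?_, .inr ?_, by omega⟩
      · simp [State.setN, run, NExp.eval, h2, h3]; ring
      · simp [State.setN, run, NExp.eval, h0, h3]; ring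
      · simpa using hb
      · omega

/-- The relations between the parameters that the algorithm computes. -/
structure Parameters (n : ℕ) (ε : ℝ) (L e r : ℕ) : Prop where
  le_two_pow : n ≤ 2 ^ L
  two_pow_lt : L = 0 ∨ 2 ^ (L - 1) < n
  log_le : L ≤ n
  exp_le : (e : ℝ) ≤ ε * L
  lt_exp : ε * L < e + 1
  le_sq : n ≤ r ^ 2 * 2 ^ e
  sq_lt : r = 0 ∨ (r - 1) ^ 2 * 2 ^ e < n
  root_le : r ≤ n

/-! ### Numerical estimates -/

namespace Parameters

variable {n L e r : ℕ} {ε : ℝ}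

theorem two_pow_le (h : Parameters n ε L e r) (hn : 1 ≤ n) : (2 : ℝ) ^ L ≤ 2 * n := by
  have : 2 ^ L ≤ 2 * n := by
    rcases h.two_pow_lt with h0 | h0
    · simp [h0]; omega
    · have h1 : 2 ^ L ≤ 2 * 2 ^ (L - 1) := by
        rw [← pow_succ']
        exact Nat.pow_le_pow_right (by norm_num) (by omega)
      omega
  exact_mod_cast this

theorem deg_le (h : Parameters n ε L e r) (hn : 1 ≤ n) (h0 : 0 ≤ ε) (h1 : ε ≤ 1) :
    (2 : ℝ) ^ e ≤ 2 * (n : ℝ) ^ ε := by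
  calc (2 : ℝ) ^ e = (2 : ℝ) ^ (e : ℝ) := (Real.rpow_natCast _ _).symm
    _ ≤ (2 : ℝ) ^ (L * ε) := Real.rpow_le_rpow_of_exponent_le (by norm_num) (by linarith [h.exp_le])
    _ = ((2 : ℝ) ^ L) ^ ε := by rw [Real.rpow_mul (by norm_num), Real.rpow_natCast]
    _ ≤ (2 * n) ^ ε := Real.rpow_le_rpow (by positivity) (h.two_pow_le hn) h0
    _ = 2 ^ ε * (n : ℝ) ^ ε := Real.mul_rpow (by norm_num) (by positivity)
    _ ≤ 2 ^ (1 : ℝ) * (n : ℝ) ^ ε := by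
      gcongr
      norm_num
    _ = 2 * (n : ℝ) ^ ε := by rw [Real.rpow_one]

theorem le_deg (h : Parameters n ε L e r) (h0 : 0 ≤ ε) : (n : ℝ) ^ ε ≤ 2 * 2 ^ e := by
  have hn : (n : ℝ) ≤ 2 ^ L := by exact_mod_cast h.le_two_pow
  calc (n : ℝ) ^ ε ≤ ((2 : ℝ) ^ L) ^ ε := Real.rpow_le_rpow (by positivity) hn h0
    _ = (2 : ℝ) ^ (L * ε) := by rw [Real.rpow_mul (by norm_num), Real.rpow_natCast]
    _ ≤ (2 : ℝ) ^ ((e + 1 : ℕ) : ℝ) :=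
      Real.rpow_le_rpow_of_exponent_le (by norm_num) (by push_cast; linarith [h.lt_exp])
    _ = 2 * 2 ^ e := by rw [Real.rpow_natCast, pow_succ']

/-- Let x = n^((1-ε)/2), so x² n^ε = n. If r - 1 ≥ 2x, minimality of r gives 4x² 2^e < n = x² n^ε ≤
2x² 2^e, which is absurd; so r < 2x + 1 ≤ 3x. -/
theorem root_le_rpow (h : Parameters n ε L e r) (hn : 1 ≤ n) (h0 : 0 ≤ ε) (h1 : ε ≤ 1) :
    (r : ℝ) ≤ 3 * (n : ℝ) ^ ((1 - ε) / 2) := by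
  have hn' : (1 : ℝ) ≤ n := by exact_mod_cast hn
  set x := (n : ℝ) ^ ((1 - ε) / 2) with hx
  have hx1 : 1 ≤ x := Real.one_le_rpow hn' (by linarith)
  have hx2 : x ^ 2 * (n : ℝ) ^ ε = n := by
    rw [hx, ← Real.rpow_natCast, ← Real.rpow_mul (by positivity), ← Real.rpow_add (by positivity)]
    norm_num
  rcases h.sq_lt with hr | hr
  · simp [hr]; linarith
  · rcases Nat.eq_zero_or_pos r with rfl | hr0
    · simp; linarith
    obtain ⟨m, rfl⟩ : ∃ m, r = m + 1 := ⟨r - 1, by omega⟩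
    have hr' : (m : ℝ) ^ 2 * 2 ^ e < n := by
      simp only [Nat.add_sub_cancel] at hr
      exact_mod_cast hr
    have hm : (m : ℝ) < 2 * x := by
      by_contra! hcon
      have h2 : (0 : ℝ) < 2 ^ e := by positivity
      have h3 : (2 * x) ^ 2 ≤ (m : ℝ) ^ 2 := by gcongr
      have h4 := h.le_deg h0
      have h5 : x ^ 2 * (n : ℝ) ^ ε ≤ x ^ 2 * (2 * 2 ^ e) := by gcongr
      have h6 : (2 * x) ^ 2 * 2 ^ e ≤ (m : ℝ) ^ 2 * 2 ^ e := by gcongr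
      have h7 : 0 < x ^ 2 * (2 : ℝ) ^ e := by positivity
      nlinarith
    push_cast
    linarith

/-- As L ≤ 1 + log₂ n and log₂ n ≥ 1, the left side is at most 15 log₂ n, and 15 / log 2 < 22. -/
theorem log_le_log (h : Parameters n ε L e r) (hn : 2 ≤ n) : (2 * L + 11 : ℝ) ≤ 22 * Real.log n := by
  have hn' : (2 : ℝ) ≤ n := by exact_mod_cast hn
  have h1 : L * Real.log 2 ≤ Real.log 2 + Real.log n := by
    rw [← Real.log_pow, ← Real.log_mul (by norm_num) (by positivity)]
    exact Real.log_le_log (by positivity) (h.two_pow_le (by omega))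
  have h2 : Real.log 2 ≤ Real.log n := Real.log_le_log (by norm_num) hn'
  have h3 := Real.log_two_gt_d9
  nlinarith [(Nat.cast_nonneg L : (0 : ℝ) ≤ L)]

/-- The three terms contribute at most 2, 3 and 81 times n^(1+ε), the last one because r² ≤
9n^(1-ε). -/
theorem size_le (h : Parameters n ε L e r) (hn : 1 ≤ n) (h0 : 0 ≤ ε) (h1 : ε ≤ 1) :
    ((n * (2 ^ e + 3) + (3 * r) ^ 2 : ℕ) : ℝ) ≤ 200 * (n : ℝ) ^ (1 + ε) := by
  have hn' : (1 : ℝ) ≤ n := by exact_mod_cast hn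
  have a1 := h.deg_le hn h0 h1
  have a2 := h.root_le_rpow hn h0 h1
  have a3 : (r : ℝ) ^ 2 ≤ 9 * (n : ℝ) ^ (1 + ε) := by
    calc (r : ℝ) ^ 2 ≤ (3 * (n : ℝ) ^ ((1 - ε) / 2)) ^ 2 := by gcongr
      _ = 9 * (n : ℝ) ^ (1 - ε) := by
        rw [mul_pow, ← Real.rpow_natCast ((n : ℝ) ^ _), ← Real.rpow_mul (by positivity)]
        norm_num
      _ ≤ 9 * (n : ℝ) ^ (1 + ε) := by
        gcongr
        linarith
  have a4 : (n : ℝ) * (n : ℝ) ^ ε = (n : ℝ) ^ (1 + ε) := by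
    rw [Real.rpow_add (by positivity), Real.rpow_one]
  have a5 : (n : ℝ) ≤ (n : ℝ) ^ (1 + ε) := by
    conv_lhs => rw [← Real.rpow_one (n : ℝ)]
    exact Real.rpow_le_rpow_of_exponent_le hn' (by linarith)
  have a6 : (n : ℝ) * 2 ^ e ≤ n * (2 * (n : ℝ) ^ ε) := by gcongr
  push_cast
  nlinarith

theorem stretch_le (h : Parameters n ε L e r) (hn : 2 ≤ n) (h0 : 0 ≤ ε) (h1 : ε ≤ 1) :
    ((3 * r * (8 + (2 * L + 3)) : ℕ) : ℝ) ≤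
      200 * (n : ℝ) ^ ((1 - ε) / 2) * Real.log n := by
  have a1 := h.root_le_rpow (by omega) h0 h1
  have a2 := h.log_le_log hn
  have a3 : 0 ≤ (n : ℝ) ^ ((1 - ε) / 2) := by positivity
  have a4 : 0 ≤ Real.log n := Real.log_natCast_nonneg n
  calc ((3 * r * (8 + (2 * L + 3)) : ℕ) : ℝ) = 3 * r * (2 * L + 11) := by push_cast; ring
    _ ≤ 3 * (3 * (n : ℝ) ^ ((1 - ε) / 2)) * (22 * Real.log n) := by gcongr
    -- The product of the constants is 3 · 3 · 22 = 198.
    _ ≤ 200 * (n : ℝ) ^ ((1 - ε) / 2) * Real.log n := by nlinarith [mul_nonneg a3 a4]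

end Parameters

theorem served_bot {n : ℕ} (G : WeightedGraph n) (β : ℕ) : Served G β ⊥ ⊥ := by
  intro u v P hP _
  cases P with
  | nil => simp [WeightedGraph.dist_self]
  | cons h p => exact absurd (hP _ (List.mem_cons_self ..)) (by simp)

theorem parameters_spec {n : ℕ} (G : WeightedGraph n) {ε : ℝ} (h0 : 0 ≤ ε) (h1 : ε ≤ 1) :
    ∃ L e r, Parameters n ε L e r ∧
      (Cmd.parameters.run (input G ε)).Ctx G L (2 ^ e) r ⊥ ⊥ := by
  have hn : (input G ε).nreg 0 = n := by simp [input]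
  have hlog := computeLog_spec hn
  set s₁ := computeLog.run (input G ε) with hs₁
  have n₁ : s₁.nreg 0 = n := by rw [hs₁, run_nreg _ _ (by decide), hn]
  obtain ⟨e, he1, he2, he3⟩ := computeDeg_spec n₁ rfl hlog.2.2
    (by rw [hs₁, run_rreg _ _ (by decide)]; simp [input]) h0 h1
  set s₂ := computeDeg.run s₁ with hs₂
  have n₂ : s₂.nreg 0 = n := by rw [hs₂, run_nreg _ _ (by decide), n₁]
  obtain ⟨r, hr1, hr2, hr3, hr4⟩ := computeRoot_spec n₂ he1 Nat.one_le_two_pow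
  have hrun : Cmd.parameters.run (input G ε) = computeRoot.run s₂ := by
    simp only [Cmd.parameters, block, run.eq_6, hs₁, hs₂]
  have harr : ∀ A, (Cmd.parameters.run (input G ε)).narr A = (input G ε).narr A := fun A =>
    run_narr _ _ (by simp [Cmd.parameters, computeLog, computeDeg, computeRoot, addTimes, block, narrs])
  refine ⟨s₁.nreg 2, e, r, ⟨hlog.1, hlog.2.1, hlog.2.2, he2, he3, hr2, hr3, hr4⟩,
    ?_, ?_, ?_, ?_, ?_, ?_, ?_, ?_⟩
  · rw [run_nreg _ _ (by decide), hn]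
  · rw [hrun, run_nreg _ _ (by decide), hs₂, run_nreg _ _ (by decide)]
  · rw [hrun, run_nreg _ _ (by decide), he1]
  · rw [hrun, hr1]
  · intro i j
    rw [harr]
    simp +contextual [input]
  · intro i j
    rw [harr]
    simp [input]
  · intro i j
    rw [harr]
    simp [input]
  · intro i j hij
    rw [run_rarr _ _ (by decide)]
    simp [input, hij]

theorem spanner_spec {n : ℕ} (hn : 1 ≤ n) (G : WeightedGraph n) {ε : ℝ} (h0 : 0 ≤ ε) (h1 : ε ≤ 1) :
    ∃ H : SimpleGraph (Fin n), Outputs (Cmd.spanner.run (input G ε)) H ∧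
      G.IsAdditiveSpanner H (200 * (n : ℝ) ^ ((1 - ε) / 2) * Real.log n) ∧
      (H.edgeSet.ncard : ℝ) ≤ 200 * (n : ℝ) ^ (1 + ε) := by
  obtain ⟨L, e, r, hp, hc⟩ := parameters_spec G h0 h1
  -- 9r²d ≥ 9n > 4n; this uses n ≥ 1.
  have hR : 4 * n < (3 * r) * (3 * r) * 2 ^ e := by
    have := hp.le_sq
    nlinarith
  obtain ⟨M, H, hc', hI, hS, hcard⟩ := rounds_spec hp.log_le hp.root_le hR hc.size
    ⟨⊥, ⊥, hc, .bot, served_bot G _, by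
      simpa using Set.ncard_le_card (unmarked G ⊥)⟩
  have hrun : Cmd.spanner.run (input G ε) =
      (forN 8 (forN 9 Cmd.round)).run (Cmd.parameters.run (input G ε)) := by
    rw [Cmd.spanner, run.eq_6]
  have hempty : unmarked G M = ∅ := by
    rw [Nat.sub_self, Nat.le_zero, Set.ncard_eq_zero] at hcard
    exact hcard
  have hM : G.graph ≤ M := by
    intro a b hab
    by_contra hcon
    exact (hempty ▸ (⟨hab, hcon⟩ : (a, b) ∈ unmarked G M) : (a, b) ∈ (∅ : Set (Fin n × Fin n)))
  refine ⟨H, hrun ▸ hc'.spanner, ⟨hI.le.trans hI.le_graph, fun u v P hP => ?_⟩, ?_⟩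
  -- Equal ends are treated apart: for n = 1 the logarithm vanishes, and `stretch_le` needs n ≥ 2.
  · rcases eq_or_ne u v with rfl | huv
    · simp [WeightedGraph.dist_self]
    · have hn2 : 2 ≤ n := by
        have := u.2
        have := v.2
        have : (u : ℕ) ≠ v := fun h => huv (Fin.ext h)
        omega
      refine (hS u v P (fun e he => SimpleGraph.edgeSet_mono hM (P.edges_subset_edgeSet he))
        hP.2).trans ?_
      gcongr
      rw [← ENNReal.ofReal_natCast]
      exact ENNReal.ofReal_le_ofReal (hp.stretch_le hn2 h0 h1)
  · refine le_trans ?_ (hp.size_le hn h0 h1)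
    -- Taking k = L + 1 makes n < 2^k strict, and then κ = 2k + 1 exactly.
    have := hI.ncard_edgeSet_le (by simpa using hR) (k := L + 1)
      (by simpa using lt_of_le_of_lt hp.le_two_pow (Nat.pow_lt_pow_right (by norm_num) (by omega)))
      (by omega)
    rw [Fintype.card_fin] at this
    exact_mod_cast this

end RealRAM

theorem mainTheorem2 :
    ∃ (A : RealRAM.Program) (T : Polynomial ℕ) (C : ℝ), 0 < C ∧
      ∀ (n : ℕ) (G : WeightedGraph n) (ε : ℝ), 0 ≤ ε → ε ≤ 1 →
        ∃ (k : ℕ) (t : RealRAM.State) (H : SimpleGraph (Fin n)),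
          RealRAM.Exec A (RealRAM.input G ε) k t ∧ k ≤ T.eval n ∧ RealRAM.Outputs t H ∧
          G.IsAdditiveSpanner H (C * (n : ℝ) ^ ((1 - ε) / 2) * Real.log n) ∧
          (H.edgeSet.ncard : ℝ) ≤ C * (n : ℝ) ^ (1 + ε) := by
  refine ⟨RealRAM.Cmd.spanner.compile, RealRAM.Cmd.spanner.costPoly, 200, by norm_num,
    fun n G ε h0 h1 => ?_⟩
  obtain ⟨k, hk, hexec⟩ := RealRAM.Cmd.spanner.exec_compile rfl (by decide) (RealRAM.input G ε)
  rw [show (RealRAM.input G ε).nreg 0 = n by simp [RealRAM.input]] at hk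
  -- For n = 0 the strict inequality 4n < 9r²d fails, but all claims are trivial.
  rcases Nat.eq_zero_or_pos n with rfl | hn
  · refine ⟨k, _, ⊥, hexec, hk, fun i => i.elim0, ⟨bot_le, fun u => u.elim0⟩, ?_⟩
    simp only [SimpleGraph.edgeSet_bot, Set.ncard_empty, Nat.cast_zero]
    positivity
  · obtain ⟨H, hH⟩ := RealRAM.spanner_spec hn G h0 h1
    exact ⟨k, _, H, hexec, hk, hH⟩
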